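/- **Notation.** $(a)_m=a(a+1)\cdots(a+m-1)$ (with $(a)_0=1$), $(-1)!!=1$. For $\mathbf d=(d_1,\dots,d_n)\in(\mathbb Z_{\ge0})^n$, $n\ge1$, put $|\mathbf d|=\sum_j d_j$, $g(\mathbf d)=|\mathbf d|+1$ and $X(\mathbf d)=\sum_{j}(2d_j+1)$. The Brézin–Gross–Witten numbers $\langle\tau_{d_1}\cdots\tau_{d_n}\rangle^{\Theta}$ are the rational numbers for which $B(\mathbf d)=\langle\tau_{d_1}\cdots\tau_{d_n}\rangle^{\Theta}\prod_{j}(2d_j+1)!!$ is determined by $B(0)=\tfrac18$ and, for $d\ge0$ and $\mathbf d=(d_1,\dots,d_n)$, $n\ge0$, $(d,\mathbf d)\ne(0)$, by $$B(d,\mathbf d)=\sum_{i=1}^n(2d_i+1)\,B(d_1,\dots,d_i+d,\dots,d_n)+\frac12\sum_{a+b=d-1}\Bigl(B(a,b,\mathbf d)+\sum_{I\sqcup J=\{1,\dots,n\}}B(a,\mathbf d_I)\,B(b,\mathbf d_J)\Bigr).$$ Put $$C(\mathbf d)=\frac{2^{2g(\mathbf d)-1}\prod_j(2d_j+1)!!}{(X(\mathbf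 d)-1)!}\,\langle\tau_{d_1}\cdots\tau_{d_n}\rangle^{\Theta},\qquad \gamma(X)=\frac{\Gamma(\frac X2+1)^2}{\pi\,\Gamma(\frac{X+1}2)\,\Gamma(\frac{X+3}2)},$$ and $\widehat C(\mathbf d)=C(\mathbf d)/\gamma(X(\mathbf d))$ for $d_1,\dots,d_n\ge1$. **Proposition.** Let $d\ge1$ be an integer. There is a unique power series $W_d(X)\in X^{-2d-2}\,\mathbb Q[[X^{-1}]]$ which is an asymptotic expansion, to all orders in $X^{-1}$, $$1-\widehat C\bigl(d,\tfrac X2-1-d\bigr)\sim W_d(X)$$ as $X\to\infty$ through the even integers (it is unique even among all power series in $\mathbb R[[X^{-1}]]$), and it is given by $$W_d(X)=\frac{(2d+1)!!^3}{2^{d+1}\,d!}\sum_{j\ge1}\frac{A_j(d)}{d+j}\,\frac1{(X-2d-j+1)_{2d+2j}},$$ where the inverse Pochhammer symbols are interpreted as elements of $\mathbb Q[[X^{-1}]]$. Here the $A_j$ $(j\ge1)$ are polynomials with rational coefficients whose values at the integers $d\ge1$ are determined uniquely by the identity $$2^{-2d-4}\,\frac{\Gamma\bigl(\frac{X+1}2-d\bigr)^3\,\Gamma\bigl(\frac{X+3}2\bigr)}{\Gamma\bigl(\frac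 X2+2\bigr)^3\,\Gamma\bigl(\frac X2-d+1\bigr)}=\sum_{j\ge1}\frac{A_j(d)}{(X-2d-j+1)_{2d+2j+2}},$$ in which both sides are interpreted as power series in $X^{-1}$ with rational coefficients, the left-hand side through its asymptotic expansion as $X\to+\infty$. More explicitly, $$A_j(d)=(-1)^{j-1}\,(j-1)!\sum_{0\le l\le[\frac{j+1}2]}\frac{(2l-1)!!}{8^l\,l!^3}\,(j-2l)_{2l}\,\bigl(d+\tfrac32-l\bigr)_{j-1}.$$ -/

import Mathlib

open scoped Nat

namespace BGW

/-- `X(d₁,…,dₙ) = ∑ (2 dⱼ + 1)`, which equals `2g - 2 + n` with `g = d₁ + ⋯ + dₙ + 1`. -/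
def bigX (l : List ℕ) : ℕ := (l.map fun k => 2 * k + 1).sum

/-- The entries of the list `l` at the positions in `I`, in their order. -/
def pick (l : List ℕ) (I : Finset (Fin l.length)) : List ℕ :=
  ((List.finRange l.length).filter (· ∈ I)).map l.get

theorem bigX_cons (d : ℕ) (l : List ℕ) : bigX (d :: l) = 2 * d + 1 + bigX l := by
  simp [bigX]

theorem bigX_pick_le (l : List ℕ) (I : Finset (Fin l.length)) : bigX (pick l I) ≤ bigX l := by
  have h : List.Sublist (pick l I) l := by
    have h1 : List.Sublist (pick l I) ((List.finRange l.length).map l.get) :=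
      (List.filter_sublist (p := fun i => decide (i ∈ I))).map _
    rwa [List.map_get_finRange] at h1
  exact (h.map _).sum_le_sum (fun _ _ => Nat.zero_le _)

theorem bigX_set_lt (d : ℕ) (l : List ℕ) (i : Fin l.length) :
    bigX (l.set i (l.get i + d)) < bigX (d :: l) := by
  have key : ∀ (l : List ℕ) (i : ℕ) (hi : i < l.length),
      bigX (l.set i (l[i] + d)) = bigX l + 2 * d := by
    intro l
    induction l with
    | nil => intro i hi; simp at hi
    | cons a t ih =>
      intro i hi
      cases i with
      | zero => simp only [List.set_cons_zero, List.getElem_cons_zero, bigX_cons]; ring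
      | succ i =>
        have hi' : i < t.length := by simpa using hi
        simp only [List.set_cons_succ, List.getElem_cons_succ, bigX_cons, ih i hi']; ring
  have := key l i i.2
  rw [bigX_cons]
  simp only [List.get_eq_getElem]
  omega

/-- The numbers `B(d₁,…,dₙ) = ⟨τ_{d₁} ⋯ τ_{dₙ}⟩^Θ ∏ (2dⱼ+1)!!`, defined by the recursion of
Dijkgraaf–Verlinde–Verlinde type (equivalent to the Virasoro constraints)
`B(d,𝐝) = ∑ᵢ (2dᵢ+1) B(d₁,…,dᵢ+d,…,dₙ)
  + ½ ∑_{a+b=d-1} (B(a,b,𝐝) + ∑_{I ⊔ J = {1,…,n}} B(a,𝐝_I) B(b,𝐝_J))`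
together with the initial value `B(0) = 1/8`. The sums over `a + b = d - 1` are indexed by
`a = 0, …, d - 1`; the value at the empty list never occurs in the recursion. -/
def B : List ℕ → ℚ
  | [] => 0
  | d :: l =>
    (if d = 0 ∧ l = [] then 1 / 8 else 0)
    + ∑ i : Fin l.length, (2 * (l.get i : ℚ) + 1) * B (l.set i (l.get i + d))
    + 1 / 2 * ∑ a : Fin d, (B (a :: (d - 1 - a) :: l)
        + ∑ I : Finset (Fin l.length), B (a :: pick l I) * B ((d - 1 - a) :: pick l Iᶜ))
termination_by l => bigX l
decreasing_by
  · exact bigX_set_lt d l i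
  · have := a.2; simp only [bigX_cons]; omega
  · have := a.2; have := bigX_pick_le l I; simp only [bigX_cons]; omega
  · have := a.2; have := bigX_pick_le l Iᶜ; simp only [bigX_cons]; omega

/-- The Brézin–Gross–Witten number `⟨τ_{d₁} ⋯ τ_{dₙ}⟩^Θ_g`, `g = d₁ + ⋯ + dₙ + 1`. -/
def number (l : List ℕ) : ℚ := B l / (l.map fun k => ((2 * k + 1)‼ : ℚ)).prod

/-- The normalized number
`C(𝐝) = 2^{2g-1} ∏ (2dⱼ+1)!! / (X(𝐝)-1)! · ⟨τ_{d₁} ⋯ τ_{dₙ}⟩^Θ_g` with `2g - 1 = 2|𝐝| + 1`. -/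
def C (l : List ℕ) : ℚ :=
  2 ^ (2 * l.sum + 1) * (l.map fun k => ((2 * k + 1)‼ : ℚ)).prod / ((bigX l - 1)! : ℚ) * number l

/-- `γ(X) = Γ(X/2+1)² / (π Γ((X+1)/2) Γ((X+3)/2))`. -/
noncomputable def gammaFun (x : ℝ) : ℝ :=
  Real.Gamma (x / 2 + 1) ^ 2 / (Real.pi * Real.Gamma ((x + 1) / 2) * Real.Gamma ((x + 3) / 2))

/-- The renormalized number `Ĉ(𝐝) = C(𝐝) / γ(X(𝐝))` (for lists of positive integers). -/
noncomputable def Chat (l : List ℕ) : ℝ := (C l : ℝ) / gammaFun (bigX l)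

/-- `f ∼ ∑ₖ Pₖ x^{-k}` along `l`: the power series `P`, in the variable `1/x`, is an asymptotic
expansion to all orders of `f` in inverse powers of `x`. -/
def HasInvExpansion {α : Type*} (l : Filter α) (x f : α → ℝ) (P : PowerSeries ℝ) : Prop :=
  ∀ N : ℕ, (fun a => f a - ∑ k ∈ Finset.range N, PowerSeries.coeff k P / x a ^ k)
    =O[l] fun a => 1 / x a ^ N

/-- The expansion in `ℚ⟦1/X⟧` of the inverse Pochhammer symbol
`1/(X+a)_m = ∏_{i<m} 1/(X+a+i)`; with `t = 1/X`, each factor is `t / (1 + (a+i) t)`. -/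
noncomputable def invPochhammer (a : ℤ) (m : ℕ) : PowerSeries ℚ :=
  ∏ i ∈ Finset.range m, PowerSeries.X *
    (1 + PowerSeries.C ((a : ℚ) + (i : ℚ)) * PowerSeries.X)⁻¹

/-- `S = ∑_{j ≥ 1} f j` as formal power series: each coefficient of the partial sums
is eventually equal to the coefficient of `S`. -/
def IsFormalSum (f : ℕ → PowerSeries ℚ) (S : PowerSeries ℚ) : Prop :=
  ∀ n : ℕ, ∀ᶠ J in Filter.atTop,
    PowerSeries.coeff n (∑ j ∈ Finset.Icc 1 J, f j) = PowerSeries.coeff n S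

end BGW

/-! Let Z = exp F be the generating function for which the numbers B are the Taylor coefficients of
F. The recursion for B is the system of Virasoro constraints ∂Z/∂t_d = V_d Z. Since [V_m, V_n] =
2(m-n) V_{m+n}, this overdetermined system is solved by one recursion in the weight, the
cut-and-join recursion n Z_n = Σ (2k+1) t_k V_k Z_{n-1} (`pderiv_zpart_succ`, `evZero_corr`).

In Miwa variables t_k = Σ x_i^{2k+1}/(2k+1) the cut-and-join recursion is an evolution equation, and
multiplication by ∏ (x_i-x_j)/(x_i+x_j) turns its generator into a sum of one-variable operators. A
solution is determined by its initial value, so Schur's Pfaffian identity between the initial values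
propagates: the four-variable function is the Pfaffian of the two-variable ones (`pfaffian_four`),
and these are bilinear in an explicit one-variable series ψ. The mixed derivative at (x,-x,1,-1),
where every t_k vanishes, gives the two-point generating function (`C_mul_twoSeries_sub`). Its
coefficients yield B(d,e+1) - B(d+1,e) in closed form, and from it an inhomogeneous first-order
recursion in e (`B_difference`, `B_recursion`).

After normalization that recursion reads Ĉ(d,e+1) - Ĉ(d,e) = c (2X-2d+3) G(X), where G is the Gamma
quotient of the theorem (`Chat_succ_sub`), and Ĉ(d,e) → 1 as e → ∞ (`tendsto_Chat`). So 1 - Ĉ is a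
tail sum of G, and two facts about inverse Pochhammer symbols finish the proof. Both G and the
series Σ A_j/(X-2d-j+1)_{2d+2j+2} obey the same first-order equation under X ↦ X+2; for the series
this is a three-term recursion of the A_j, proved by creative telescoping (`aCoeff_recursion`,
`sum_invP_bracket`). And 1/(X-2d-j+1)_{2d+2j} is a discrete antiderivative of
2(d+j)(2X-2d+3)/(X-2d-j+1)_{2d+2j+2} (`invP'_sub`), which is where the denominators d+j come from.
Everything analytic reduces to one principle: a function tending to 0 whose increments are
O(t^{-m-1}) is O(t^{-m}). -/

namespace BGW

/-! ### Virasoro operators and their commutation relations -/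

/-- The derivation `∑ₖ (2k+1) tₖ ∂/∂t_{k+m}` of `ℚ[t₀, t₁, …]`. -/
noncomputable def shiftDer (m : ℕ) :
    Derivation ℚ (MvPolynomial ℕ ℚ) (MvPolynomial ℕ ℚ) :=
  MvPolynomial.mkDerivation ℚ fun i =>
    if m ≤ i then ((2 * (i - m) + 1 : ℕ) : MvPolynomial ℕ ℚ) * MvPolynomial.X (i - m) else 0

/-- The second order operator `∑_{a+b=m-1} ∂²/∂tₐ∂t_b`. -/
noncomputable def quadDer (m : ℕ) (f : MvPolynomial ℕ ℚ) : MvPolynomial ℕ ℚ :=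
  ∑ b ∈ Finset.range m, MvPolynomial.pderiv b (MvPolynomial.pderiv (m - 1 - b) f)

/-- The homogeneous part of the `m`-th Virasoro operator. -/
noncomputable def vir (m : ℕ) (f : MvPolynomial ℕ ℚ) : MvPolynomial ℕ ℚ :=
  shiftDer m f + MvPolynomial.C (1 / 2) * quadDer m f
    + (if m = 0 then MvPolynomial.C (1 / 8) * f else 0)

section Operators

open MvPolynomial

theorem shiftDer_X (m i : ℕ) : shiftDer m (X i) =
    if m ≤ i then ((2 * (i - m) + 1 : ℕ) : MvPolynomial ℕ ℚ) * X (i - m) else 0 := by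
  simp [shiftDer]

theorem pderiv_natCast_mul (a n : ℕ) (f : MvPolynomial ℕ ℚ) :
    pderiv a ((n : MvPolynomial ℕ ℚ) * f) = n * pderiv a f := by
  rw [← nsmul_eq_mul, map_nsmul, nsmul_eq_mul]

theorem pderiv_natCast (a n : ℕ) : pderiv a (n : MvPolynomial ℕ ℚ) = 0 :=
  (pderiv a).map_natCast n

theorem pderiv_comm (a b : ℕ) (f : MvPolynomial ℕ ℚ) :
    pderiv a (pderiv b f) = pderiv b (pderiv a f) := by
  have : ⁅(pderiv a : Derivation ℚ (MvPolynomial ℕ ℚ) (MvPolynomial ℕ ℚ)),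
      (pderiv b : Derivation ℚ (MvPolynomial ℕ ℚ) (MvPolynomial ℕ ℚ))⁆ = 0 := by
    apply derivation_ext
    intro i
    simp [Derivation.commutator_apply, pderiv_X, Pi.single_apply, apply_ite]
  have h := congrArg (fun D : Derivation ℚ (MvPolynomial ℕ ℚ) _ => D f) this
  simpa [Derivation.commutator_apply, sub_eq_zero] using h

/-- Both sides are values of derivations, one of them a commutator, so comparison on the variables
suffices. -/
theorem pderiv_shiftDer (a m : ℕ) (f : MvPolynomial ℕ ℚ) :
    pderiv a (shiftDer m f) = shiftDer m (pderiv a f)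
      + ((2 * a + 1 : ℕ) : MvPolynomial ℕ ℚ) * pderiv (a + m) f := by
  have : ⁅(pderiv a : Derivation ℚ (MvPolynomial ℕ ℚ) _), shiftDer m⁆ =
      ((2 * a + 1 : ℕ) : MvPolynomial ℕ ℚ) • (pderiv (a + m) :
        Derivation ℚ (MvPolynomial ℕ ℚ) (MvPolynomial ℕ ℚ)) := by
    apply derivation_ext
    intro i
    rw [Derivation.commutator_apply, shiftDer_X]
    simp only [Derivation.smul_apply, pderiv_X, Pi.single_apply, smul_eq_mul]
    by_cases h : a + m = i
    · subst h
      have e2 : shiftDer m (if a + m = a then (1 : MvPolynomial ℕ ℚ) else 0) = 0 := by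
        split_ifs <;> simp
      rw [if_pos (by omega), if_pos rfl, pderiv_mul, pderiv_natCast,
        show a + m - m = a by omega, pderiv_X_self, e2]
      ring
    · have e1 : pderiv a (if m ≤ i then ((2 * (i - m) + 1 : ℕ) : MvPolynomial ℕ ℚ) * X (i - m)
          else 0) = 0 := by
        split_ifs with hm
        · rw [pderiv_mul, pderiv_natCast, pderiv_X_of_ne (by omega)]
          simp
        · simp
      have e2 : shiftDer m (if i = a then (1 : MvPolynomial ℕ ℚ) else 0) = 0 := by
        split_ifs <;> simp
      rw [if_neg (Ne.symm h), mul_zero, e1, e2, sub_zero]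
  have h := congrArg (fun D : Derivation ℚ (MvPolynomial ℕ ℚ) _ => D f) this
  simp only [Derivation.commutator_apply, Derivation.smul_apply, smul_eq_mul] at h
  linear_combination h

/-- The bracket is 2(m-n) times the shift by m+n. It is written additively because the coefficients
are casts of natural numbers. As a relation between derivations it only has to be checked on
variables. -/
theorem shiftDer_comm (m n : ℕ) (f : MvPolynomial ℕ ℚ) :
    shiftDer m (shiftDer n f) + ((2 * n : ℕ) : MvPolynomial ℕ ℚ) * shiftDer (m + n) f
      = shiftDer n (shiftDer m f) + ((2 * m : ℕ) : MvPolynomial ℕ ℚ) * shiftDer (m + n) f := by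
  have : ⁅shiftDer m, shiftDer n⁆ + ((2 * n : ℕ) : MvPolynomial ℕ ℚ) • shiftDer (m + n)
      = ((2 * m : ℕ) : MvPolynomial ℕ ℚ) • shiftDer (m + n) := by
    apply derivation_ext
    intro i
    simp only [Derivation.add_apply, Derivation.commutator_apply, Derivation.smul_apply,
      shiftDer_X, apply_ite, Derivation.leibniz, Derivation.map_natCast, map_zero]
    by_cases h : m + n ≤ i
    · obtain ⟨k, rfl⟩ := Nat.exists_eq_add_of_le h
      have e1 : m + n + k - n = m + k := by omega
      have e2 : m + n + k - m = n + k := by omega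
      have e3 : m + n + k - (m + n) = k := by omega
      simp only [e1, e2, e3, show n ≤ m + n + k by omega, show m ≤ m + n + k by omega, h,
        if_true, show m ≤ m + k by omega, show n ≤ n + k by omega, Nat.add_sub_cancel_left,
        smul_eq_mul]
      push_cast
      ring
    · have e1 : ¬ (n ≤ i ∧ m ≤ i - n) := by omega
      have e2 : ¬ (m ≤ i ∧ n ≤ i - m) := by omega
      by_cases hn : n ≤ i
      · have h1 : ¬ m ≤ i - n := fun h => e1 ⟨hn, h⟩
        by_cases hm : m ≤ i
        · have h2 : ¬ n ≤ i - m := fun h => e2 ⟨hm, h⟩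
          simp only [hn, hm, h1, h2, if_true, if_false, h]; simp
        · simp only [hn, hm, h1, if_true, if_false, h]; simp
      · by_cases hm : m ≤ i
        · have h2 : ¬ n ≤ i - m := fun h => e2 ⟨hm, h⟩
          simp only [hn, hm, h2, if_true, if_false, h]; simp
        · simp only [hn, hm, if_false, h]; simp
  have h := congrArg (fun D : Derivation ℚ (MvPolynomial ℕ ℚ) _ => D f) this
  simp only [Derivation.commutator_apply, Derivation.smul_apply, smul_eq_mul,
    Derivation.add_apply] at h
  linear_combination h

theorem pderiv_quadDer (a m : ℕ) (f : MvPolynomial ℕ ℚ) :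
    pderiv a (quadDer m f) = quadDer m (pderiv a f) := by
  simp only [quadDer, map_sum]
  refine Finset.sum_congr rfl fun b _ => ?_
  rw [pderiv_comm a b, pderiv_comm a]

theorem quadDer_comm (m n : ℕ) (f : MvPolynomial ℕ ℚ) :
    quadDer m (quadDer n f) = quadDer n (quadDer m f) := by
  simp only [quadDer, map_sum]
  rw [Finset.sum_comm]
  refine Finset.sum_congr rfl fun b _ => Finset.sum_congr rfl fun a _ => ?_
  rw [pderiv_comm (m - 1 - a) b, pderiv_comm a b, pderiv_comm (m - 1 - a) (n - 1 - b),
    pderiv_comm a (n - 1 - b)]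

/-- `∑_{a+b=m-1} (2a+1) ∂²/∂t_{a+n}∂t_b`. -/
noncomputable def skewQuad (n m : ℕ) (f : MvPolynomial ℕ ℚ) : MvPolynomial ℕ ℚ :=
  ∑ b ∈ Finset.range m, ((2 * (m - 1 - b) + 1 : ℕ) : MvPolynomial ℕ ℚ) *
    pderiv b (pderiv (n + m - 1 - b) f)

theorem quadDer_shiftDer (m n : ℕ) (f : MvPolynomial ℕ ℚ) :
    quadDer m (shiftDer n f) = shiftDer n (quadDer m f)
      + ((2 : ℕ) : MvPolynomial ℕ ℚ) * skewQuad n m f := by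
  have h1 : quadDer m (shiftDer n f) = shiftDer n (quadDer m f)
      + (∑ b ∈ Finset.range m, ((2 * b + 1 : ℕ) : MvPolynomial ℕ ℚ) *
          pderiv (b + n) (pderiv (m - 1 - b) f)
        + ∑ b ∈ Finset.range m, ((2 * (m - 1 - b) + 1 : ℕ) : MvPolynomial ℕ ℚ) *
          pderiv b (pderiv (m - 1 - b + n) f)) := by
    simp only [quadDer, map_sum, ← Finset.sum_add_distrib]
    refine Finset.sum_congr rfl fun b _ => ?_
    rw [pderiv_shiftDer, map_add, pderiv_shiftDer, pderiv_mul, pderiv_natCast]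
    ring
  have h2 : ∑ b ∈ Finset.range m, ((2 * b + 1 : ℕ) : MvPolynomial ℕ ℚ) *
          pderiv (b + n) (pderiv (m - 1 - b) f) = skewQuad n m f := by
    rw [skewQuad, ← Finset.sum_range_reflect]
    refine Finset.sum_congr rfl fun b hb => ?_
    rw [Finset.mem_range] at hb
    rw [pderiv_comm, show m - 1 - (m - 1 - b) = b by omega,
      show m - 1 - b + n = n + m - 1 - b by omega]
  have h3 : ∑ b ∈ Finset.range m, ((2 * (m - 1 - b) + 1 : ℕ) : MvPolynomial ℕ ℚ) *
          pderiv b (pderiv (m - 1 - b + n) f) = skewQuad n m f := by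
    refine Finset.sum_congr rfl fun b hb => ?_
    rw [Finset.mem_range] at hb
    rw [show m - 1 - b + n = n + m - 1 - b by omega]
  rw [h1, h2, h3]
  push_cast
  ring

/-- The terms ∂_b ∂_{m+n-1-b} are symmetric under b ↦ m+n-1-b. The difference of the two skew sums
is one sum over b < m+n with weight 2m-1-2b; averaging it with its reflection, of weight 1-2n+2b,
leaves the constant weight m-n. -/
theorem skewQuad_sub (m n : ℕ) (f : MvPolynomial ℕ ℚ) :
    skewQuad n m f + (n : MvPolynomial ℕ ℚ) * quadDer (m + n) f
      = skewQuad m n f + (m : MvPolynomial ℕ ℚ) * quadDer (m + n) f := by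
  set g : ℕ → MvPolynomial ℕ ℚ := fun b => pderiv b (pderiv (m + n - 1 - b) f) with hg
  have hsym : ∀ b < m + n, g (m + n - 1 - b) = g b := fun b hb => by
    simp only [hg]
    rw [pderiv_comm, show m + n - 1 - (m + n - 1 - b) = b by omega]
  have e1 : skewQuad n m f = ∑ b ∈ Finset.range m, (2 * m - 1 - 2 * b : MvPolynomial ℕ ℚ) * g b := by
    refine Finset.sum_congr rfl fun b hb => ?_
    rw [Finset.mem_range] at hb
    obtain ⟨k, rfl⟩ := Nat.exists_eq_add_of_lt hb
    simp only [hg, show n + (b + k + 1) = b + k + 1 + n by omega,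
      show b + k + 1 - 1 - b = k by omega]
    push_cast
    ring
  have e2 : skewQuad m n f = ∑ b ∈ Finset.range n, (2 * n - 1 - 2 * b : MvPolynomial ℕ ℚ) * g b := by
    refine Finset.sum_congr rfl fun b hb => ?_
    rw [Finset.mem_range] at hb
    obtain ⟨k, rfl⟩ := Nat.exists_eq_add_of_lt hb
    simp only [hg, show b + k + 1 - 1 - b = k by omega]
    push_cast
    ring
  have e3 : ∑ b ∈ Finset.range n, (2 * n - 1 - 2 * b : MvPolynomial ℕ ℚ) * g b
      = ∑ b ∈ Finset.range n, (2 * (m + b : ℕ) - 2 * m + 1 : MvPolynomial ℕ ℚ) * g (m + b) := by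
    rw [← Finset.sum_range_reflect]
    refine Finset.sum_congr rfl fun b hb => ?_
    rw [Finset.mem_range] at hb
    obtain ⟨k, rfl⟩ := Nat.exists_eq_add_of_lt hb
    rw [← hsym (m + b) (by omega), show b + k + 1 - 1 - b = k by omega,
      show m + (b + k + 1) - 1 - (m + b) = k by omega]
    push_cast
    ring
  have e4 : ∑ b ∈ Finset.range (m + n), (2 * m - 1 - 2 * b : MvPolynomial ℕ ℚ) * g b
      = skewQuad n m f - skewQuad m n f := by
    have e : ∑ b ∈ Finset.range n, (2 * m - 1 - 2 * (m + b : ℕ) : MvPolynomial ℕ ℚ) * g (m + b)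
        = - skewQuad m n f := by
      rw [e2, e3, ← Finset.sum_neg_distrib]
      refine Finset.sum_congr rfl fun b _ => ?_
      ring
    rw [Finset.sum_range_add, e, ← e1, sub_eq_add_neg]
  have e5 : ∑ b ∈ Finset.range (m + n), (2 * m - 1 - 2 * b : MvPolynomial ℕ ℚ) * g b
      = ∑ b ∈ Finset.range (m + n), (1 - 2 * n + 2 * b : MvPolynomial ℕ ℚ) * g b := by
    rw [← Finset.sum_range_reflect]
    refine Finset.sum_congr rfl fun b hb => ?_
    rw [Finset.mem_range] at hb
    rw [hsym b hb]
    obtain ⟨k, hk⟩ := Nat.exists_eq_add_of_lt hb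
    have : (m : MvPolynomial ℕ ℚ) + n = b + k + 1 := by exact_mod_cast hk
    rw [hk, show b + k + 1 - 1 - b = k by omega]
    linear_combination 2 * g b * this
  have e6 : (2 : MvPolynomial ℕ ℚ) * (skewQuad n m f - skewQuad m n f)
      = 2 * ((m - n : MvPolynomial ℕ ℚ) * quadDer (m + n) f) := by
    rw [two_mul]
    nth_rewrite 2 [← e4]
    rw [e5, ← e4, ← Finset.sum_add_distrib, quadDer, Finset.mul_sum, Finset.mul_sum]
    refine Finset.sum_congr rfl fun b _ => ?_
    simp only [hg]
    ring
  have h2 : (2 : MvPolynomial ℕ ℚ) ≠ 0 := by norm_num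
  linear_combination mul_left_cancel₀ h2 e6

theorem two_mul_C_half : (2 : MvPolynomial ℕ ℚ) * MvPolynomial.C (1 / 2) = 1 := by
  rw [← map_ofNat MvPolynomial.C 2, ← C_mul]; norm_num

/-- The shift parts bracket by `shiftDer_comm`, the mixed terms by `quadDer_shiftDer` and
`skewQuad_sub`, and the second-order parts commute. For nonnegative indices no central term appears:
the scalar 1/8 in V_0 commutes with everything, and m+n = 0 forces m = n = 0. -/
theorem vir_comm (m n : ℕ) (f : MvPolynomial ℕ ℚ) :
    vir m (vir n f) + ((2 * n : ℕ) : MvPolynomial ℕ ℚ) * vir (m + n) f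
      = vir n (vir m f) + ((2 * m : ℕ) : MvPolynomial ℕ ℚ) * vir (m + n) f := by
  have hq : ∀ (k : ℕ) (c : ℚ) (g : MvPolynomial ℕ ℚ), quadDer k (MvPolynomial.C c * g) = MvPolynomial.C c * quadDer k g := by
    intro k c g
    simp [quadDer, Finset.mul_sum]
  have hs : ∀ (k : ℕ) (c : ℚ) (g : MvPolynomial ℕ ℚ),
      shiftDer k (MvPolynomial.C c * g) = MvPolynomial.C c * shiftDer k g := by
    intro k c g
    simp
  have hqa : ∀ (k : ℕ) (g g' : MvPolynomial ℕ ℚ),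
      quadDer k (g + g') = quadDer k g + quadDer k g' := by
    intro k g g'
    simp [quadDer, Finset.sum_add_distrib]
  have key : ∀ k l : ℕ, shiftDer k (shiftDer l f + MvPolynomial.C (1 / 2) * quadDer l f)
        + MvPolynomial.C (1 / 2) * quadDer k (shiftDer l f + MvPolynomial.C (1 / 2) * quadDer l f)
      = shiftDer k (shiftDer l f) + MvPolynomial.C (1 / 2) * (shiftDer k (quadDer l f)
        + shiftDer l (quadDer k f)) + skewQuad l k f + MvPolynomial.C (1 / 2) * MvPolynomial.C (1 / 2) * quadDer k (quadDer l f) := by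
    intro k l
    rw [map_add, hs, hqa, hq, quadDer_shiftDer]
    push_cast
    linear_combination skewQuad l k f * two_mul_C_half
  have main : shiftDer m (shiftDer n f + MvPolynomial.C (1 / 2) * quadDer n f)
        + MvPolynomial.C (1 / 2) * quadDer m (shiftDer n f + MvPolynomial.C (1 / 2) * quadDer n f)
        + ((2 * n : ℕ) : MvPolynomial ℕ ℚ) * (shiftDer (m + n) f + MvPolynomial.C (1 / 2) * quadDer (m + n) f)
      = shiftDer n (shiftDer m f + MvPolynomial.C (1 / 2) * quadDer m f)
        + MvPolynomial.C (1 / 2) * quadDer n (shiftDer m f + MvPolynomial.C (1 / 2) * quadDer m f)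
        + ((2 * m : ℕ) : MvPolynomial ℕ ℚ) * (shiftDer (m + n) f + MvPolynomial.C (1 / 2) * quadDer (m + n) f) := by
    rw [key, key, quadDer_comm n m]
    have h1 := shiftDer_comm m n f
    have h2 := skewQuad_sub m n f
    push_cast at h1 ⊢
    linear_combination h1 + h2 + ((n : MvPolynomial ℕ ℚ) - m) * quadDer (m + n) f * two_mul_C_half
  rcases Nat.eq_zero_or_pos m with rfl | hm
  · rcases Nat.eq_zero_or_pos n with rfl | hn
    · rfl
    · simp only [vir, hn.ne', if_true, if_false, add_zero, zero_add, hqa, hq, hs, map_add] at main ⊢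
      linear_combination main
  · rcases Nat.eq_zero_or_pos n with rfl | hn
    · simp only [vir, hm.ne', if_true, if_false, add_zero, hqa, hq, hs, map_add] at main ⊢
      linear_combination main
    · simp only [vir, hm.ne', hn.ne', if_false, add_zero, show ¬ m + n = 0 by omega] at main ⊢
      linear_combination main

theorem pderiv_vir (a m : ℕ) (f : MvPolynomial ℕ ℚ) :
    pderiv a (vir m f) = vir m (pderiv a f)
      + ((2 * a + 1 : ℕ) : MvPolynomial ℕ ℚ) * pderiv (a + m) f := by
  by_cases h : m = 0
  · simp only [vir, map_add, pderiv_shiftDer, pderiv_C_mul, pderiv_quadDer, h, if_true]; ring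
  · simp only [vir, map_add, pderiv_shiftDer, pderiv_C_mul, pderiv_quadDer, h, if_false, map_zero]
    ring

theorem quadDer_X_mul (m k : ℕ) (f : MvPolynomial ℕ ℚ) :
    quadDer m (X k * f) = X k * quadDer m f
      + if k < m then 2 * pderiv (m - 1 - k) f else 0 := by
  have h : ∀ b ∈ Finset.range m, pderiv b (pderiv (m - 1 - b) (X k * f))
      = X k * pderiv b (pderiv (m - 1 - b) f) +
        ((if k = m - 1 - b then pderiv b f else 0) + if k = b then pderiv (m - 1 - b) f else 0) := by
    intro b _
    simp only [pderiv_mul, pderiv_X, Pi.single_apply, map_add, ite_mul, one_mul, zero_mul,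
      apply_ite (pderiv b), map_zero]
    ring
  rw [quadDer, Finset.sum_congr rfl h, Finset.sum_add_distrib, Finset.sum_add_distrib,
    ← Finset.mul_sum, quadDer]
  congr 1
  by_cases hk : k < m
  · rw [Finset.sum_eq_single (m - 1 - k), Finset.sum_eq_single k]
    · simp [hk, show m - 1 - (m - 1 - k) = k by omega]; ring
    · intro b _ hb; simp [hb.symm]
    · simp [hk]
    · intro b hb hne
      rw [Finset.mem_range] at hb
      rw [if_neg (by omega)]
    · intro h; exact absurd (Finset.mem_range.2 (by omega)) h
  · rw [Finset.sum_eq_zero, Finset.sum_eq_zero]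
    · simp [hk]
    · intro b hb
      rw [Finset.mem_range] at hb
      rw [if_neg (by omega)]
    · intro b hb
      rw [Finset.mem_range] at hb
      rw [if_neg (by omega)]

theorem vir_X_mul (m k : ℕ) (f : MvPolynomial ℕ ℚ) :
    vir m (X k * f) = X k * vir m f
      + (if m ≤ k then ((2 * (k - m) + 1 : ℕ) : MvPolynomial ℕ ℚ) * X (k - m) else 0) * f
      + if k < m then pderiv (m - 1 - k) f else 0 := by
  have h2 := two_mul_C_half
  rw [vir, quadDer_X_mul, Derivation.leibniz, shiftDer_X, vir]
  split_ifs <;> simp only [smul_eq_mul] <;>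
    first
    | ring1
    | linear_combination pderiv (m - 1 - k) f * h2

end Operators

/-! ### The cut-and-join recursion solves the Virasoro constraints -/

/-- The weight `n` part of the partition function `Z = exp F`, given by the cut-and-join
recursion `n Z_n = ∑ₖ (2k+1) tₖ Vₖ Z_{n-1}`. -/
noncomputable def zpart : ℕ → MvPolynomial ℕ ℚ
  | 0 => 1
  | n + 1 => MvPolynomial.C (1 / ((n : ℚ) + 1)) * ∑ k ∈ Finset.range (2 ^ (n + 1)),
      ((2 * k + 1 : ℕ) : MvPolynomial ℕ ℚ) * MvPolynomial.X k * vir k (zpart n)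

section CutAndJoin

open MvPolynomial

theorem derivation_mem_supported {s : Set ℕ} (D : Derivation ℚ (MvPolynomial ℕ ℚ) (MvPolynomial ℕ ℚ))
    (hD : ∀ i ∈ s, D (X i) ∈ supported ℚ s) {f : MvPolynomial ℕ ℚ} (hf : f ∈ supported ℚ s) :
    D f ∈ supported ℚ s := by
  rw [supported_eq_adjoin_X] at hf
  induction hf using Algebra.adjoin_induction with
  | mem x hx => obtain ⟨i, hi, rfl⟩ := hx; exact hD i hi
  | algebraMap r => rw [D.map_algebraMap]; exact zero_mem _
  | add x y _ _ hx hy => rw [map_add]; exact add_mem hx hy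
  | mul x y hx' hy' hx hy =>
    rw [← supported_eq_adjoin_X] at hx' hy'
    rw [D.leibniz]
    exact add_mem (mul_mem hx' hy) (mul_mem hy' hx)

theorem pderiv_mem_supported {s : Set ℕ} (a : ℕ) {f : MvPolynomial ℕ ℚ}
    (hf : f ∈ supported ℚ s) : pderiv a f ∈ supported ℚ s := by
  refine derivation_mem_supported _ (fun i _ => ?_) hf
  rw [pderiv_X, Pi.single_apply]
  split_ifs
  · exact one_mem _
  · exact zero_mem _

theorem pderiv_eq_zero_of_supported {K a : ℕ} (ha : K ≤ a) {f : MvPolynomial ℕ ℚ}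
    (hf : f ∈ supported ℚ (Set.Iio K)) : pderiv a f = 0 := by
  refine pderiv_eq_zero_of_notMem_vars fun h => ?_
  have := mem_supported.1 hf h
  exact absurd (Set.mem_Iio.1 this) (by omega)

theorem shiftDer_eq_sum {K : ℕ} (m : ℕ) {f : MvPolynomial ℕ ℚ}
    (hf : f ∈ supported ℚ (Set.Iio K)) : shiftDer m f = ∑ k ∈ Finset.range K,
      ((2 * k + 1 : ℕ) : MvPolynomial ℕ ℚ) * X k * pderiv (k + m) f := by
  let D : Derivation ℚ (MvPolynomial ℕ ℚ) (MvPolynomial ℕ ℚ) := ∑ k ∈ Finset.range K,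
      (((2 * k + 1 : ℕ) : MvPolynomial ℕ ℚ) * X k) • pderiv (k + m)
  have hDa : ∀ g, D g = ∑ k ∈ Finset.range K,
      ((2 * k + 1 : ℕ) : MvPolynomial ℕ ℚ) * X k * pderiv (k + m) g := by
    intro g
    have : D g = Derivation.coeFnAddMonoidHom D g := rfl
    rw [this, map_sum, Finset.sum_apply]
    rfl
  rw [← hDa]
  refine derivation_eqOn_supported (s := Set.Iio K) ?_ hf
  intro i hi
  simp only [Function.comp_apply]
  rw [hDa, shiftDer_X]
  have hi' : i < K := hi
  split_ifs with h
  · rw [Finset.sum_eq_single (i - m)]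
    · rw [show i - m + m = i by omega, pderiv_X_self, mul_one]
    · intro b _ hb
      rw [pderiv_X_of_ne (by omega), mul_zero]
    · intro hb
      exact absurd (Finset.mem_range.2 (by omega)) hb
  · refine (Finset.sum_eq_zero fun b _ => ?_).symm
    rw [pderiv_X_of_ne (by omega), mul_zero]

/-- If a+b = m-1 ≥ 2K-1, one of a, b is at least K, so the second-order part dies as well as the
shift. Since Z_n involves only t_k with k < 2^n, the cutoff 2^(n+1) in `zpart` discards only zero
terms. -/
theorem vir_eq_zero {K m : ℕ} (hm : 2 * K ≤ m) (hm0 : m ≠ 0) {f : MvPolynomial ℕ ℚ}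
    (hf : f ∈ supported ℚ (Set.Iio K)) : vir m f = 0 := by
  have h1 : shiftDer m f = 0 := by
    rw [shiftDer_eq_sum m hf]
    refine Finset.sum_eq_zero fun k _ => ?_
    rw [pderiv_eq_zero_of_supported (by omega) hf, mul_zero]
  have h2 : quadDer m f = 0 := by
    refine Finset.sum_eq_zero fun b hb => ?_
    rw [Finset.mem_range] at hb
    by_cases h : K ≤ b
    · exact pderiv_eq_zero_of_supported h (pderiv_mem_supported _ hf)
    · rw [pderiv_eq_zero_of_supported (a := m - 1 - b) (by omega) hf, map_zero]
  rw [vir, h1, h2, if_neg hm0]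
  ring

theorem vir_mem_supported {K : ℕ} (m : ℕ) {f : MvPolynomial ℕ ℚ}
    (hf : f ∈ supported ℚ (Set.Iio K)) : vir m f ∈ supported ℚ (Set.Iio K) := by
  have hC : ∀ c : ℚ, (MvPolynomial.C c : MvPolynomial ℕ ℚ) ∈ supported ℚ (Set.Iio K) :=
    fun c => (supported ℚ (Set.Iio K)).algebraMap_mem c
  refine add_mem (add_mem ?_ (mul_mem (hC _) ?_)) ?_
  · refine derivation_mem_supported _ (fun i hi => ?_) hf
    rw [shiftDer_X]
    split_ifs
    · exact mul_mem (natCast_mem _ _) (X_mem_supported.2 (lt_of_le_of_lt (Nat.sub_le i m) hi))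
    · exact zero_mem _
  · exact sum_mem fun b _ => pderiv_mem_supported _ (pderiv_mem_supported _ hf)
  · split_ifs
    · exact mul_mem (hC _) hf
    · exact zero_mem _

theorem zpart_mem_supported (n : ℕ) : zpart n ∈ supported ℚ (Set.Iio (2 ^ n)) := by
  induction n with
  | zero => exact one_mem _
  | succ n ih =>
    have h := supported_mono (R := ℚ) (Set.Iio_subset_Iio
      (Nat.pow_le_pow_right (n := 2) (by norm_num) (Nat.le_succ n)))
    refine mul_mem ((supported ℚ _).algebraMap_mem _) (sum_mem fun k hk => mul_mem (mul_mem
      (natCast_mem _ _) (X_mem_supported.2 (Finset.mem_range.1 hk))) (h (vir_mem_supported k ih)))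

theorem zpart_succ_eq {n K : ℕ} (hK : 2 ^ (n + 1) ≤ K) :
    ((n + 1 : ℕ) : MvPolynomial ℕ ℚ) * zpart (n + 1) = ∑ k ∈ Finset.range K,
      ((2 * k + 1 : ℕ) : MvPolynomial ℕ ℚ) * X k * vir k (zpart n) := by
  have h1 : ((n + 1 : ℕ) : MvPolynomial ℕ ℚ) * MvPolynomial.C (1 / ((n : ℚ) + 1)) = 1 := by
    rw [← map_natCast (MvPolynomial.C : ℚ →+* MvPolynomial ℕ ℚ), ← MvPolynomial.C_mul]
    rw [← MvPolynomial.C_1]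
    congr 1
    push_cast
    field_simp
  rw [zpart, ← mul_assoc, h1, one_mul]
  refine Finset.sum_subset (Finset.range_subset_range.2 hK) fun k _ hk => ?_
  rw [Finset.mem_range, not_lt, pow_succ] at hk
  have := Nat.two_pow_pos n
  rw [vir_eq_zero (by omega) (by omega) (zpart_mem_supported n), mul_zero]

theorem sum_pderiv_eq_shiftDer {n K : ℕ} (m : ℕ) (hK : 2 ^ n ≤ K) : ∑ k ∈ Finset.range K,
      ((2 * k + 1 : ℕ) : MvPolynomial ℕ ℚ) * X k * pderiv (k + m) (zpart n)
      = shiftDer m (zpart n) :=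
  (shiftDer_eq_sum m (supported_mono (Set.Iio_subset_Iio hK) (zpart_mem_supported n))).symm

theorem vir_sum {ι : Type*} (m : ℕ) (s : Finset ι) (f : ι → MvPolynomial ℕ ℚ) :
    vir m (∑ i ∈ s, f i) = ∑ i ∈ s, vir m (f i) := by
  have : ∀ f g, vir m (f + g) = vir m f + vir m g := by
    intro f g
    simp only [vir, quadDer, map_add, Finset.sum_add_distrib]
    split_ifs <;> ring
  have h0 : vir m 0 = 0 := by simp [vir, quadDer]
  classical
  induction s using Finset.induction_on with
  | empty => simpa using h0
  | insert a s ha ih => rw [Finset.sum_insert ha, Finset.sum_insert ha, this, ih]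

theorem vir_natCast_mul (m c : ℕ) (f : MvPolynomial ℕ ℚ) :
    vir m ((c : MvPolynomial ℕ ℚ) * f) = c * vir m f := by
  rw [← nsmul_eq_mul, ← nsmul_eq_mul]
  simp only [vir, quadDer, map_nsmul, Finset.sum_nsmul, nsmul_add, mul_smul_comm]
  split_ifs <;> simp

/-- Averaging over k ↔ d-1-k replaces the weight 2k+1 by d. -/
theorem sum_mul_pderiv_pderiv (d : ℕ) (f : MvPolynomial ℕ ℚ) :
    ∑ k ∈ Finset.range d, ((2 * k + 1 : ℕ) : MvPolynomial ℕ ℚ) * pderiv (d - 1 - k) (pderiv k f)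
      = d * quadDer d f := by
  have h1 : ∑ k ∈ Finset.range d, ((2 * k + 1 : ℕ) : MvPolynomial ℕ ℚ) *
        pderiv (d - 1 - k) (pderiv k f)
      = ∑ k ∈ Finset.range d, ((2 * (d - 1 - k) + 1 : ℕ) : MvPolynomial ℕ ℚ) *
        pderiv (d - 1 - k) (pderiv k f) := by
    rw [← Finset.sum_range_reflect]
    refine Finset.sum_congr rfl fun k hk => ?_
    rw [Finset.mem_range] at hk
    rw [pderiv_comm, show d - 1 - (d - 1 - k) = k by omega]
  have h2 : (2 : MvPolynomial ℕ ℚ) ≠ 0 := by norm_num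
  refine mul_left_cancel₀ h2 ?_
  rw [two_mul]
  nth_rewrite 2 [h1]
  rw [← Finset.sum_add_distrib, quadDer, Finset.mul_sum, Finset.mul_sum]
  refine Finset.sum_congr rfl fun k hk => ?_
  rw [Finset.mem_range] at hk
  obtain ⟨j, rfl⟩ := Nat.exists_eq_add_of_lt hk
  rw [pderiv_comm k, show k + j + 1 - 1 - k = j by omega]
  push_cast
  ring

/-- The Virasoro constraints `∂Z/∂t_d = V_d Z`. -/
theorem pderiv_zpart_succ (n d : ℕ) : pderiv d (zpart (n + 1)) = vir d (zpart n) := by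
  induction n generalizing d with
  | zero =>
    have hc : ((1 : ℕ) : MvPolynomial ℕ ℚ) * zpart (0 + 1) = _ := zpart_succ_eq (le_max_left (2 ^ (0 + 1)) (d + 1))
    rw [Nat.cast_one, one_mul] at hc
    have hv : ∀ k, vir k (zpart 0) = if k = 0 then MvPolynomial.C (1 / 8) else 0 := by
      intro k
      simp [zpart, vir, quadDer]
    rw [hc, Finset.sum_eq_single 0]
    · rw [hv, if_pos rfl, hv]
      by_cases h : d = 0
      · subst h; simp [pderiv_X]
      · rw [if_neg h, pderiv_mul, pderiv_mul, pderiv_C, pderiv_X_of_ne (Ne.symm h), pderiv_natCast]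
        ring
    · intro k _ hk
      rw [hv, if_neg hk, mul_zero]
    · intro h
      exact absurd (Finset.mem_range.2 (by positivity)) h
  | succ n ih =>
    obtain ⟨K, hK1, hK2⟩ : ∃ K, 2 ^ (n + 1 + 1) ≤ K ∧ d ≤ K := ⟨_, le_max_left _ d, le_max_right _ _⟩
    have hK3 : 2 ^ (n + 1) ≤ K := le_trans (Nat.pow_le_pow_right (by norm_num) (by omega)) hK1
    -- By the induction hypothesis V_k Z_n = ∂_k Z_{n+1}, so the recursion defining Z_{n+1} becomes
    -- Euler's identity: Z_{n+1} is homogeneous of weight n+1 when t_k has weight 2k+1.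
    set Z := zpart (n + 1) with hZ
    have eul : ((n + 1 : ℕ) : MvPolynomial ℕ ℚ) * Z = ∑ k ∈ Finset.range K,
        ((2 * k + 1 : ℕ) : MvPolynomial ℕ ℚ) * X k * pderiv k Z := by
      rw [hZ, zpart_succ_eq hK3]
      exact Finset.sum_congr rfl fun k _ => by rw [ih]
    -- The recursion for the next weight is differentiated with respect to t_d.
    have e1 : ((n + 1 + 1 : ℕ) : MvPolynomial ℕ ℚ) * pderiv d (zpart (n + 1 + 1))
        = ((2 * d + 1 : ℕ) : MvPolynomial ℕ ℚ) * vir d Z + ∑ k ∈ Finset.range K,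
          ((2 * k + 1 : ℕ) : MvPolynomial ℕ ℚ) * X k * (vir d (pderiv k Z)
            + ((2 * k + 1 : ℕ) : MvPolynomial ℕ ℚ) * pderiv (k + d) Z) := by
      have h : ∀ k, pderiv d (((2 * k + 1 : ℕ) : MvPolynomial ℕ ℚ) * X k * vir k Z)
          = (if k = d then ((2 * d + 1 : ℕ) : MvPolynomial ℕ ℚ) * vir d Z else 0)
          + ((2 * k + 1 : ℕ) : MvPolynomial ℕ ℚ) * X k * (vir d (pderiv k Z)
            + ((2 * k + 1 : ℕ) : MvPolynomial ℕ ℚ) * pderiv (k + d) Z) := by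
        intro k
        -- Read through the induction hypothesis, the commutation relation on Z_n exchanges V_k ∂_d
        -- Z for V_d ∂_k Z up to multiples of ∂_{k+d} Z.
        have c1 := vir_comm k d (zpart n)
        rw [← ih, ← ih, ← ih] at c1
        have c2 := pderiv_vir d k Z
        rw [show d + k = k + d by omega] at c2
        rw [pderiv_mul, pderiv_mul, pderiv_natCast, pderiv_X, Pi.single_apply, c2]
        push_cast at c1 ⊢
        split_ifs with h
        · subst h
          linear_combination (2 * (k : MvPolynomial ℕ ℚ) + 1) * X k * c1
        · linear_combination (2 * (k : MvPolynomial ℕ ℚ) + 1) * X k * c1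
      rw [← pderiv_natCast_mul, zpart_succ_eq (le_trans hK1 (Nat.le_succ K)), map_sum,
        Finset.sum_congr rfl (fun k _ => h k), Finset.sum_add_distrib]
      congr 1
      · rw [Finset.sum_ite_eq' , if_pos (Finset.mem_range.2 (by omega))]
      · rw [Finset.sum_range_succ, pderiv_eq_zero_of_supported (a := K) hK3 (zpart_mem_supported _),
          pderiv_eq_zero_of_supported (a := K + d) (by omega) (zpart_mem_supported _)]
        simp [vir, quadDer]
    -- V_d is applied to Euler's identity. Subtracting this from `e1` leaves (2d+1) V_d Z minus 2d
    -- times the shift part minus d times the second-order sum, which is V_d Z, so that the factor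
    -- n+2 cancels.
    have e2 : ((n + 1 : ℕ) : MvPolynomial ℕ ℚ) * vir d Z
        = ∑ k ∈ Finset.range K, ((2 * k + 1 : ℕ) : MvPolynomial ℕ ℚ) * X k * vir d (pderiv k Z)
          + ∑ k ∈ Finset.range K, ((2 * (k + d) + 1 : ℕ) : MvPolynomial ℕ ℚ) *
            (((2 * k + 1 : ℕ) : MvPolynomial ℕ ℚ) * X k * pderiv (k + d) Z)
          + d * quadDer d Z := by
      rw [← vir_natCast_mul, eul, vir_sum, ← sum_mul_pderiv_pderiv]
      have h : ∀ k, vir d (((2 * k + 1 : ℕ) : MvPolynomial ℕ ℚ) * X k * pderiv k Z)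
          = ((2 * k + 1 : ℕ) : MvPolynomial ℕ ℚ) * X k * vir d (pderiv k Z)
          + (if d ≤ k then ((2 * k + 1 : ℕ) : MvPolynomial ℕ ℚ) *
            (((2 * (k - d) + 1 : ℕ) : MvPolynomial ℕ ℚ) * X (k - d) * pderiv k Z) else 0)
          + if k < d then ((2 * k + 1 : ℕ) : MvPolynomial ℕ ℚ) * pderiv (d - 1 - k) (pderiv k Z)
            else 0 := by
        intro k
        rw [mul_assoc, vir_natCast_mul, vir_X_mul]
        split_ifs <;> ring
      rw [Finset.sum_congr rfl (fun k _ => h k), Finset.sum_add_distrib, Finset.sum_add_distrib]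
      congr 1
      · congr 1
        obtain ⟨J, rfl⟩ := Nat.exists_eq_add_of_le hK2
        rw [Finset.sum_range_add, Finset.sum_eq_zero, zero_add, Nat.add_comm d J,
          Finset.sum_range_add]
        · rw [Finset.sum_eq_zero (s := Finset.range d) (fun k _ => by
            rw [pderiv_eq_zero_of_supported (a := J + k + d) (by omega)
              (zpart_mem_supported (n + 1))]; ring), add_zero]
          refine Finset.sum_congr rfl fun k _ => ?_
          rw [if_pos (by omega), show d + k - d = k by omega, Nat.add_comm d k]
        · intro k hk
          rw [Finset.mem_range] at hk
          rw [if_neg (by omega)]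
      · obtain ⟨J, rfl⟩ := Nat.exists_eq_add_of_le hK2
        rw [Finset.sum_range_add]
        nth_rewrite 2 [Finset.sum_eq_zero]
        · rw [add_zero]
          refine Finset.sum_congr rfl fun k hk => ?_
          rw [if_pos (Finset.mem_range.1 hk)]
        · intro k _
          rw [if_neg (by omega)]
    have e3 : ∑ k ∈ Finset.range K, ((2 * k + 1 : ℕ) : MvPolynomial ℕ ℚ) * X k * (vir d (pderiv k Z)
            + ((2 * k + 1 : ℕ) : MvPolynomial ℕ ℚ) * pderiv (k + d) Z)
        = ∑ k ∈ Finset.range K, ((2 * k + 1 : ℕ) : MvPolynomial ℕ ℚ) * X k * vir d (pderiv k Z)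
          + ∑ k ∈ Finset.range K, ((2 * (k + d) + 1 : ℕ) : MvPolynomial ℕ ℚ) *
            (((2 * k + 1 : ℕ) : MvPolynomial ℕ ℚ) * X k * pderiv (k + d) Z)
          - 2 * d * shiftDer d Z := by
      rw [hZ, ← sum_pderiv_eq_shiftDer d hK3, Finset.mul_sum, ← Finset.sum_add_distrib,
        ← Finset.sum_sub_distrib]
      refine Finset.sum_congr rfl fun k _ => ?_
      push_cast
      ring
    have e4 : (d : MvPolynomial ℕ ℚ) * vir d Z = (d : MvPolynomial ℕ ℚ) * (shiftDer d Z + MvPolynomial.C (1 / 2) * quadDer d Z) := by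
      rw [vir]
      by_cases h : d = 0
      · subst h; simp
      · rw [if_neg h, add_zero]
    have h0 : ((n + 1 + 1 : ℕ) : MvPolynomial ℕ ℚ) ≠ 0 :=
      Nat.cast_ne_zero.2 (by omega)
    refine mul_left_cancel₀ h0 ?_
    rw [e1, e3]
    push_cast at e2 ⊢
    linear_combination -e2 + 2 * e4 + d * quadDer d Z * two_mul_C_half

end CutAndJoin

/-! ### Derivations acting on coefficients, sublists, and iterated Leibniz rules -/

/-- The derivation of `A⟦X⟧` that applies a derivation of `A` to the coefficients. -/
noncomputable def mapDer {A : Type*} [CommRing A] [Algebra ℚ A] (D : Derivation ℚ A A) :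
    Derivation ℚ (PowerSeries A) (PowerSeries A) :=
  Derivation.mk'
    { toFun := fun f => PowerSeries.mk fun n => D (PowerSeries.coeff n f)
      map_add' := fun f g => by ext n; simp
      map_smul' := fun c f => by ext n; simp }
    (fun f g => by
      ext n
      simp only [LinearMap.coe_mk, AddHom.coe_mk, PowerSeries.coeff_mk, PowerSeries.coeff_mul,
        map_sum, Derivation.leibniz, smul_eq_mul, map_add, Finset.sum_add_distrib]
      congr 1
      rw [← Finset.Nat.sum_antidiagonal_swap]
      rfl)

theorem coeff_mapDer {A : Type*} [CommRing A] [Algebra ℚ A] (D : Derivation ℚ A A)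
    (n : ℕ) (f : PowerSeries A) :
    PowerSeries.coeff n (mapDer D f) = D (PowerSeries.coeff n f) := by
  simp [mapDer]

theorem mapDer_X {A : Type*} [CommRing A] [Algebra ℚ A] (D : Derivation ℚ A A) :
    mapDer D PowerSeries.X = 0 := by
  ext n
  rw [coeff_mapDer, PowerSeries.coeff_X]
  split_ifs <;> simp

theorem mapDer_C {A : Type*} [CommRing A] [Algebra ℚ A] (D : Derivation ℚ A A) (a : A) :
    mapDer D (PowerSeries.C a) = PowerSeries.C (D a) := by
  ext n
  rw [coeff_mapDer, PowerSeries.coeff_C, PowerSeries.coeff_C]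
  split_ifs <;> simp

section Lists

theorem bigX_set (d : ℕ) : ∀ (l : List ℕ) (i : Fin l.length),
    bigX (l.set i (l.get i + d)) = bigX l + 2 * d
  | [], i => i.elim0
  | a :: t, ⟨0, _⟩ => by simp [bigX_cons]; ring
  | a :: t, ⟨i + 1, hi⟩ => by
    have := bigX_set d t ⟨i, by simpa using hi⟩
    simp only [List.set_cons_succ, List.get_eq_getElem, List.getElem_cons_succ, bigX_cons] at this ⊢
    omega

theorem pick_cons (a : ℕ) (l : List ℕ) (I : Finset (Fin (a :: l).length)) :
    pick (a :: l) I = (if (0 : Fin (l.length + 1)) ∈ I then [a] else []) ++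
      pick l (Finset.univ.filter fun i : Fin l.length => i.succ ∈ I) := by
  have h : List.finRange (a :: l).length = (0 : Fin (l.length + 1)) :: (List.finRange l.length).map Fin.succ :=
    List.finRange_succ
  rw [pick, h, List.filter_cons]
  have h2 : List.map (a :: l).get (List.filter (fun x => decide (x ∈ I))
      (List.map Fin.succ (List.finRange l.length)))
      = pick l (Finset.univ.filter fun i : Fin l.length => i.succ ∈ I) := by
    rw [List.filter_map, List.map_map, pick]
    congr 1
    refine List.filter_congr fun x _ => ?_
    simp
  split_ifs <;> simp_all

end Lists

section IteratedDerivations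

variable {A : Type*} [CommRing A] [Algebra ℚ A] (D : ℕ → Derivation ℚ A A)

/-- The composition of the derivations `D k`, `k` running through the list. -/
def iterDer (l : List ℕ) (f : A) : A := l.foldl (fun g k => D k g) f

theorem iterDer_cons (a : ℕ) (l : List ℕ) (f : A) :
    iterDer D (a :: l) f = iterDer D l (D a f) := rfl

theorem iterDer_nil (f : A) : iterDer D [] f = f := rfl

theorem iterDer_add (l : List ℕ) (f g : A) :
    iterDer D l (f + g) = iterDer D l f + iterDer D l g := by
  induction l generalizing f g with
  | nil => rfl
  | cons a l ih => simp only [iterDer_cons, map_add, ih]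

theorem iterDer_zero (l : List ℕ) : iterDer D l (0 : A) = 0 := by
  induction l with
  | nil => rfl
  | cons a l ih => simp only [iterDer_cons, map_zero, ih]

theorem iterDer_smul (l : List ℕ) (c : ℚ) (f : A) :
    iterDer D l (c • f) = c • iterDer D l f := by
  induction l generalizing f with
  | nil => rfl
  | cons a l ih => rw [iterDer_cons, (D a).map_smul, ih, iterDer_cons]

theorem iterDer_mul_of_const (h : A) (hh : ∀ k, D k h = 0) (l : List ℕ) (f : A) :
    iterDer D l (h * f) = h * iterDer D l f := by
  induction l generalizing f with
  | nil => rfl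
  | cons a l ih =>
    rw [iterDer_cons, Derivation.leibniz, hh, smul_zero, add_zero, smul_eq_mul, ih, iterDer_cons]

theorem iterDer_algebraMap (l : List ℕ) (c : ℚ) :
    iterDer D l (algebraMap ℚ A c) = if l = [] then algebraMap ℚ A c else 0 := by
  cases l with
  | nil => rfl
  | cons a l => simp [iterDer_cons, iterDer_zero]

theorem iterDer_sum {ι : Type*} (s : Finset ι) (l : List ℕ) (f : ι → A) :
    iterDer D l (∑ i ∈ s, f i) = ∑ i ∈ s, iterDer D l (f i) := by
  classical
  induction s using Finset.induction_on with
  | empty => simp [iterDer_zero]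
  | insert a s ha ih => rw [Finset.sum_insert ha, Finset.sum_insert ha, iterDer_add, ih]

/-- Subsets are split according to whether they contain 0. This drives the inductive proof of the
Leibniz rule `iterDer_mul`, where the first derivative falls on one of the two factors. -/
theorem sum_finset_fin_succ {M : Type*} [AddCommMonoid M] (n : ℕ) (f : Finset (Fin (n + 1)) → M) :
    ∑ I : Finset (Fin (n + 1)), f I =
      ∑ J : Finset (Fin n), f (insert 0 (J.map (Fin.succEmb n)))
        + ∑ J : Finset (Fin n), f (J.map (Fin.succEmb n)) := by
  have h0 : ∀ J : Finset (Fin n), (0 : Fin (n + 1)) ∉ J.map (Fin.succEmb n) := by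
    intro J h
    obtain ⟨i, _, hi⟩ := Finset.mem_map.1 h
    exact Fin.succ_ne_zero i hi
  have hJ : ∀ I : Finset (Fin (n + 1)), 0 ∉ I →
      (Finset.univ.filter fun i : Fin n => i.succ ∈ I).map (Fin.succEmb n) = I := by
    intro I hI
    ext x
    simp only [Finset.mem_map, Finset.mem_filter, Finset.mem_univ, true_and, Fin.coe_succEmb]
    constructor
    · rintro ⟨i, hi, rfl⟩; exact hi
    · intro hx
      obtain ⟨i, rfl⟩ := Fin.exists_succ_eq.2 (show x ≠ 0 from fun h => hI (h ▸ hx))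
      exact ⟨i, hx, rfl⟩
  rw [← Finset.sum_filter_add_sum_filter_not Finset.univ (fun I : Finset (Fin (n + 1)) => 0 ∈ I)]
  congr 1
  · symm
    refine Finset.sum_nbij' (fun J => insert 0 (J.map (Fin.succEmb n)))
      (fun I => Finset.univ.filter fun i : Fin n => i.succ ∈ I) ?_ ?_ ?_ ?_ ?_
    · intro J _; simp
    · intro I _; simp
    · intro J _; ext i; simp [Fin.succ_ne_zero]
    · intro I hI
      have h1 := hJ (I.erase 0) (by simp)
      have h2 : (Finset.univ.filter fun i : Fin n => i.succ ∈ I.erase 0)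
          = Finset.univ.filter fun i : Fin n => i.succ ∈ I := by
        ext i; simp [Fin.succ_ne_zero]
      rw [h2] at h1
      simp only [h1]
      exact Finset.insert_erase (Finset.mem_filter.1 hI).2
    · intro J _; rfl
  · symm
    refine Finset.sum_nbij' (fun J => J.map (Fin.succEmb n))
      (fun I => Finset.univ.filter fun i : Fin n => i.succ ∈ I) ?_ ?_ ?_ ?_ ?_
    · intro J _; simp
    · intro I _; simp
    · intro J _; ext i; simp
    · intro I hI
      exact hJ I (Finset.mem_filter.1 hI).2
    · intro J _; rfl

theorem pick_insert_zero (a : ℕ) (l : List ℕ) (J : Finset (Fin l.length)) :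
    pick (a :: l) (insert (0 : Fin (l.length + 1)) (J.map (Fin.succEmb l.length)) : Finset (Fin (l.length + 1)))
      = a :: pick l J := by
  rw [pick_cons, if_pos (by simp)]
  simp only [List.singleton_append, List.cons.injEq, true_and]
  congr 1
  ext i; simp [Fin.succ_ne_zero]

theorem pick_map_succ (a : ℕ) (l : List ℕ) (J : Finset (Fin l.length)) :
    pick (a :: l) (J.map (Fin.succEmb l.length) : Finset (Fin (l.length + 1))) = pick l J := by
  rw [pick_cons, if_neg (by simp [Fin.succ_ne_zero])]
  simp only [List.nil_append]
  congr 1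
  ext i; simp

theorem compl_insert_zero_map (n : ℕ) (J : Finset (Fin n)) :
    (insert (0 : Fin (n + 1)) (J.map (Fin.succEmb n)))ᶜ = Jᶜ.map (Fin.succEmb n) := by
  ext x
  refine Fin.cases ?_ (fun i => ?_) x
  · simp [Fin.succ_ne_zero]
  · simp [Fin.succ_ne_zero]

theorem compl_map_succ (n : ℕ) (J : Finset (Fin n)) :
    (J.map (Fin.succEmb n))ᶜ = insert (0 : Fin (n + 1)) (Jᶜ.map (Fin.succEmb n)) := by
  ext x
  refine Fin.cases ?_ (fun i => ?_) x
  · simp [Fin.succ_ne_zero]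
  · simp [Fin.succ_ne_zero]

theorem bigX_pick_add (l : List ℕ) (I : Finset (Fin l.length)) :
    bigX (pick l I) + bigX (pick l Iᶜ) = bigX l := by
  induction l with
  | nil => simp [pick, bigX]
  | cons a l ih =>
    rw [pick_cons, pick_cons]
    have h : (Finset.univ.filter fun i : Fin l.length => i.succ ∈ Iᶜ)
        = (Finset.univ.filter fun i : Fin l.length => i.succ ∈ I)ᶜ := by
      ext i; simp
    have happ : ∀ l₁ l₂ : List ℕ, bigX (l₁ ++ l₂) = bigX l₁ + bigX l₂ := by
      intro l₁ l₂; simp [bigX]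
    rw [h, happ, happ, bigX_cons, ← ih (Finset.univ.filter fun i : Fin l.length => i.succ ∈ I)]
    by_cases h0 : (0 : Fin (l.length + 1)) ∈ I
    · rw [if_pos h0, if_neg (by simpa using h0)]
      simp [bigX]; ring
    · rw [if_neg h0, if_pos (by simpa using h0)]
      simp [bigX]; ring

theorem iterDer_mul (l : List ℕ) (f g : A) : iterDer D l (f * g) =
    ∑ I : Finset (Fin l.length), iterDer D (pick l I) f * iterDer D (pick l Iᶜ) g := by
  induction l generalizing f g with
  | nil =>
    rw [Fintype.sum_eq_single ∅]
    · rfl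
    · intro I hI
      exact absurd (Finset.eq_empty_of_forall_notMem fun x => x.elim0) hI
  | cons a l ih =>
    rw [iterDer_cons, Derivation.leibniz, iterDer_add, smul_eq_mul, smul_eq_mul, ih,
      mul_comm g, ih]
    refine Eq.trans ?_ (sum_finset_fin_succ l.length (fun I : Finset (Fin (l.length + 1)) =>
      iterDer D (pick (a :: l) I) f * iterDer D (pick (a :: l) Iᶜ) g)).symm
    simp only [compl_insert_zero_map, compl_map_succ, pick_insert_zero, pick_map_succ,
      iterDer_cons]
    rw [add_comm]

/-- Each derivative D_a passing T produces one commutator (2a+1) D_{a+d}, which raises a single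
entry of the list by d. This is the origin of the first sum in the recursion for `B`. -/
theorem iterDer_comm_shift (T : Derivation ℚ A A) (d : ℕ)
    (hT : ∀ a f, D a (T f) = T (D a f) + ((2 * a + 1 : ℕ) : A) * D (a + d) f)
    (l : List ℕ) (f : A) : iterDer D l (T f) = T (iterDer D l f)
      + ∑ i : Fin l.length, ((2 * l.get i + 1 : ℕ) : A) * iterDer D (l.set i (l.get i + d)) f := by
  induction l generalizing f with
  | nil => simp [iterDer_nil]
  | cons a l ih =>
    rw [iterDer_cons, hT, iterDer_add, ih, iterDer_mul_of_const D _ (fun k => (D k).map_natCast _)]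
    refine Eq.trans ?_ (congrArg _ (Fin.sum_univ_succ (n := l.length) _).symm)
    simp only [List.get_eq_getElem, Fin.val_zero, Fin.val_succ, List.getElem_cons_zero,
      List.getElem_cons_succ, List.set_cons_zero, List.set_cons_succ, iterDer_cons]
    ring

end IteratedDerivations

/-! ### The numbers B as Taylor coefficients of log Z -/

/-- The partition function, the weight being recorded by the power series variable. -/
noncomputable def zser : PowerSeries (MvPolynomial ℕ ℚ) := PowerSeries.mk zpart

/-- The derivation `∂/∂tₖ` of `ℚ[t₀, t₁, …]⟦h⟧`. -/
noncomputable def tDer (k : ℕ) : Derivation ℚ (PowerSeries (MvPolynomial ℕ ℚ))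
    (PowerSeries (MvPolynomial ℕ ℚ)) := mapDer (MvPolynomial.pderiv k)

/-- The evaluation at `t = 0`. -/
noncomputable def evZero : PowerSeries (MvPolynomial ℕ ℚ) →+* PowerSeries ℚ :=
  PowerSeries.map MvPolynomial.constantCoeff

theorem tDer_shift (a d : ℕ) (f : PowerSeries (MvPolynomial ℕ ℚ)) :
    tDer a (mapDer (shiftDer d) f) = mapDer (shiftDer d) (tDer a f)
      + ((2 * a + 1 : ℕ) : PowerSeries (MvPolynomial ℕ ℚ)) * tDer (a + d) f := by
  ext1 n
  rw [← nsmul_eq_mul, map_add, map_nsmul]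
  simp only [tDer, coeff_mapDer]
  rw [pderiv_shiftDer, nsmul_eq_mul]

theorem evZero_shift (d : ℕ) (f : PowerSeries (MvPolynomial ℕ ℚ)) :
    evZero (mapDer (shiftDer d) f) = 0 := by
  ext n
  rw [evZero, PowerSeries.coeff_map, coeff_mapDer, map_zero]
  set g := PowerSeries.coeff n f
  have hg : g ∈ MvPolynomial.supported ℚ (Set.Iio (g.vars.sup id + 1)) := by
    rw [MvPolynomial.mem_supported]
    intro i hi
    exact Nat.lt_succ_of_le (Finset.le_sup (f := id) hi)
  rw [shiftDer_eq_sum d hg, map_sum]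
  refine Finset.sum_eq_zero fun k _ => ?_
  simp

theorem coeff_zser (n : ℕ) : PowerSeries.coeff n zser = zpart n := PowerSeries.coeff_mk _ _

theorem coeff_tDer (k n : ℕ) (f : PowerSeries (MvPolynomial ℕ ℚ)) :
    PowerSeries.coeff n (tDer k f) = MvPolynomial.pderiv k (PowerSeries.coeff n f) :=
  coeff_mapDer _ _ _

theorem evZero_X : evZero PowerSeries.X = PowerSeries.X := PowerSeries.map_X _

theorem tDer_zser (d : ℕ) : tDer d zser = PowerSeries.X * (mapDer (shiftDer d) zser
    + (1 / 2 : ℚ) • ∑ b ∈ Finset.range d, tDer (d - 1 - b) (tDer b zser)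
    + (if d = 0 then (1 / 8 : ℚ) • zser else 0)) := by
  ext1 n
  cases n with
  | zero => rw [coeff_tDer, coeff_zser, PowerSeries.coeff_zero_X_mul, zpart, MvPolynomial.pderiv_one]
  | succ n =>
    rw [PowerSeries.coeff_succ_X_mul, coeff_tDer, coeff_zser, pderiv_zpart_succ]
    have h1 : PowerSeries.coeff n (mapDer (shiftDer d) zser) = shiftDer d (zpart n) := by
      rw [coeff_mapDer, coeff_zser]
    have h2 : PowerSeries.coeff n ((1 / 2 : ℚ) • ∑ b ∈ Finset.range d,
        tDer (d - 1 - b) (tDer b zser)) = MvPolynomial.C (1 / 2) * quadDer d (zpart n) := by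
      rw [PowerSeries.coeff_smul, MvPolynomial.smul_eq_C_mul, map_sum, quadDer]
      congr 1
      refine Finset.sum_congr rfl fun b _ => ?_
      rw [coeff_tDer, coeff_tDer, coeff_zser, pderiv_comm]
    have h3 : PowerSeries.coeff n (if d = 0 then (1 / 8 : ℚ) • zser else 0)
        = if d = 0 then MvPolynomial.C (1 / 8) * zpart n else 0 := by
      split_ifs
      · rw [PowerSeries.coeff_smul, coeff_zser, MvPolynomial.smul_eq_C_mul]
      · rw [map_zero]
    rw [vir, ← h1, ← h2, ← h3, ← map_add, ← map_add]

theorem exists_zser_inv : ∃ z, zser * z = 1 := by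
  have : IsUnit zser := by
    rw [PowerSeries.isUnit_iff_constantCoeff]
    simp [zser, ← PowerSeries.coeff_zero_eq_constantCoeff_apply, zpart]
  exact this.exists_right_inv

/-- The inverse of the partition function. -/
noncomputable def zinv : PowerSeries (MvPolynomial ℕ ℚ) := exists_zser_inv.choose

theorem zser_mul_zinv : zser * zinv = 1 := exists_zser_inv.choose_spec

/-- The derivative `∂F/∂t_d` of the free energy `F = log Z`. -/
noncomputable def freeDer (d : ℕ) : PowerSeries (MvPolynomial ℕ ℚ) := tDer d zser * zinv

theorem der_zinv (D : Derivation ℚ (PowerSeries (MvPolynomial ℕ ℚ))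
    (PowerSeries (MvPolynomial ℕ ℚ))) : D zinv = - zinv ^ 2 * D zser := by
  rw [D.leibniz_of_mul_eq_one (a := zinv) (b := zser) (by rw [mul_comm, zser_mul_zinv]), smul_eq_mul]

theorem tDer_freeDer (a b : ℕ) :
    tDer a (freeDer b) = tDer a (tDer b zser) * zinv - freeDer a * freeDer b := by
  rw [freeDer, freeDer, Derivation.leibniz, der_zinv, smul_eq_mul, smul_eq_mul]
  ring

/-- The Virasoro constraint is divided by Z. The quotient of ∂_a∂_b Z by Z is the second derivative
of F plus the product of its first derivatives, which accounts for the connected and split terms in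
the recursion for `B`. Only logarithmic derivatives occur, so F itself need not be formed. -/
theorem freeDer_eq (d : ℕ) : freeDer d = PowerSeries.X * (mapDer (shiftDer d) zser * zinv
    + (1 / 2 : ℚ) • ∑ b ∈ Finset.range d, (tDer (d - 1 - b) (freeDer b)
        + freeDer b * freeDer (d - 1 - b))
    + algebraMap ℚ _ (if d = 0 then 1 / 8 else 0)) := by
  have h : ∀ b ∈ Finset.range d, tDer (d - 1 - b) (freeDer b) + freeDer b * freeDer (d - 1 - b)
      = zinv * tDer (d - 1 - b) (tDer b zser) := by
    intro b _
    rw [tDer_freeDer]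
    ring
  rw [Finset.sum_congr rfl h, ← Finset.mul_sum, freeDer, tDer_zser, mul_assoc, add_mul, add_mul,
    smul_mul_assoc, mul_comm zinv]
  congr 2
  split_ifs
  · rw [smul_mul_assoc, zser_mul_zinv, Algebra.algebraMap_eq_smul_one]
  · simp

/-- The connected correlators as functions of `t`. -/
noncomputable def corr : List ℕ → PowerSeries (MvPolynomial ℕ ℚ)
  | [] => 0
  | d :: l => iterDer tDer l (freeDer d)

/-- The function being differentiated is the shift derivation applied to log Z, and the commutator
of ∂_a with that derivation gives the second term. -/
theorem tDer_shift_zser_mul (a d : ℕ) : tDer a (mapDer (shiftDer d) zser * zinv) =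
    mapDer (shiftDer d) (freeDer a)
      + ((2 * a + 1 : ℕ) : PowerSeries (MvPolynomial ℕ ℚ)) * freeDer (a + d) := by
  rw [freeDer, freeDer, Derivation.leibniz, Derivation.leibniz, der_zinv, der_zinv, tDer_shift]
  simp only [smul_eq_mul]
  ring

theorem iterDer_shift_zser_mul (d : ℕ) (l : List ℕ) :
    evZero (iterDer tDer l (mapDer (shiftDer d) zser * zinv)) =
      ∑ i : Fin l.length, ((2 * l.get i + 1 : ℕ) : PowerSeries ℚ) *
        evZero (corr (l.set i (l.get i + d))) := by
  cases l with
  | nil => simp [iterDer_nil, evZero_shift]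
  | cons a l =>
    rw [iterDer_cons, tDer_shift_zser_mul, iterDer_add,
      iterDer_comm_shift tDer _ d (fun a f => tDer_shift a d f),
      iterDer_mul_of_const tDer _ (fun k => (tDer k).map_natCast _), map_add, map_add,
      evZero_shift, zero_add, map_sum, map_mul, map_natCast]
    simp only [map_mul, map_natCast]
    refine Eq.trans ?_ (Fin.sum_univ_succ (n := l.length) _).symm
    simp only [List.get_eq_getElem, Fin.val_zero, Fin.val_succ, List.getElem_cons_zero,
      List.getElem_cons_succ, List.set_cons_zero, List.set_cons_succ, corr]
    ring

theorem evZero_smul (c : ℚ) (f : PowerSeries (MvPolynomial ℕ ℚ)) :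
    evZero (c • f) = PowerSeries.C c * evZero f := by
  ext n
  rw [evZero, PowerSeries.coeff_map, PowerSeries.coeff_C_mul, PowerSeries.coeff_map,
    PowerSeries.coeff_smul, MvPolynomial.smul_eq_C_mul, map_mul, MvPolynomial.constantCoeff_C]

/-- The numbers `B` are the coefficients of the free energy. -/
theorem evZero_corr (l : List ℕ) :
    evZero (corr l) = PowerSeries.C (B l) * PowerSeries.X ^ bigX l := by
  induction hn : bigX l using Nat.strong_induction_on generalizing l with
  | _ n ih =>
  cases l with
  | nil => rw [corr, B]; simp
  | cons d l =>
    -- The induction follows the termination measure of `B`: every list in the recursion has smaller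
    -- `bigX`. The power of the weight variable is carried along because Z is homogeneous.
    have ih' : ∀ l', bigX l' < bigX (d :: l) →
        evZero (corr l') = PowerSeries.C (B l') * PowerSeries.X ^ bigX l' := fun l' h =>
      ih _ (hn ▸ h) l' rfl
    subst hn
    rw [corr, freeDer_eq, iterDer_mul_of_const tDer _ (fun k => mapDer_X _), map_mul, evZero_X, iterDer_add,
      iterDer_add, iterDer_smul, iterDer_sum, map_add, map_add, evZero_smul, map_sum,
      iterDer_shift_zser_mul, iterDer_algebraMap]
    have e1 : ∀ i : Fin l.length, ((2 * l.get i + 1 : ℕ) : PowerSeries ℚ) *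
        evZero (corr (l.set i (l.get i + d))) =
        PowerSeries.C ((2 * (l.get i : ℚ) + 1) * B (l.set i (l.get i + d))) *
          PowerSeries.X ^ (2 * d + bigX l) := by
      intro i
      rw [ih' _ (bigX_set_lt d l i), bigX_set, map_mul, ← map_natCast PowerSeries.C,
        add_comm (2 * d)]
      push_cast
      ring
    have e2 : ∀ a ∈ Finset.range d, evZero (iterDer tDer l (tDer (d - 1 - a) (freeDer a)
        + freeDer a * freeDer (d - 1 - a))) =
        PowerSeries.C (B (a :: (d - 1 - a) :: l)
        + ∑ I : Finset (Fin l.length), B (a :: pick l I) * B ((d - 1 - a) :: pick l Iᶜ)) *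
          PowerSeries.X ^ (2 * d + bigX l) := by
      intro a ha
      rw [Finset.mem_range] at ha
      rw [iterDer_add, iterDer_mul, map_add, map_sum, map_add, add_mul, map_sum, Finset.sum_mul]
      congr 1
      · have h1 : bigX (a :: (d - 1 - a) :: l) = 2 * d + bigX l := by
          simp only [bigX_cons]; omega
        rw [← h1]
        exact ih' (a :: (d - 1 - a) :: l) (by simp only [bigX_cons]; omega)
      · refine Finset.sum_congr rfl fun I _ => ?_
        have h0 := bigX_pick_add l I
        have h1 : bigX (a :: pick l I) + bigX ((d - 1 - a) :: pick l Iᶜ) = 2 * d + bigX l := by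
          simp only [bigX_cons]; omega
        rw [← h1, pow_add, map_mul, map_mul]
        have h2 := ih' (a :: pick l I) (by simp only [bigX_cons]; omega)
        have h3 := ih' ((d - 1 - a) :: pick l Iᶜ) (by simp only [bigX_cons]; omega)
        rw [corr] at h2 h3
        rw [h2, h3]
        ring
    have e3 : evZero (if l = [] then algebraMap ℚ (PowerSeries (MvPolynomial ℕ ℚ))
          (if d = 0 then 1 / 8 else 0) else 0)
        = PowerSeries.C (if d = 0 ∧ l = [] then 1 / 8 else 0) *
          PowerSeries.X ^ (2 * d + bigX l) := by
      by_cases hl : l = []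
      · by_cases hd : d = 0
        · rw [if_pos hl, if_pos hd, if_pos ⟨hd, hl⟩, Algebra.algebraMap_eq_smul_one, evZero_smul,
            map_one]
          subst hl hd
          simp [bigX]
        · rw [if_pos hl, if_neg hd, if_neg (fun h => hd h.1)]
          simp
      · rw [if_neg hl, if_neg (fun h => hl h.2)]
        simp
    rw [Finset.sum_congr rfl (fun i _ => e1 i), Finset.sum_congr rfl e2, e3, B, bigX_cons,
      Finset.sum_range (fun a => PowerSeries.C (B (a :: (d - 1 - a) :: l)
        + ∑ I : Finset (Fin l.length), B (a :: pick l I) * B ((d - 1 - a) :: pick l Iᶜ)) *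
          PowerSeries.X ^ (2 * d + bigX l)), ← Finset.sum_mul, ← Finset.sum_mul, ← map_sum,
      ← map_sum, show 2 * d + 1 + bigX l = 2 * d + bigX l + 1 by ring, pow_succ,
      map_add PowerSeries.C, map_add PowerSeries.C, map_mul PowerSeries.C]
    ring

theorem evZero_zser : evZero zser = 1 := by
  ext n
  rw [evZero, PowerSeries.coeff_map, zser, PowerSeries.coeff_mk, PowerSeries.coeff_one]
  cases n with
  | zero => simp [zpart]
  | succ n => simp [zpart]

theorem constantCoeff_pderiv_zpart (d n : ℕ) :
    MvPolynomial.constantCoeff (MvPolynomial.pderiv d (zpart n))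
      = if n = 2 * d + 1 then B [d] else 0 := by
  have h := evZero_corr [d]
  rw [corr, iterDer_nil] at h
  have h1 : evZero (tDer d zser) = evZero (freeDer d) := by
    have : tDer d zser = freeDer d * zser := by
      rw [freeDer, mul_assoc, mul_comm zinv, zser_mul_zinv, mul_one]
    rw [this, map_mul, evZero_zser, mul_one]
  rw [← h1] at h
  have h2 := congrArg (PowerSeries.coeff n) h
  rw [evZero, PowerSeries.coeff_map, tDer, coeff_mapDer, zser, PowerSeries.coeff_mk,
    PowerSeries.coeff_C_mul, PowerSeries.coeff_X_pow] at h2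
  rw [h2]
  simp [bigX]

/-- Moments are expressed through cumulants; since Z equals 1 at t = 0, dividing by Z is invisible
there. Homogeneity leaves only one weight n. -/
theorem constantCoeff_pderiv_pderiv_zpart (d e n : ℕ) :
    MvPolynomial.constantCoeff (MvPolynomial.pderiv e (MvPolynomial.pderiv d (zpart n)))
      = if n = 2 * d + 2 * e + 2 then B [d, e] + B [d] * B [e] else 0 := by
  have h := evZero_corr [d, e]
  rw [corr, iterDer_cons, iterDer_nil] at h
  have hd := evZero_corr [d]
  have he := evZero_corr [e]
  rw [corr, iterDer_nil] at hd he
  have h1 : evZero (tDer e (tDer d zser)) = evZero (tDer e (freeDer d))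
      + evZero (freeDer d) * evZero (freeDer e) := by
    have : tDer e (tDer d zser) = (tDer e (freeDer d) + freeDer d * freeDer e) * zser := by
      rw [tDer_freeDer]
      linear_combination - tDer e (tDer d zser) * zser_mul_zinv
    rw [this, map_mul, evZero_zser, mul_one, map_add, map_mul]
  rw [h, hd, he] at h1
  have h2 := congrArg (PowerSeries.coeff n) h1
  have hX : bigX [d, e] = 2 * d + 2 * e + 2 := by simp [bigX]; ring
  have hX' : bigX [d] + bigX [e] = 2 * d + 2 * e + 2 := by simp [bigX]; ring
  rw [show PowerSeries.C (B [d]) * PowerSeries.X ^ bigX [d] *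
    (PowerSeries.C (B [e]) * PowerSeries.X ^ bigX [e])
    = PowerSeries.C (B [d] * B [e]) * PowerSeries.X ^ (bigX [d] + bigX [e]) by
      rw [map_mul, pow_add]; ring, hX, hX', ← add_mul, ← map_add] at h2
  rw [evZero, PowerSeries.coeff_map, tDer, tDer, coeff_mapDer, coeff_mapDer, zser,
    PowerSeries.coeff_mk, PowerSeries.coeff_C_mul, PowerSeries.coeff_X_pow] at h2
  rw [h2]
  simp

/-- The symmetry is hidden in the recursion, but is the equality of mixed partial derivatives of Z.
-/
theorem B_pair_comm (d e : ℕ) : B [d, e] = B [e, d] := by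
  have h1 := constantCoeff_pderiv_pderiv_zpart d e (2 * d + 2 * e + 2)
  have h2 := constantCoeff_pderiv_pderiv_zpart e d (2 * d + 2 * e + 2)
  rw [if_pos (by ring)] at h1 h2
  rw [pderiv_comm, h1] at h2
  linarith

/-! ### Miwa variables and the chain rule -/

section Miwa

variable {ι A : Type*} [CommRing A] [Algebra ℚ A]

/-- The Miwa specialization `tₖ = ∑_{i ∈ S} xᵢ^{2k+1}/(2k+1)`. -/
noncomputable def miwa (x : ι → A) (S : Finset ι) : MvPolynomial ℕ ℚ →ₐ[ℚ] A :=
  MvPolynomial.aeval fun k => (1 / (2 * (k : ℚ) + 1)) • ∑ i ∈ S, x i ^ (2 * k + 1)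

theorem miwa_X (x : ι → A) (S : Finset ι) (k : ℕ) : miwa x S (MvPolynomial.X k) =
    (1 / (2 * (k : ℚ) + 1)) • ∑ i ∈ S, x i ^ (2 * k + 1) := by
  simp [miwa]

theorem miwa_mul_X (x : ι → A) (S : Finset ι) (k : ℕ) :
    miwa x S (((2 * k + 1 : ℕ) : MvPolynomial ℕ ℚ) * MvPolynomial.X k) =
      ∑ i ∈ S, x i ^ (2 * k + 1) := by
  have h : ((2 * k + 1 : ℕ) : A) = algebraMap ℚ A (2 * (k : ℚ) + 1) := by
    rw [← map_natCast (algebraMap ℚ A)]; push_cast; rfl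
  rw [map_mul, map_natCast, miwa_X, h, ← Algebra.smul_def, smul_smul, mul_one_div_cancel, one_smul]
  positivity

theorem der_miwa_X {x : ι → A} {S : Finset ι} (D : Derivation ℚ A A) (k : ℕ) :
    D (miwa x S (MvPolynomial.X k)) = ∑ i ∈ S, x i ^ (2 * k) * D (x i) := by
  rw [miwa_X, D.map_smul, map_sum, Finset.smul_sum]
  refine Finset.sum_congr rfl fun i _ => ?_
  rw [D.leibniz_pow, ← Nat.cast_smul_eq_nsmul ℚ, smul_smul]
  push_cast
  rw [one_div_mul_cancel (by positivity), one_smul, smul_eq_mul]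

/-- The chain rule for the Miwa specialization. -/
theorem der_miwa {x : ι → A} {S : Finset ι} (D : Derivation ℚ A A) {K : ℕ}
    {f : MvPolynomial ℕ ℚ} (hf : f ∈ MvPolynomial.supported ℚ (Set.Iio K)) :
    D (miwa x S f) = ∑ k ∈ Finset.range K,
      (∑ i ∈ S, x i ^ (2 * k) * D (x i)) * miwa x S (MvPolynomial.pderiv k f) := by
  rw [MvPolynomial.supported_eq_adjoin_X] at hf
  induction hf using Algebra.adjoin_induction with
  | mem y hy =>
    obtain ⟨i, hi, rfl⟩ := hy
    rw [der_miwa_X, Finset.sum_eq_single i]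
    · simp
    · intro j _ hj
      rw [MvPolynomial.pderiv_X_of_ne (Ne.symm hj), map_zero, mul_zero]
    · intro h
      exact absurd (Finset.mem_range.2 hi) h
  | algebraMap r =>
    rw [AlgHom.commutes, D.map_algebraMap]
    simp
  | add f g _ _ hf hg =>
    simp only [map_add, hf, hg, mul_add, Finset.sum_add_distrib]
  | mul f g _ _ hf hg =>
    rw [map_mul, D.leibniz, hf, hg, smul_eq_mul, smul_eq_mul, Finset.mul_sum, Finset.mul_sum,
      ← Finset.sum_add_distrib]
    refine Finset.sum_congr rfl fun k _ => ?_
    rw [Derivation.leibniz, map_add, smul_eq_mul, smul_eq_mul, map_mul, map_mul]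
    ring

theorem der_miwa_single [DecidableEq ι] {x : ι → A} {S : Finset ι} {i : ι} (hi : i ∈ S)
    (D : Derivation ℚ A A) (hD : ∀ j, D (x j) = if j = i then 1 else 0) {K : ℕ}
    {f : MvPolynomial ℕ ℚ} (hf : f ∈ MvPolynomial.supported ℚ (Set.Iio K)) :
    D (miwa x S f) = ∑ k ∈ Finset.range K,
      x i ^ (2 * k) * miwa x S (MvPolynomial.pderiv k f) := by
  rw [der_miwa D hf]
  refine Finset.sum_congr rfl fun k _ => ?_
  simp [hD, hi]

theorem der_miwa_of_notMem [DecidableEq ι] {x : ι → A} {S : Finset ι} {i : ι} (hi : i ∉ S)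
    (D : Derivation ℚ A A) (hD : ∀ j, D (x j) = if j = i then 1 else 0)
    (f : MvPolynomial ℕ ℚ) : D (miwa x S f) = 0 := by
  have hf : f ∈ MvPolynomial.supported ℚ (Set.Iio (f.vars.sup id + 1)) := by
    rw [MvPolynomial.mem_supported]
    intro i hi
    exact Nat.lt_succ_of_le (Finset.le_sup (f := id) hi)
  rw [der_miwa D hf]
  refine Finset.sum_eq_zero fun k _ => ?_
  simp [hD, hi]

/-- Since ∂t_k/∂x_i = x_i^{2k}, the chain rule gives a second-order part and a part from
differentiating x_i^{2k}. The factor x_i^3 makes the second-order exponent 2(b+c+1)+1, which is the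
power sum multiplying ∂_b∂_c in the cut-and-join recursion. -/
theorem der_der_miwa [DecidableEq ι] {x : ι → A} {S : Finset ι} {i : ι} (hi : i ∈ S)
    (D : Derivation ℚ A A) (hD : ∀ j, D (x j) = if j = i then 1 else 0) {K : ℕ}
    {f : MvPolynomial ℕ ℚ} (hf : f ∈ MvPolynomial.supported ℚ (Set.Iio K)) :
    x i ^ 3 * D (D (miwa x S f)) = ∑ k ∈ Finset.range K,
        ((2 * k : ℕ) : A) * x i ^ (2 * k + 2) * miwa x S (MvPolynomial.pderiv k f)
      + ∑ b ∈ Finset.range K, ∑ c ∈ Finset.range K, x i ^ (2 * (b + c + 1) + 1) *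
          miwa x S (MvPolynomial.pderiv b (MvPolynomial.pderiv c f)) := by
  rw [der_miwa_single hi D hD hf, map_sum, Finset.mul_sum, Finset.sum_comm (s := Finset.range K)
    (t := Finset.range K), ← Finset.sum_add_distrib]
  refine Finset.sum_congr rfl fun k _ => ?_
  rw [D.leibniz, der_miwa_single hi D hD (pderiv_mem_supported k hf), D.leibniz_pow, hD, if_pos rfl,
    smul_eq_mul, smul_eq_mul, smul_eq_mul, mul_one, nsmul_eq_mul, mul_add, Finset.mul_sum,
    Finset.mul_sum, add_comm]
  congr 1
  · rcases k with _ | k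
    · simp
    · rw [show 2 * (k + 1) - 1 = 2 * k + 1 by omega, show 2 * (k + 1) + 2 = 2 * k + 1 + 3 by ring,
        pow_add _ _ 3]
      ring
  · refine Finset.sum_congr rfl fun b _ => ?_
    rw [show 2 * (b + k + 1) + 1 = 3 + 2 * k + 2 * b by ring, pow_add, pow_add]
    ring

theorem sum_sum_shift {R : Type*} [CommRing R] {K K' : ℕ} (hK : K ≤ K') (p q : ℕ → R) (hq : ∀ m, K ≤ m → q m = 0) :
    ∑ k ∈ Finset.range K', p k * ∑ l ∈ Finset.range K, p l * q (l + k)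
      = ∑ m ∈ Finset.range K, (∑ k ∈ Finset.range (m + 1), p k * p (m - k)) * q m := by
  have h1 : ∑ m ∈ Finset.range K, (∑ k ∈ Finset.range (m + 1), p k * p (m - k)) * q m
      = ∑ m ∈ Finset.range K, ∑ k ∈ Finset.range (m + 1), (fun a b => p a * p b * q (a + b)) k (m - k) := by
    refine Finset.sum_congr rfl fun m _ => ?_
    rw [Finset.sum_mul]
    refine Finset.sum_congr rfl fun k hk => ?_
    rw [Finset.mem_range] at hk
    simp only [show k + (m - k) = m by omega]
  rw [h1, Finset.sum_range_diag_flip (f := fun a b => p a * p b * q (a + b))]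
  have h2 : ∑ k ∈ Finset.range K', p k * ∑ l ∈ Finset.range K, p l * q (l + k)
      = ∑ k ∈ Finset.range K, p k * ∑ l ∈ Finset.range K, p l * q (l + k) := by
    refine (Finset.sum_subset (Finset.range_subset_range.2 hK) fun k _ hk => ?_).symm
    rw [Finset.mem_range, not_lt] at hk
    rw [Finset.sum_eq_zero, mul_zero]
    intro l _
    rw [hq _ (by omega), mul_zero]
  rw [h2]
  refine Finset.sum_congr rfl fun k _ => ?_
  rw [Finset.mul_sum]
  symm
  refine Finset.sum_subset_zero_on_sdiff (Finset.range_subset_range.2 (Nat.sub_le K k)) ?_ ?_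
  · intro l hl
    rw [Finset.mem_sdiff, Finset.mem_range, Finset.mem_range] at hl
    rw [hq _ (by omega)]
    ring
  · intro l _
    rw [add_comm l k]
    ring

theorem sum_sum_quad {R : Type*} [CommRing R] (K : ℕ) (p : ℕ → R) (q : ℕ → ℕ → R) (hq : ∀ b c, K ≤ b ∨ K ≤ c → q b c = 0) :
    ∑ k ∈ Finset.range (2 * K + 1), p k * ∑ b ∈ Finset.range k, q b (k - 1 - b)
      = ∑ b ∈ Finset.range K, ∑ c ∈ Finset.range K, p (b + c + 1) * q b c := by
  rw [Finset.sum_range_succ', Finset.range_zero, Finset.sum_empty, mul_zero, add_zero]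
  have h1 : ∑ k ∈ Finset.range (2 * K), p (k + 1) * ∑ b ∈ Finset.range (k + 1), q b (k + 1 - 1 - b)
      = ∑ m ∈ Finset.range (2 * K), ∑ k ∈ Finset.range (m + 1),
        (fun a b => p (a + b + 1) * q a b) k (m - k) := by
    refine Finset.sum_congr rfl fun m _ => ?_
    rw [Finset.mul_sum]
    refine Finset.sum_congr rfl fun k hk => ?_
    rw [Finset.mem_range] at hk
    simp only [show k + (m - k) = m by omega, Nat.add_sub_cancel]
  rw [h1, Finset.sum_range_diag_flip (f := fun a b => p (a + b + 1) * q a b)]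
  symm
  refine Finset.sum_subset_zero_on_sdiff (Finset.range_subset_range.2 (by omega)) ?_ ?_
  · intro b hb
    rw [Finset.mem_sdiff, Finset.mem_range, Finset.mem_range] at hb
    refine Finset.sum_eq_zero fun c _ => ?_
    rw [hq b c (Or.inl (by omega)), mul_zero]
  · intro b hb
    rw [Finset.mem_range] at hb
    refine Finset.sum_subset (Finset.range_subset_range.2 (by omega)) fun c _ hc => ?_
    rw [Finset.mem_range] at hc
    rw [hq b c (Or.inr (by omega)), mul_zero]

end Miwa

/-! ### The cut-and-join equation in Miwa variables -/

section Hamiltonian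

variable {ι F : Type*} [DecidableEq ι] [Field F]

theorem geom_pair (m : ℕ) {u v : F} (h : u ^ 2 ≠ v ^ 2) :
    ∑ k ∈ Finset.range (m + 1), u ^ (2 * k + 1) * v ^ (2 * (m - k) + 1)
      = u * v * (u ^ (2 * m + 2) - v ^ (2 * m + 2)) / (u ^ 2 - v ^ 2) := by
  rw [eq_div_iff (sub_ne_zero.2 h)]
  have := Commute.geom_sum₂_mul (Commute.all (u ^ 2) (v ^ 2)) (m + 1)
  rw [← pow_mul, ← pow_mul, show 2 * (m + 1) = 2 * m + 2 by ring] at this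
  rw [← this, ← mul_assoc]
  congr 1
  rw [Finset.mul_sum]
  refine Finset.sum_congr rfl fun k _ => ?_
  rw [Nat.add_sub_cancel, ← pow_mul, ← pow_mul]
  ring

/-- The cut-and-join equation for the Miwa specialization. -/
theorem miwa_cutJoin [Algebra ℚ F] {x : ι → F} {S : Finset ι} (D : ι → Derivation ℚ F F)
    (hD : ∀ i j, D i (x j) = if j = i then 1 else 0)
    (hx : ∀ i ∈ S, ∀ j ∈ S, j ≠ i → x i ^ 2 ≠ x j ^ 2) (n : ℕ) :
    ((n + 1 : ℕ) : F) * miwa x S (zpart (n + 1)) =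
      ∑ i ∈ S, (1 / 2 * x i ^ 3 * D i (D i (miwa x S (zpart n)))
        + x i ^ 2 * D i (miwa x S (zpart n)) + 1 / 8 * x i * miwa x S (zpart n))
      + ∑ i ∈ S, x i ^ 3 * (∑ j ∈ S.erase i, 2 * x j / (x i ^ 2 - x j ^ 2)) *
          D i (miwa x S (zpart n)) := by
  have : CharZero F := algebraRat.charZero F
  set K := 2 ^ n with hKdef
  have hK : 0 < K := Nat.two_pow_pos n
  have hf := zpart_mem_supported n
  set f := zpart n with hfdef
  set σ := miwa x S with hσ
  set p : ℕ → F := fun k => ∑ i ∈ S, x i ^ (2 * k + 1) with hp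
  have hhalf : ∀ c : ℚ, σ (MvPolynomial.C c) = (c : F) := by
    intro c
    rw [hσ, miwa, MvPolynomial.aeval_C, eq_ratCast]
  have e0 : ((n + 1 : ℕ) : F) * σ (zpart (n + 1)) = ∑ k ∈ Finset.range (2 * K + 1),
      p k * σ (vir k f) := by
    rw [← map_natCast σ, ← map_mul, zpart_succ_eq (K := 2 * K + 1) (by rw [pow_succ]; omega), map_sum]
    refine Finset.sum_congr rfl fun k _ => ?_
    rw [map_mul, hσ, miwa_mul_X]
  have e1 : ∑ k ∈ Finset.range (2 * K + 1), p k * σ (shiftDer k f)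
      = ∑ m ∈ Finset.range K, (∑ k ∈ Finset.range (m + 1), p k * p (m - k)) *
          σ (MvPolynomial.pderiv m f) := by
    rw [← sum_sum_shift (K' := 2 * K + 1) (by omega) p (fun m => σ (MvPolynomial.pderiv m f))
      (fun m hm => by rw [pderiv_eq_zero_of_supported hm hf, map_zero])]
    refine Finset.sum_congr rfl fun k _ => ?_
    rw [shiftDer_eq_sum k hf, map_sum]
    congr 1
    refine Finset.sum_congr rfl fun l _ => ?_
    rw [map_mul, hσ, miwa_mul_X]
  have e2 : ∑ k ∈ Finset.range (2 * K + 1), p k * σ (quadDer k f)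
      = ∑ b ∈ Finset.range K, ∑ c ∈ Finset.range K, p (b + c + 1) *
          σ (MvPolynomial.pderiv b (MvPolynomial.pderiv c f)) := by
    rw [← sum_sum_quad K p (fun b c => σ (MvPolynomial.pderiv b (MvPolynomial.pderiv c f)))]
    · refine Finset.sum_congr rfl fun k _ => ?_
      rw [quadDer, map_sum]
    · rintro b c (h | h)
      · rw [pderiv_eq_zero_of_supported h (pderiv_mem_supported c hf), map_zero]
      · rw [pderiv_eq_zero_of_supported h hf, map_zero, map_zero]
  have e3 : ∑ k ∈ Finset.range (2 * K + 1), p k * σ (if k = 0 then MvPolynomial.C (1 / 8) * f else 0)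
      = ∑ i ∈ S, 1 / 8 * x i * σ f := by
    rw [Finset.sum_eq_single 0]
    · rw [if_pos rfl, map_mul, hhalf, hp, Finset.sum_mul]
      refine Finset.sum_congr rfl fun i _ => ?_
      push_cast
      ring
    · intro k _ hk
      rw [if_neg hk, map_zero, mul_zero]
    · intro h
      exact absurd (Finset.mem_range.2 (by omega)) h
  -- Products of power sums are double sums over i, j. The diagonal gives (m+1) x_i^{2m+2}; off the
  -- diagonal the sum over k is geometric, and its two end terms are exchanged by i ↔ j.
  have e4 : ∀ m, ∑ k ∈ Finset.range (m + 1), p k * p (m - k)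
      = ∑ i ∈ S, ((m + 1 : ℕ) : F) * x i ^ (2 * m + 2)
        + ∑ i ∈ S, ∑ j ∈ S.erase i, 2 * x i * x j / (x i ^ 2 - x j ^ 2) * x i ^ (2 * m + 2) := by
    intro m
    have h1 : ∑ k ∈ Finset.range (m + 1), p k * p (m - k) = ∑ i ∈ S, ∑ j ∈ S,
        ∑ k ∈ Finset.range (m + 1), x i ^ (2 * k + 1) * x j ^ (2 * (m - k) + 1) := by
      simp only [hp, Finset.sum_mul_sum]
      rw [Finset.sum_comm]
      refine Finset.sum_congr rfl fun i _ => ?_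
      rw [Finset.sum_comm]
    have h2 : ∀ i ∈ S, ∑ j ∈ S,
        ∑ k ∈ Finset.range (m + 1), x i ^ (2 * k + 1) * x j ^ (2 * (m - k) + 1)
        = ((m + 1 : ℕ) : F) * x i ^ (2 * m + 2) + ∑ j ∈ S.erase i,
          (x i * x j / (x i ^ 2 - x j ^ 2) * x i ^ (2 * m + 2)
            + x j * x i / (x j ^ 2 - x i ^ 2) * x j ^ (2 * m + 2)) := by
      intro i hi
      rw [← Finset.add_sum_erase S _ hi]
      congr 1
      · rw [Finset.sum_congr rfl (g := fun _ => x i ^ (2 * m + 2))]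
        · rw [Finset.sum_const, Finset.card_range, nsmul_eq_mul]
        · intro k hk
          rw [Finset.mem_range] at hk
          rw [← pow_add]
          congr 1
          omega
      · refine Finset.sum_congr rfl fun j hj => ?_
        rw [Finset.mem_erase] at hj
        have h := hx i hi j hj.2 hj.1
        rw [geom_pair m h]
        have h' : x i ^ 2 - x j ^ 2 ≠ 0 := sub_ne_zero.2 h
        have h'' : x j ^ 2 - x i ^ 2 ≠ 0 := sub_ne_zero.2 h.symm
        field_simp
        ring
    have h3 : ∑ i ∈ S, ∑ j ∈ S.erase i, x j * x i / (x j ^ 2 - x i ^ 2) * x j ^ (2 * m + 2)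
        = ∑ i ∈ S, ∑ j ∈ S.erase i, x i * x j / (x i ^ 2 - x j ^ 2) * x i ^ (2 * m + 2) := by
      refine Finset.sum_comm' ?_
      intro i j
      simp only [Finset.mem_erase]
      tauto
    rw [h1, Finset.sum_congr rfl h2, Finset.sum_add_distrib]
    congr 1
    simp only [Finset.sum_add_distrib]
    rw [h3, ← Finset.sum_add_distrib]
    refine Finset.sum_congr rfl fun i _ => ?_
    rw [← Finset.sum_add_distrib]
    refine Finset.sum_congr rfl fun j _ => ?_
    ring
  have e5 : ∑ m ∈ Finset.range K, (∑ k ∈ Finset.range (m + 1), p k * p (m - k)) *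
          σ (MvPolynomial.pderiv m f)
      = ∑ i ∈ S, (∑ m ∈ Finset.range K, ((m + 1 : ℕ) : F) * x i ^ (2 * m + 2) *
          σ (MvPolynomial.pderiv m f))
        + ∑ i ∈ S, x i ^ 3 * (∑ j ∈ S.erase i, 2 * x j / (x i ^ 2 - x j ^ 2)) * D i (σ f) := by
    rw [Finset.sum_congr rfl (fun m _ => by rw [e4, add_mul, Finset.sum_mul, Finset.sum_mul]),
      Finset.sum_add_distrib, Finset.sum_comm]
    congr 1
    rw [Finset.sum_comm]
    refine Finset.sum_congr rfl fun i hi => ?_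
    rw [hσ, der_miwa_single hi (D i) (hD i) hf, Finset.mul_sum]
    refine Finset.sum_congr rfl fun m _ => ?_
    rw [Finset.mul_sum, Finset.sum_mul, Finset.sum_mul]
    refine Finset.sum_congr rfl fun j _ => ?_
    ring
  -- The weight m+1 of the diagonal splits as m + 1: half of the 2m from `der_der_miwa`, and 1 from
  -- the first-order term.
  have e6 : ∀ i ∈ S, 1 / 2 * x i ^ 3 * D i (D i (σ f)) + x i ^ 2 * D i (σ f)
      = (∑ m ∈ Finset.range K, ((m + 1 : ℕ) : F) * x i ^ (2 * m + 2) *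
          σ (MvPolynomial.pderiv m f))
        + 1 / 2 * ∑ b ∈ Finset.range K, ∑ c ∈ Finset.range K, x i ^ (2 * (b + c + 1) + 1) *
          σ (MvPolynomial.pderiv b (MvPolynomial.pderiv c f)) := by
    intro i hi
    have h1 := der_der_miwa (S := S) hi (D i) (hD i) hf
    rw [mul_assoc, h1, hσ, der_miwa_single hi (D i) (hD i) hf, mul_add, add_right_comm,
      Finset.mul_sum, Finset.mul_sum, ← Finset.sum_add_distrib]
    congr 1
    refine Finset.sum_congr rfl fun m _ => ?_
    push_cast
    ring
  have e7 : ∑ b ∈ Finset.range K, ∑ c ∈ Finset.range K, p (b + c + 1) *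
          σ (MvPolynomial.pderiv b (MvPolynomial.pderiv c f))
      = ∑ i ∈ S, ∑ b ∈ Finset.range K, ∑ c ∈ Finset.range K, x i ^ (2 * (b + c + 1) + 1) *
          σ (MvPolynomial.pderiv b (MvPolynomial.pderiv c f)) := by
    rw [Finset.sum_comm (s := S)]
    refine Finset.sum_congr rfl fun b _ => ?_
    rw [Finset.sum_comm (s := S)]
    refine Finset.sum_congr rfl fun c _ => ?_
    rw [hp, Finset.sum_mul]
  have e8 : ∀ k, p k * σ (vir k f) = p k * σ (shiftDer k f) + 1 / 2 * (p k * σ (quadDer k f))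
      + p k * σ (if k = 0 then MvPolynomial.C (1 / 8) * f else 0) := by
    intro k
    rw [vir, map_add, map_add, map_mul, hhalf]
    push_cast
    ring
  rw [e0, Finset.sum_congr rfl (fun k _ => e8 k), Finset.sum_add_distrib, Finset.sum_add_distrib,
    ← Finset.mul_sum, e1, e2, e3, e5, e7, Finset.sum_add_distrib, Finset.sum_congr rfl e6,
    Finset.sum_add_distrib, ← Finset.mul_sum]
  ring

end Hamiltonian

/-! ### Decoupling into one-variable operators -/

section FreeHamiltonian

variable {ι F : Type*} [Field F] [Algebra ℚ F]

/-- The operator `½x³D² + x²D + x/8`, applied to the coefficients of a power series. -/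
noncomputable def hOp (D : Derivation ℚ F F) (x : F) (f : PowerSeries F) : PowerSeries F :=
  PowerSeries.C (1 / 2 * x ^ 3) * mapDer D (mapDer D f) + PowerSeries.C (x ^ 2) * mapDer D f
    + PowerSeries.C (1 / 8 * x) * f

/-- The Miwa specialization of the partition function. -/
noncomputable def miwaZ {A : Type*} [CommRing A] [Algebra ℚ A] (x : ι → A) (S : Finset ι) :
    PowerSeries A := PowerSeries.map (miwa x S : MvPolynomial ℕ ℚ →+* A) zser

theorem coeff_miwaZ {A : Type*} [CommRing A] [Algebra ℚ A] (x : ι → A) (S : Finset ι) (n : ℕ) :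
    PowerSeries.coeff n (miwaZ x S) = miwa x S (zpart n) := by
  rw [miwaZ, PowerSeries.coeff_map, coeff_zser]
  rfl

variable [DecidableEq ι]

theorem deriv_miwaZ {x : ι → F} {S : Finset ι} (D : ι → Derivation ℚ F F)
    (hD : ∀ i j, D i (x j) = if j = i then 1 else 0)
    (hx : ∀ i ∈ S, ∀ j ∈ S, j ≠ i → x i ^ 2 ≠ x j ^ 2) :
    PowerSeries.derivative F (miwaZ x S) = ∑ i ∈ S, (hOp (D i) (x i) (miwaZ x S)
      + PowerSeries.C (x i ^ 3 * ∑ j ∈ S.erase i, 2 * x j / (x i ^ 2 - x j ^ 2)) *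
          mapDer (D i) (miwaZ x S)) := by
  ext n
  rw [PowerSeries.coeff_derivative, coeff_miwaZ, map_sum, mul_comm]
  have h := miwa_cutJoin D hD hx n
  push_cast at h
  rw [h, ← Finset.sum_add_distrib]
  refine Finset.sum_congr rfl fun i _ => ?_
  simp only [hOp, map_add, PowerSeries.coeff_C_mul, coeff_mapDer, coeff_miwaZ]

/-- Conjugating by a factor with logarithmic derivative a adds a first-order term x³aD, which is the
interaction term of the cut-and-join operator for a suitable factor, and a potential that has to
cancel in total. -/
theorem hOp_C_mul (D : Derivation ℚ F F) (x c a : F) (hc : D c = c * a) (f : PowerSeries F) :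
    hOp D x (PowerSeries.C c * f) = PowerSeries.C c * (hOp D x f
      + PowerSeries.C (x ^ 3 * a) * mapDer D f
      + PowerSeries.C (1 / 2 * x ^ 3 * (a ^ 2 + D a) + x ^ 2 * a) * f) := by
  have h2 : (PowerSeries.C (1 / 2 : F)) * 2 = 1 := by
    have : CharZero F := algebraRat.charZero F
    rw [← map_ofNat PowerSeries.C 2, ← map_mul]
    norm_num
  simp only [hOp, Derivation.leibniz, map_add, mapDer_C, hc, smul_eq_mul, map_mul, map_pow]
  linear_combination PowerSeries.C x ^ 3 * PowerSeries.C c * PowerSeries.C a * mapDer D f * h2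

/-- Conjugation by `Δ` turns the cut-and-join operator into a sum of one-variable operators. -/
theorem deriv_C_mul_miwaZ {x : ι → F} {S : Finset ι} (D : ι → Derivation ℚ F F)
    (hD : ∀ i j, D i (x j) = if j = i then 1 else 0)
    (hx : ∀ i ∈ S, ∀ j ∈ S, j ≠ i → x i ^ 2 ≠ x j ^ 2) (Δ : F) (a : ι → F)
    (ha : ∀ i ∈ S, a i = ∑ j ∈ S.erase i, 2 * x j / (x i ^ 2 - x j ^ 2))
    (hΔ : ∀ i ∈ S, D i Δ = Δ * a i)
    (h0 : ∑ i ∈ S, (1 / 2 * x i ^ 3 * (a i ^ 2 + D i (a i)) + x i ^ 2 * a i) = 0) :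
    PowerSeries.derivative F (PowerSeries.C Δ * miwaZ x S) =
      ∑ i ∈ S, hOp (D i) (x i) (PowerSeries.C Δ * miwaZ x S) := by
  have h1 : PowerSeries.derivative F (PowerSeries.C Δ * miwaZ x S)
      = PowerSeries.C Δ * PowerSeries.derivative F (miwaZ x S) := by
    rw [Derivation.leibniz, PowerSeries.derivative_C, smul_zero, add_zero, smul_eq_mul]
  rw [h1, deriv_miwaZ D hD hx, Finset.sum_congr rfl
    (fun i hi => hOp_C_mul (D i) (x i) Δ (a i) (hΔ i hi) (miwaZ x S)), ← Finset.mul_sum]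
  simp only [Finset.sum_add_distrib]
  rw [← Finset.sum_mul, ← map_sum, h0, map_zero, zero_mul, add_zero]
  congr 2
  refine Finset.sum_congr rfl fun i hi => ?_
  rw [ha i hi]

theorem hOp_sub (D : Derivation ℚ F F) (x : F) (f g : PowerSeries F) :
    hOp D x (f - g) = hOp D x f - hOp D x g := by
  simp only [hOp, map_sub]
  ring

theorem hOp_mul_of_der_eq_zero (D : Derivation ℚ F F) (x : F) (f g : PowerSeries F)
    (hg : mapDer D g = 0) : hOp D x (f * g) = hOp D x f * g := by
  have h : ∀ f', mapDer D (f' * g) = mapDer D f' * g := fun f' => by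
    rw [Derivation.leibniz, hg, smul_zero, zero_add, smul_eq_mul, mul_comm]
  rw [hOp, h, h, hOp]
  ring

/-- The right side acts coefficientwise, so the equation determines coefficient n+1 from coefficient
n; dividing by n+1 uses characteristic zero. -/
theorem eq_of_deriv_eq {x : ι → F} {S : Finset ι} (D : ι → Derivation ℚ F F) (f g : PowerSeries F)
    (hf : PowerSeries.derivative F f = ∑ i ∈ S, hOp (D i) (x i) f)
    (hg : PowerSeries.derivative F g = ∑ i ∈ S, hOp (D i) (x i) g)
    (h0 : PowerSeries.coeff 0 f = PowerSeries.coeff 0 g) : f = g := by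
  have : CharZero F := algebraRat.charZero F
  ext n
  induction n with
  | zero => exact h0
  | succ n ih =>
    have h1 := congrArg (PowerSeries.coeff n) hf
    have h2 := congrArg (PowerSeries.coeff n) hg
    simp only [PowerSeries.coeff_derivative, map_sum, hOp, map_add, PowerSeries.coeff_C_mul,
      coeff_mapDer] at h1 h2
    rw [ih, ← h2] at h1
    exact mul_right_cancel₀ (by exact_mod_cast Nat.succ_ne_zero n) h1

theorem deriv_mul_of_disjoint {x : ι → F} {S T : Finset ι} (hST : Disjoint S T)
    (D : ι → Derivation ℚ F F) (f g : PowerSeries F)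
    (hf : PowerSeries.derivative F f = ∑ i ∈ S, hOp (D i) (x i) f)
    (hg : PowerSeries.derivative F g = ∑ i ∈ T, hOp (D i) (x i) g)
    (hf0 : ∀ i ∈ T, mapDer (D i) f = 0) (hg0 : ∀ i ∈ S, mapDer (D i) g = 0) :
    PowerSeries.derivative F (f * g) = ∑ i ∈ S ∪ T, hOp (D i) (x i) (f * g) := by
  rw [Derivation.leibniz, hf, hg, Finset.sum_union hST, smul_eq_mul, smul_eq_mul, Finset.mul_sum,
    Finset.mul_sum, add_comm]
  congr 1
  · refine Finset.sum_congr rfl fun i hi => ?_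
    rw [hOp_mul_of_der_eq_zero _ _ _ _ (hg0 i hi), mul_comm]
  · refine Finset.sum_congr rfl fun i hi => ?_
    rw [mul_comm f g, hOp_mul_of_der_eq_zero _ _ g f (hf0 i hi), mul_comm]

theorem mapDer_miwaZ_of_notMem {x : ι → F} {S : Finset ι} (D : ι → Derivation ℚ F F)
    (hD : ∀ i j, D i (x j) = if j = i then 1 else 0) {i : ι} (hi : i ∉ S) :
    mapDer (D i) (miwaZ x S) = 0 := by
  ext n
  rw [coeff_mapDer, coeff_miwaZ, der_miwa_of_notMem hi (D i) (hD i), map_zero]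

/-- The logarithmic derivative of `(xᵢ - xⱼ)/(xᵢ + xⱼ)`. -/
theorem der_delta {x : ι → F} (D : ι → Derivation ℚ F F)
    (hD : ∀ i j, D i (x j) = if j = i then 1 else 0) {i j : ι} (h : x i ^ 2 ≠ x j ^ 2) (k : ι) :
    D k ((x i - x j) / (x i + x j)) = (x i - x j) / (x i + x j) *
      ((if i = k then 2 * x j / (x i ^ 2 - x j ^ 2) else 0)
        + if j = k then 2 * x i / (x j ^ 2 - x i ^ 2) else 0) := by
  have h1 : x i + x j ≠ 0 := fun e => h (by linear_combination (x i - x j) * e)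
  have h2 : x i ^ 2 - x j ^ 2 ≠ 0 := sub_ne_zero.2 h
  have h3 : x j ^ 2 - x i ^ 2 ≠ 0 := sub_ne_zero.2 h.symm
  rw [Derivation.leibniz_div, map_add, map_sub, hD, hD]
  simp only [smul_eq_mul]
  split_ifs <;> field_simp <;> ring

theorem der_logDer {x : ι → F} (D : ι → Derivation ℚ F F)
    (hD : ∀ i j, D i (x j) = if j = i then 1 else 0) {i j : ι} (hij : j ≠ i) :
    D i (2 * x j / (x i ^ 2 - x j ^ 2)) = - (4 * x i * x j) / (x i ^ 2 - x j ^ 2) ^ 2 := by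
  have h2 : D i 2 = 0 := (D i).map_natCast 2
  rw [Derivation.leibniz_div, map_sub, Derivation.leibniz, Derivation.leibniz_pow,
    Derivation.leibniz_pow, hD, hD, if_neg hij, if_pos rfl, h2]
  simp only [smul_eq_mul, nsmul_eq_mul]
  rw [div_eq_mul_inv, ← inv_pow]
  push_cast
  ring

/-- The potential produced by conjugation cancels within each pair of variables. The cross terms of
the squared logarithmic derivatives cancel over triples, by `triple_identity`. -/
theorem pair_identity {u v : F} (h : u ^ 2 ≠ v ^ 2) :
    1 / 2 * u ^ 3 * ((2 * v / (u ^ 2 - v ^ 2)) ^ 2 + - (4 * u * v) / (u ^ 2 - v ^ 2) ^ 2)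
      + u ^ 2 * (2 * v / (u ^ 2 - v ^ 2))
      + (1 / 2 * v ^ 3 * ((2 * u / (v ^ 2 - u ^ 2)) ^ 2 + - (4 * v * u) / (v ^ 2 - u ^ 2) ^ 2)
      + v ^ 2 * (2 * u / (v ^ 2 - u ^ 2))) = 0 := by
  have : CharZero F := algebraRat.charZero F
  have h2 : u ^ 2 - v ^ 2 ≠ 0 := sub_ne_zero.2 h
  have h3 : v ^ 2 - u ^ 2 ≠ 0 := sub_ne_zero.2 h.symm
  rw [show v ^ 2 - u ^ 2 = - (u ^ 2 - v ^ 2) by ring]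
  field_simp
  ring

theorem triple_identity {K : Type*} [Field K] {u v w : K} (h : u ^ 2 ≠ v ^ 2) (h' : u ^ 2 ≠ w ^ 2) (h'' : v ^ 2 ≠ w ^ 2) :
    u ^ 3 * (2 * v / (u ^ 2 - v ^ 2)) * (2 * w / (u ^ 2 - w ^ 2))
      + v ^ 3 * (2 * u / (v ^ 2 - u ^ 2)) * (2 * w / (v ^ 2 - w ^ 2))
      + w ^ 3 * (2 * u / (w ^ 2 - u ^ 2)) * (2 * v / (w ^ 2 - v ^ 2)) = 0 := by
  have h1 : u ^ 2 - v ^ 2 ≠ 0 := sub_ne_zero.2 h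
  have h2 : u ^ 2 - w ^ 2 ≠ 0 := sub_ne_zero.2 h'
  have h3 : v ^ 2 - w ^ 2 ≠ 0 := sub_ne_zero.2 h''
  rw [show v ^ 2 - u ^ 2 = - (u ^ 2 - v ^ 2) by ring, show w ^ 2 - u ^ 2 = - (u ^ 2 - w ^ 2) by ring,
    show w ^ 2 - v ^ 2 = - (v ^ 2 - w ^ 2) by ring]
  field_simp
  ring

/-- The two-variable function `(xᵢ - xⱼ)/(xᵢ + xⱼ) Z(xᵢ, xⱼ)` satisfies the decoupled equation. -/
theorem deriv_delta_mul_miwaZ_pair {x : ι → F} (D : ι → Derivation ℚ F F)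
    (hD : ∀ i j, D i (x j) = if j = i then 1 else 0) {i j : ι} (hij : i ≠ j)
    (h : x i ^ 2 ≠ x j ^ 2) :
    PowerSeries.derivative F (PowerSeries.C ((x i - x j) / (x i + x j)) * miwaZ x {i, j}) =
      ∑ k ∈ {i, j}, hOp (D k) (x k) (PowerSeries.C ((x i - x j) / (x i + x j)) * miwaZ x {i, j}) := by
  have ei : ({i, j} : Finset ι).erase i = {j} := by
    ext k; simp only [Finset.mem_erase, Finset.mem_insert, Finset.mem_singleton]; aesop
  have ej : ({i, j} : Finset ι).erase j = {i} := by
    ext k; simp only [Finset.mem_erase, Finset.mem_insert, Finset.mem_singleton]; aesop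
  refine deriv_C_mul_miwaZ D hD ?_ _
    (fun k => if k = i then 2 * x j / (x i ^ 2 - x j ^ 2) else 2 * x i / (x j ^ 2 - x i ^ 2)) ?_ ?_ ?_
  · intro k hk l hl hkl
    simp only [Finset.mem_insert, Finset.mem_singleton] at hk hl
    rcases hk with rfl | rfl <;> rcases hl with rfl | rfl
    · exact absurd rfl hkl
    · exact h
    · exact h.symm
    · exact absurd rfl hkl
  · intro k hk
    simp only [Finset.mem_insert, Finset.mem_singleton] at hk
    rcases hk with rfl | rfl
    · rw [if_pos rfl, ei, Finset.sum_singleton]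
    · rw [if_neg hij.symm, ej, Finset.sum_singleton]
  · intro k hk
    simp only [Finset.mem_insert, Finset.mem_singleton] at hk
    rw [der_delta D hD h]
    rcases hk with rfl | rfl
    · simp [hij.symm]
    · simp [hij, hij.symm]
  · rw [Finset.sum_pair hij, if_pos rfl, if_neg hij.symm, der_logDer D hD hij.symm,
      der_logDer D hD hij]
    exact pair_identity h

end FreeHamiltonian

/-! ### The Pfaffian formula in four variables -/

section FourVariables

variable {F : Type*} [Field F] [Algebra ℚ F]

/-- Schur's Pfaffian identity of size four; it is needed as the equality of initial values in
`pfaffian_four`. -/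
theorem schur_pfaffian {K : Type*} [Field K] {a b c d : K} (h1 : a + b ≠ 0) (h2 : a + c ≠ 0)
    (h3 : a + d ≠ 0) (h4 : b + c ≠ 0) (h5 : b + d ≠ 0) (h6 : c + d ≠ 0) :
    (a - b) / (a + b) * ((c - d) / (c + d)) - (a - c) / (a + c) * ((b - d) / (b + d))
      + (a - d) / (a + d) * ((b - c) / (b + c))
    = (a - b) / (a + b) * ((a - c) / (a + c)) * ((a - d) / (a + d)) * ((b - c) / (b + c))
      * ((b - d) / (b + d)) * ((c - d) / (c + d)) := by
  field_simp
  ring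

theorem coeff_zero_miwaZ {ι A : Type*} [CommRing A] [Algebra ℚ A] (x : ι → A) (S : Finset ι) :
    PowerSeries.coeff 0 (miwaZ x S) = 1 := by
  rw [coeff_miwaZ, zpart, map_one]

theorem logDer_mul {A : Type*} [CommRing A] [Algebra ℚ A] (D : Derivation ℚ A A) {f g a b : A}
    (hf : D f = f * a) (hg : D g = g * b) : D (f * g) = f * g * (a + b) := by
  rw [D.leibniz, hf, hg, smul_eq_mul, smul_eq_mul]
  ring

theorem deriv_delta_mul_miwaZ_four {x : Fin 4 → F} (D : Fin 4 → Derivation ℚ F F)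
    (hD : ∀ i j, D i (x j) = if j = i then 1 else 0)
    (hx : ∀ i j, i ≠ j → x i ^ 2 ≠ x j ^ 2) (Δ : F)
    (hΔ : Δ = (x 0 - x 1) / (x 0 + x 1) * ((x 0 - x 2) / (x 0 + x 2)) * ((x 0 - x 3) / (x 0 + x 3))
      * ((x 1 - x 2) / (x 1 + x 2)) * ((x 1 - x 3) / (x 1 + x 3)) * ((x 2 - x 3) / (x 2 + x 3))) :
    PowerSeries.derivative F (PowerSeries.C Δ * miwaZ x Finset.univ) =
      ∑ i, hOp (D i) (x i) (PowerSeries.C Δ * miwaZ x Finset.univ) := by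
  set b : Fin 4 → Fin 4 → F := fun i j => 2 * x j / (x i ^ 2 - x j ^ 2) with hb
  have e0 : (Finset.univ : Finset (Fin 4)).erase 0 = {1, 2, 3} := by decide
  have e1 : (Finset.univ : Finset (Fin 4)).erase 1 = {0, 2, 3} := by decide
  have e2 : (Finset.univ : Finset (Fin 4)).erase 2 = {0, 1, 3} := by decide
  have e3 : (Finset.univ : Finset (Fin 4)).erase 3 = {0, 1, 2} := by decide
  have s3 : ∀ (i j k : Fin 4) (f : Fin 4 → F), i ≠ j → i ≠ k → j ≠ k →
      ∑ l ∈ ({i, j, k} : Finset (Fin 4)), f l = f i + f j + f k := by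
    intro i j k f hij hik hjk
    rw [Finset.sum_insert (by simp [hij, hik]), Finset.sum_pair hjk, add_assoc]
  have ha0 : ∑ j ∈ (Finset.univ : Finset (Fin 4)).erase 0, b 0 j = b 0 1 + b 0 2 + b 0 3 := by
    rw [e0, s3] <;> decide
  have ha1 : ∑ j ∈ (Finset.univ : Finset (Fin 4)).erase 1, b 1 j = b 1 0 + b 1 2 + b 1 3 := by
    rw [e1, s3] <;> decide
  have ha2 : ∑ j ∈ (Finset.univ : Finset (Fin 4)).erase 2, b 2 j = b 2 0 + b 2 1 + b 2 3 := by
    rw [e2, s3] <;> decide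
  have ha3 : ∑ j ∈ (Finset.univ : Finset (Fin 4)).erase 3, b 3 j = b 3 0 + b 3 1 + b 3 2 := by
    rw [e3, s3] <;> decide
  refine deriv_C_mul_miwaZ D hD (fun i _ j _ h => hx i j h.symm) Δ
    (fun i => ∑ j ∈ (Finset.univ : Finset (Fin 4)).erase i, b i j) (fun i _ => rfl) ?_ ?_
  · intro i _
    have key := logDer_mul (D i) (logDer_mul (D i) (logDer_mul (D i) (logDer_mul (D i)
      (logDer_mul (D i) (der_delta D hD (hx 0 1 (by decide)) i)
      (der_delta D hD (hx 0 2 (by decide)) i)) (der_delta D hD (hx 0 3 (by decide)) i))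
      (der_delta D hD (hx 1 2 (by decide)) i)) (der_delta D hD (hx 1 3 (by decide)) i))
      (der_delta D hD (hx 2 3 (by decide)) i)
    rw [← hΔ] at key
    rw [key]
    congr 1
    fin_cases i
    · refine Eq.trans ?_ ha0.symm; simp [hb]
    · refine Eq.trans ?_ ha1.symm; simp [hb]
    · refine Eq.trans ?_ ha2.symm; simp [hb]
    · refine Eq.trans ?_ ha3.symm; simp [hb]
  -- Expanding the square of a sum of three logarithmic derivatives separates the potential into six
  -- pair contributions and four triple contributions, each of which vanishes.
  · have hp : ∀ i j, i ≠ j → 1 / 2 * x i ^ 3 * (b i j ^ 2 + D i (b i j)) + x i ^ 2 * b i j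
        + (1 / 2 * x j ^ 3 * (b j i ^ 2 + D j (b j i)) + x j ^ 2 * b j i) = 0 := by
      intro i j hij
      simp only [hb]
      rw [der_logDer D hD hij.symm, der_logDer D hD hij]
      exact pair_identity (hx i j hij)
    have ht : ∀ i j k, i ≠ j → i ≠ k → j ≠ k → x i ^ 3 * b i j * b i k + x j ^ 3 * b j i * b j k
        + x k ^ 3 * b k i * b k j = 0 := fun i j k h h' h'' =>
      triple_identity (hx i j h) (hx i k h') (hx j k h'')
    rw [Fin.sum_univ_four, ha0, ha1, ha2, ha3]
    simp only [map_add]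
    have : CharZero F := algebraRat.charZero F
    linear_combination hp 0 1 (by decide) + hp 0 2 (by decide) + hp 0 3 (by decide)
      + hp 1 2 (by decide) + hp 1 3 (by decide) + hp 2 3 (by decide)
      + ht 0 1 2 (by decide) (by decide) (by decide) + ht 0 1 3 (by decide) (by decide) (by decide)
      + ht 0 2 3 (by decide) (by decide) (by decide) + ht 1 2 3 (by decide) (by decide) (by decide)

/-- The Pfaffian formula for the partition function in four Miwa variables. -/
theorem pfaffian_four {x : Fin 4 → F} (D : Fin 4 → Derivation ℚ F F)
    (hD : ∀ i j, D i (x j) = if j = i then 1 else 0)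
    (hx : ∀ i j, i ≠ j → x i ^ 2 ≠ x j ^ 2) :
    PowerSeries.C ((x 0 - x 1) / (x 0 + x 1) * ((x 0 - x 2) / (x 0 + x 2)) * ((x 0 - x 3) / (x 0 + x 3))
      * ((x 1 - x 2) / (x 1 + x 2)) * ((x 1 - x 3) / (x 1 + x 3)) * ((x 2 - x 3) / (x 2 + x 3)))
      * miwaZ x Finset.univ
    = PowerSeries.C ((x 0 - x 1) / (x 0 + x 1)) * miwaZ x {0, 1} *
        (PowerSeries.C ((x 2 - x 3) / (x 2 + x 3)) * miwaZ x {2, 3})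
      - PowerSeries.C ((x 0 - x 2) / (x 0 + x 2)) * miwaZ x {0, 2} *
        (PowerSeries.C ((x 1 - x 3) / (x 1 + x 3)) * miwaZ x {1, 3})
      + PowerSeries.C ((x 0 - x 3) / (x 0 + x 3)) * miwaZ x {0, 3} *
        (PowerSeries.C ((x 1 - x 2) / (x 1 + x 2)) * miwaZ x {1, 2}) := by
  have hadd : ∀ i j, i ≠ j → x i + x j ≠ 0 := fun i j hij e =>
    hx i j hij (by linear_combination (x i - x j) * e)
  set Q : Fin 4 → Fin 4 → PowerSeries F := fun i j =>
    PowerSeries.C ((x i - x j) / (x i + x j)) * miwaZ x {i, j} with hQ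
  have hQ0 : ∀ i j k, i ≠ j → k ≠ i → k ≠ j → mapDer (D k) (Q i j) = 0 := by
    intro i j k hij hki hkj
    rw [hQ, Derivation.leibniz, mapDer_miwaZ_of_notMem D hD (by simp [hki, hkj]), mapDer_C,
      der_delta D hD (hx i j hij), if_neg hki.symm, if_neg hkj.symm]
    simp
  have hsol : ∀ i j k l, i ≠ j → k ≠ l → i ≠ k → i ≠ l → j ≠ k → j ≠ l →
      ({i, j} : Finset (Fin 4)) ∪ {k, l} = Finset.univ →
      PowerSeries.derivative F (Q i j * Q k l) = ∑ m, hOp (D m) (x m) (Q i j * Q k l) := by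
    intro i j k l hij hkl hik hil hjk hjl hu
    rw [← hu]
    refine deriv_mul_of_disjoint ?_ D _ _ (deriv_delta_mul_miwaZ_pair D hD hij (hx i j hij))
      (deriv_delta_mul_miwaZ_pair D hD hkl (hx k l hkl)) ?_ ?_
    · simp [hik.symm, hil.symm, hjk.symm, hjl.symm]
    · intro m hm
      simp only [Finset.mem_insert, Finset.mem_singleton] at hm
      rcases hm with rfl | rfl
      · exact hQ0 i j _ hij hik.symm hjk.symm
      · exact hQ0 i j _ hij hil.symm hjl.symm
    · intro m hm
      simp only [Finset.mem_insert, Finset.mem_singleton] at hm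
      rcases hm with rfl | rfl
      · exact hQ0 k l _ hkl hik hil
      · exact hQ0 k l _ hkl hjk hjl
  -- Each product of two pair functions in disjoint variables solves the decoupled equation, and so
  -- does the left side. Hence equality at order zero suffices.
  refine eq_of_deriv_eq (x := x) (S := Finset.univ) D _ _
    (deriv_delta_mul_miwaZ_four D hD hx _ rfl) ?_ ?_
  · change PowerSeries.derivative F (Q 0 1 * Q 2 3 - Q 0 2 * Q 1 3 + Q 0 3 * Q 1 2) =
      ∑ m, hOp (D m) (x m) (Q 0 1 * Q 2 3 - Q 0 2 * Q 1 3 + Q 0 3 * Q 1 2)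
    have hadd' : ∀ m f g, hOp (D m) (x m) (f + g) = hOp (D m) (x m) f + hOp (D m) (x m) g := by
      intro m f g
      simp only [hOp, map_add]
      ring
    simp only [hadd', hOp_sub, Finset.sum_add_distrib, Finset.sum_sub_distrib, map_add, map_sub]
    rw [hsol 0 1 2 3, hsol 0 2 1 3, hsol 0 3 1 2] <;> decide
  · have h := schur_pfaffian (hadd 0 1 (by decide)) (hadd 0 2 (by decide)) (hadd 0 3 (by decide))
      (hadd 1 2 (by decide)) (hadd 1 3 (by decide)) (hadd 2 3 (by decide))
    simp only [map_add, map_sub, PowerSeries.coeff_zero_eq_constantCoeff_apply, map_mul,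
      PowerSeries.constantCoeff_C]
    simp only [← PowerSeries.coeff_zero_eq_constantCoeff_apply, coeff_zero_miwaZ, mul_one]
    exact h.symm

end FourVariables

/-! ### The one-variable series ψ -/

section OneVariable

/-- The coefficients of the one-variable specialization. -/
noncomputable def psiCoeff : ℕ → ℚ
  | 0 => 1
  -- The one-variable operator maps x^n to ½(n+½)² x^{n+1}, because ½n(n-1) + n + 1/8 = ½(n+½)².
  | n + 1 => psiCoeff n * ((n : ℚ) + 1 / 2) ^ 2 / (2 * ((n : ℚ) + 1))

/-- The series `ψ(hx)`. -/
noncomputable def psi {A : Type*} [CommRing A] [Algebra ℚ A] (x : A) : PowerSeries A :=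
  PowerSeries.mk fun n => psiCoeff n • x ^ n

/-- The series `ψ(hx) - ½hx ψ(hx) - hx D ψ(hx)`, `D` being the Euler operator. -/
noncomputable def psiAux {A : Type*} [CommRing A] [Algebra ℚ A] (x : A) : PowerSeries A :=
  psi x - PowerSeries.X * (PowerSeries.C x * ((1 / 2 : ℚ) • psi x
    + PowerSeries.X * PowerSeries.derivative A (psi x)))

variable {F : Type*} [Field F] [Algebra ℚ F]

theorem coeff_psi {A : Type*} [CommRing A] [Algebra ℚ A] (x : A) (n : ℕ) :
    PowerSeries.coeff n (psi x) = psiCoeff n • x ^ n := PowerSeries.coeff_mk _ _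

theorem X_mul_deriv_psi (D : Derivation ℚ F F) {x : F} (hD : D x = 1) :
    PowerSeries.X * PowerSeries.derivative F (psi x) = PowerSeries.C x * mapDer D (psi x) := by
  ext n
  rw [PowerSeries.coeff_C_mul, coeff_mapDer, coeff_psi, D.map_smul, D.leibniz_pow, hD, nsmul_eq_mul]
  cases n with
  | zero => rw [PowerSeries.coeff_zero_X_mul, Nat.cast_zero, zero_mul, Algebra.smul_def, mul_zero, mul_zero]
  | succ n =>
    rw [PowerSeries.coeff_succ_X_mul, PowerSeries.coeff_derivative, coeff_psi, smul_eq_mul,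
      Nat.add_sub_cancel, mul_smul_comm, smul_mul_assoc]
    congr 1
    push_cast
    ring

theorem deriv_psi (D : Derivation ℚ F F) {x : F} (hD : D x = 1) :
    PowerSeries.derivative F (psi x) = hOp D x (psi x) := by
  have : CharZero F := algebraRat.charZero F
  have hq : ∀ q : ℚ, algebraMap ℚ F q = (q : F) := fun q => eq_ratCast _ _
  ext n
  have h1 : ∀ k : ℕ, D (x ^ k) = (k : F) * x ^ (k - 1) := by
    intro k
    rw [D.leibniz_pow, hD, nsmul_eq_mul, smul_eq_mul, mul_one]
  have h2 : x ^ 2 * D (D (x ^ n)) = (n : F) * (n - 1) * x ^ n := by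
    rw [h1, D.leibniz, h1, D.map_natCast, smul_zero, add_zero, smul_eq_mul]
    rcases n with _ | _ | n
    · simp
    · simp
    · simp only [Nat.add_sub_cancel]
      push_cast
      ring
  have h3 : x * D (x ^ n) = (n : F) * x ^ n := by
    rw [h1]
    rcases n with _ | n
    · simp
    · simp only [Nat.add_sub_cancel]
      ring
  have hn : (n : F) + 1 ≠ 0 := by exact_mod_cast Nat.succ_ne_zero n
  rw [hOp, map_add, map_add, PowerSeries.coeff_C_mul, PowerSeries.coeff_C_mul,
    PowerSeries.coeff_C_mul, coeff_mapDer, coeff_mapDer, coeff_psi, PowerSeries.coeff_derivative,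
    coeff_psi, D.map_smul, D.map_smul]
  simp only [Algebra.smul_def, psiCoeff, hq]
  push_cast
  have e : (psiCoeff n : F) * ((n : F) + 1 / 2) ^ 2 / (2 * ((n : F) + 1)) * x ^ (n + 1) * ((n : F) + 1)
      = (psiCoeff n : F) * ((n : F) + 1 / 2) ^ 2 / 2 * x ^ (n + 1) := by
    field_simp
  rw [e, pow_succ]
  linear_combination -(1 / 2 * x * (psiCoeff n : F)) * h2 - x * (psiCoeff n : F) * h3

end OneVariable

/-! ### A bilinear solution in two variables -/

section TwoVariables

variable {F : Type*} [Field F] [Algebra ℚ F]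

theorem deriv_mapDer_comm (D : Derivation ℚ F F) (f : PowerSeries F) :
    PowerSeries.derivative F (mapDer D f) = mapDer D (PowerSeries.derivative F f) := by
  ext n
  have h : D ((n : F) + 1) = 0 := by
    have := D.map_natCast (n + 1)
    push_cast at this
    exact this
  rw [PowerSeries.coeff_derivative, coeff_mapDer, coeff_mapDer, PowerSeries.coeff_derivative,
    D.leibniz, h, smul_zero, zero_add, smul_eq_mul, mul_comm]

theorem eight_mul_hOp (D : Derivation ℚ F F) (x : F) (f : PowerSeries F) :
    8 * hOp D x f = 4 * PowerSeries.C x ^ 3 * mapDer D (mapDer D f)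
      + 8 * PowerSeries.C x ^ 2 * mapDer D f + PowerSeries.C x * f := by
  have : CharZero F := algebraRat.charZero F
  have h8 : (8 : PowerSeries F) = PowerSeries.C 8 := (map_ofNat PowerSeries.C 8).symm
  have h4 : (4 : PowerSeries F) = PowerSeries.C 4 := (map_ofNat PowerSeries.C 4).symm
  rw [hOp, mul_add, mul_add, h8, h4, ← mul_assoc, ← mul_assoc, ← mul_assoc, ← map_mul, ← map_mul,
    ← map_mul, ← map_pow, ← map_pow, ← map_mul, ← map_mul]
  congr 4 <;> norm_num <;> ring

/-- The numerator of the two-variable function. -/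
noncomputable def bilin {A : Type*} [CommRing A] [Algebra ℚ A] (u v : A) : PowerSeries A :=
  PowerSeries.C u * psi u * psiAux v - PowerSeries.C v * psiAux u * psi v

theorem bilin_eq (D D' : Derivation ℚ F F) {u v : F} (hu : D u = 1) (hv : D' v = 1) :
    bilin u v = (PowerSeries.C u - PowerSeries.C v) * psi u * psi v
      - PowerSeries.X * (PowerSeries.C u * PowerSeries.C v *
        (PowerSeries.C v * psi u * mapDer D' (psi v)
          - PowerSeries.C u * mapDer D (psi u) * psi v)) := by
  simp only [bilin, psiAux, X_mul_deriv_psi D hu, X_mul_deriv_psi D' hv]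
  simp only [Algebra.smul_def]
  ring

/-- As ψ depends only on the product hx, the operators h∂_h and x∂_x agree on it, and the evolution
equation becomes an ordinary differential equation in x. -/
theorem psi_relation (D : Derivation ℚ F F) {x : F} (hD : D x = 1) (hx : x ≠ 0) :
    PowerSeries.X * (4 * PowerSeries.C x ^ 2 * mapDer D (mapDer D (psi x))
      + 8 * PowerSeries.C x * mapDer D (psi x) + psi x) = 8 * mapDer D (psi x) := by
  have h1 := X_mul_deriv_psi D hD
  rw [deriv_psi D hD] at h1
  have h2 := eight_mul_hOp D x (psi x)
  have hC : PowerSeries.C x ≠ 0 := by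
    intro h
    exact hx (by simpa using congrArg PowerSeries.constantCoeff h)
  refine mul_left_cancel₀ hC ?_
  linear_combination 8 * h1 - PowerSeries.X * h2

theorem mapDer_psi_eq_zero (D : Derivation ℚ F F) {x : F} (hD : D x = 0) :
    mapDer D (psi x) = 0 := by
  ext n
  rw [coeff_mapDer, coeff_psi, D.map_smul, D.leibniz_pow, hD]
  simp

/-- This is the decoupled evolution equation for the quotient of `bilin u v` by u+v, with
denominators cleared: the extra terms u³D, v³D' and uv come from conjugating by 1/(u+v). -/
theorem bilin_key (D D' : Derivation ℚ F F) {u v : F} (hu : D u = 1) (hv : D' v = 1)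
    (hu' : D' u = 0) (hv' : D v = 0) (hu0 : u ≠ 0) (hv0 : v ≠ 0) :
    (PowerSeries.C u + PowerSeries.C v) * (PowerSeries.derivative F (bilin u v)
        - hOp D u (bilin u v) - hOp D' v (bilin u v))
      + PowerSeries.C u ^ 3 * mapDer D (bilin u v) + PowerSeries.C v ^ 3 * mapDer D' (bilin u v)
      + PowerSeries.C u * PowerSeries.C v * bilin u v = 0 := by
  have : CharZero F := algebraRat.charZero F
  have h8 : (8 : PowerSeries F) ≠ 0 := by
    intro h
    have := congrArg PowerSeries.constantCoeff h
    rw [map_ofNat, map_zero] at this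
    norm_num at this
  have hnat : ∀ (E : Derivation ℚ F F) (n : ℕ), mapDer E (n : PowerSeries F) = 0 :=
    fun E n => (mapDer E).map_natCast n
  set a := PowerSeries.C u with ha
  set b := PowerSeries.C v with hb
  set f := psi u with hf
  set g := psi v with hg
  have Da : mapDer D a = 1 := by rw [ha, mapDer_C, hu, map_one]
  have Db : mapDer D b = 0 := by rw [hb, mapDer_C, hv', map_zero]
  have Da' : mapDer D' a = 0 := by rw [ha, mapDer_C, hu', map_zero]
  have Db' : mapDer D' b = 1 := by rw [hb, mapDer_C, hv, map_one]
  have Df' : mapDer D' f = 0 := mapDer_psi_eq_zero D' hu'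
  have Dg : mapDer D g = 0 := mapDer_psi_eq_zero D hv'
  have Dpf' : mapDer D' (mapDer D f) = 0 := by
    ext n
    rw [coeff_mapDer, coeff_mapDer, hf, coeff_psi, D.map_smul, D'.map_smul, D.leibniz_pow, hu,
      smul_eq_mul, mul_one, map_nsmul, D'.leibniz_pow, hu']
    simp
  have Dpg : mapDer D (mapDer D' g) = 0 := by
    ext n
    rw [coeff_mapDer, coeff_mapDer, hg, coeff_psi, D'.map_smul, D.map_smul, D'.leibniz_pow, hv,
      smul_eq_mul, mul_one, map_nsmul, D.leibniz_pow, hv']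
    simp
  have r1 := psi_relation D hu hu0
  have r2 := psi_relation D' hv hv0
  rw [← hf, ← ha] at r1
  rw [← hg, ← hb] at r2
  set p := mapDer D f with hp
  set q := mapDer D p with hq
  set p' := mapDer D' g with hp'
  set q' := mapDer D' p' with hq'
  have d0 : ∀ E : Derivation ℚ F F, mapDer E (PowerSeries.X : PowerSeries F) = 0 := fun E => mapDer_X E
  have df : 8 * PowerSeries.derivative F f = 4 * a ^ 3 * q + 8 * a ^ 2 * p + a * f := by
    rw [deriv_psi D hu, eight_mul_hOp]
  have dg : 8 * PowerSeries.derivative F g = 4 * b ^ 3 * q' + 8 * b ^ 2 * p' + b * g := by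
    rw [deriv_psi D' hv, eight_mul_hOp]
  have h48 : ∀ E : Derivation ℚ F F, mapDer E (4 : PowerSeries F) = 0
      ∧ mapDer E (8 : PowerSeries F) = 0 := fun E => ⟨hnat E 4, hnat E 8⟩
  have dp : 8 * PowerSeries.derivative F p = 12 * a ^ 2 * q + 4 * a ^ 3 * mapDer D q + 16 * a * p
      + 8 * a ^ 2 * q + f + a * p := by
    have h := congrArg (mapDer D) df
    simp only [Derivation.leibniz, map_add, (h48 D).1, (h48 D).2, Derivation.leibniz_pow, Da,
      smul_eq_mul, nsmul_eq_mul, ← hp, ← hq] at h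
    rw [hp, deriv_mapDer_comm]
    push_cast at h
    linear_combination h
  have dp' : 8 * PowerSeries.derivative F p' = 12 * b ^ 2 * q' + 4 * b ^ 3 * mapDer D' q'
      + 16 * b * p' + 8 * b ^ 2 * q' + g + b * p' := by
    have h := congrArg (mapDer D') dg
    simp only [Derivation.leibniz, map_add, (h48 D').1, (h48 D').2, Derivation.leibniz_pow, Db',
      smul_eq_mul, nsmul_eq_mul, ← hp', ← hq'] at h
    rw [hp', deriv_mapDer_comm]
    push_cast at h
    linear_combination h
  have hM := bilin_eq D D' hu hv
  rw [← ha, ← hb, ← hf, ← hg, ← hp, ← hp'] at hM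
  refine mul_left_cancel₀ h8 ?_
  have e1 := eight_mul_hOp D u (bilin u v)
  have e2 := eight_mul_hOp D' v (bilin u v)
  have dX : PowerSeries.derivative F (PowerSeries.X : PowerSeries F) = 1 := PowerSeries.derivative_X
  have da : PowerSeries.derivative F a = 0 := PowerSeries.derivative_C
  have db : PowerSeries.derivative F b = 0 := PowerSeries.derivative_C
  have M1 : mapDer D (bilin u v) = f * g + (a - b) * p * g
      - PowerSeries.X * (b * (b * f * p' - a * p * g) + a * b * (b * p * p' - p * g - a * q * g)) := by
    rw [hM]
    simp only [Derivation.leibniz, map_sub, d0, Da, Db, Dg, Dpg, ← hp, ← hq, smul_eq_mul]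
    ring
  have M2 : mapDer D' (bilin u v) = - f * g + (a - b) * f * p'
      - PowerSeries.X * (a * (b * f * p' - a * p * g) + a * b * (f * p' + b * f * q' - a * p * p')) := by
    rw [hM]
    simp only [Derivation.leibniz, map_sub, d0, Da', Db', Df', Dpf', ← hp', ← hq', smul_eq_mul]
    ring
  have M11 : mapDer D (mapDer D (bilin u v)) = 2 * p * g + (a - b) * q * g
      - PowerSeries.X * (2 * b * (b * p * p' - p * g - a * q * g)
        + a * b * (b * q * p' - 2 * q * g - a * mapDer D q * g)) := by
    rw [M1]
    simp only [Derivation.leibniz, map_sub, map_add, d0, Da, Db, Dg, Dpg, ← hp, ← hq, smul_eq_mul]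
    ring
  have M22 : mapDer D' (mapDer D' (bilin u v)) = - 2 * f * p' + (a - b) * f * q'
      - PowerSeries.X * (2 * a * (f * p' + b * f * q' - a * p * p')
        + a * b * (2 * f * q' + b * f * mapDer D' q' - a * p * q')) := by
    rw [M2]
    simp only [Derivation.leibniz, map_sub, map_add, map_neg, d0, Da', Db', Df', Dpf', ← hp', ← hq',
      smul_eq_mul]
    ring
  have Md : PowerSeries.derivative F (bilin u v) = (a - b) * (PowerSeries.derivative F f * g
        + f * PowerSeries.derivative F g) - a * b * (b * f * p' - a * p * g)
      - PowerSeries.X * (a * b * (b * (PowerSeries.derivative F f * p'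
          + f * PowerSeries.derivative F p') - a * (PowerSeries.derivative F p * g
          + p * PowerSeries.derivative F g))) := by
    rw [hM]
    simp only [Derivation.leibniz, map_sub, dX, da, db, smul_eq_mul]
    ring
  rw [M11, M1] at e1
  rw [M22, M2] at e2
  rw [Md, M1, M2, hM]
  rw [hM] at e1 e2
  rw [← ha] at e1
  rw [← hb] at e2
  -- After the evolution equations of ψ and of its derivative are inserted, the remaining terms are
  -- cancelled by `psi_relation` in each variable.
  linear_combination (-(a + b)) * e1 - (a + b) * e2 + (a + b) * (a - b) * (df * g + f * dg)
    - (a + b) * PowerSeries.X * a * b * (b * (df * p' + f * dp') - a * (dp * g + p * dg))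
    - a * b * (b - a) * (b * f * r2 + a * g * r1)

end TwoVariables

/-! ### Differential equations for ψ(h)ψ(-h) and its companions -/

section UnivariateSeries

/-- The Euler operator `h d/dh`. -/
noncomputable def euler : Derivation ℚ (PowerSeries ℚ) (PowerSeries ℚ) :=
  (PowerSeries.X : PowerSeries ℚ) • PowerSeries.derivative ℚ

theorem coeff_euler (f : PowerSeries ℚ) (n : ℕ) :
    PowerSeries.coeff n (euler f) = n * PowerSeries.coeff n f := by
  rw [euler, Derivation.smul_apply, smul_eq_mul]
  cases n with
  | zero => simp
  | succ n =>
    rw [PowerSeries.coeff_succ_X_mul, PowerSeries.coeff_derivative, mul_comm]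
    push_cast
    ring

theorem euler_X : euler (PowerSeries.X : PowerSeries ℚ) = PowerSeries.X := by
  rw [euler, Derivation.smul_apply, PowerSeries.derivative_X, smul_eq_mul, mul_one]

theorem euler_rescale (f : PowerSeries ℚ) (c : ℚ) :
    euler (PowerSeries.rescale c f) = PowerSeries.rescale c (euler f) := by
  ext n
  rw [coeff_euler, PowerSeries.coeff_rescale, PowerSeries.coeff_rescale, coeff_euler]
  ring

/-- The series `∑ aₙ hⁿ` with `aₙ = psiCoeff n`. -/
noncomputable def psiSeries : PowerSeries ℚ := PowerSeries.mk psiCoeff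

/-- The companion series of `psiSeries`. -/
noncomputable def psiAuxSeries : PowerSeries ℚ :=
  psiSeries - PowerSeries.C (1 / 2) * PowerSeries.X * psiSeries - PowerSeries.X * euler psiSeries

theorem eight_mul_euler_psiSeries : 8 * euler psiSeries =
    PowerSeries.X * (4 * euler (euler psiSeries) + 4 * euler psiSeries + psiSeries) := by
  have h8 : (8 : PowerSeries ℚ) = PowerSeries.C 8 := (map_ofNat PowerSeries.C 8).symm
  have h4 : (4 : PowerSeries ℚ) = PowerSeries.C 4 := (map_ofNat PowerSeries.C 4).symm
  ext n
  rw [h8, h4, PowerSeries.coeff_C_mul, coeff_euler]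
  cases n with
  | zero => simp
  | succ n =>
    rw [PowerSeries.coeff_succ_X_mul, map_add, map_add, PowerSeries.coeff_C_mul,
      PowerSeries.coeff_C_mul, coeff_euler, coeff_euler, psiSeries, PowerSeries.coeff_mk,
      PowerSeries.coeff_mk, psiCoeff]
    have : (n : ℚ) + 1 ≠ 0 := by positivity
    push_cast
    field_simp
    ring

/-- `ψ(h) ψ(-h)`. -/
noncomputable def alphaSeries : PowerSeries ℚ := psiSeries * PowerSeries.rescale (-1) psiSeries

/-- `G(h) G(-h)`. -/
noncomputable def betaSeries : PowerSeries ℚ :=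
  psiAuxSeries * PowerSeries.rescale (-1) psiAuxSeries

/-- The odd part of `ψ(h) G(-h)`. -/
noncomputable def oddSeries : PowerSeries ℚ :=
  PowerSeries.C (1 / 2) * PowerSeries.X * (alphaSeries + euler alphaSeries)

theorem rescale_psiAuxSeries : PowerSeries.rescale (-1) psiAuxSeries =
    PowerSeries.rescale (-1) psiSeries
      + PowerSeries.C (1 / 2) * PowerSeries.X * PowerSeries.rescale (-1) psiSeries
      + PowerSeries.X * PowerSeries.rescale (-1) (euler psiSeries) := by
  have hC : ∀ a : ℚ, PowerSeries.rescale (-1 : ℚ) (PowerSeries.C a) = PowerSeries.C a := by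
    intro a
    ext n
    rw [PowerSeries.coeff_rescale, PowerSeries.coeff_C]
    split_ifs with h
    · rw [h, pow_zero, one_mul]
    · rw [mul_zero]
  rw [psiAuxSeries, map_sub, map_sub, map_mul, map_mul, map_mul, hC, PowerSeries.rescale_X]
  simp only [map_neg, map_one]
  ring

/-- With θ the Euler operator, f = ψ(h) and f' = ψ(-h), the letters stand for a = ff', s = θa, r =
fθf' - f'θf, m = θf·θf' and k = ½. The products of f, θf with f', θf' form a closed system under θ;
with the first integral 2a + hr = 2 one can eliminate r and m and obtain a third-order equation for
a alone. -/
theorem euler_identities {h k a s r m b : PowerSeries ℚ} (hk2 : 2 * k = 1) (k0 : euler k = 0)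
    (eh : euler h = h) (h0 : h ≠ 0) (ea : euler a = s)
    (es : h * euler s = -2 * r - h * s - k * h * a + 2 * h * m)
    (em : h * euler m = h * (-2 * m - k * k * s)) (wr : 2 * a + h * r = 2)
    (hb : b = a + h * r - k * k * h * h * a - k * h * h * s - h * h * m) :
    euler (euler (euler a)) * h ^ 2 + 3 * euler (euler a) * h ^ 2 + 3 * euler a * h ^ 2 + a * h ^ 2
      = 4 * euler a ∧ euler b - b = -(euler a + a) := by
  have n2 : euler (2 : PowerSeries ℚ) = 0 := euler.map_natCast 2
  have m2 : euler (-2 : PowerSeries ℚ) = 0 := by rw [map_neg, n2, neg_zero]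
  have em := mul_left_cancel₀ h0 em
  have er : h * euler r = -2 * s - h * r := by
    have := congrArg euler wr
    simp only [map_add, Derivation.leibniz, n2, ea, eh, smul_eq_mul] at this
    linear_combination this
  constructor
  · have d2 := congrArg euler es
    simp only [map_add, map_sub, Derivation.leibniz, eh, n2, m2, k0, ea, smul_eq_mul] at d2
    rw [ea]
    linear_combination h * d2 - 2 * er + 2 * h ^ 2 * em + h * es
      - ((k + 1) * h ^ 2 * s + h ^ 2 * a) * hk2
  · have hb' : b = 2 - a - h * h * (k * k * a + k * s + m) := by linear_combination hb + wr
    have d := congrArg euler hb'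
    simp only [map_add, map_sub, Derivation.leibniz, eh, n2, k0, ea, smul_eq_mul] at d
    rw [ea, d, hb']
    linear_combination -h ^ 2 * em - k * h * es + wr + (h * r - h ^ 2 * m) * hk2

theorem series_relations :
    euler (euler (euler alphaSeries)) * PowerSeries.X ^ 2
        + 3 * euler (euler alphaSeries) * PowerSeries.X ^ 2
        + 3 * euler alphaSeries * PowerSeries.X ^ 2 + alphaSeries * PowerSeries.X ^ 2
      = 4 * euler alphaSeries ∧
    euler betaSeries - betaSeries = -(euler alphaSeries + alphaSeries) ∧
    psiSeries * PowerSeries.rescale (-1) psiAuxSeries = 1 + oddSeries ∧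
    psiAuxSeries * PowerSeries.rescale (-1) psiSeries = 1 - oddSeries := by
  set h : PowerSeries ℚ := PowerSeries.X with hh
  set k : PowerSeries ℚ := PowerSeries.C (1 / 2) with hk
  have hk2 : 2 * k = 1 := by
    rw [hk, ← map_ofNat PowerSeries.C 2, ← map_mul]
    norm_num
  have k0 : euler k = 0 := by
    ext n
    rw [coeff_euler, hk, PowerSeries.coeff_C]
    split_ifs with e <;> simp [e]
  have eh : euler h = h := euler_X
  have h0 : h ≠ 0 := PowerSeries.X_ne_zero
  have c8 : (8 : PowerSeries ℚ) ≠ 0 := by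
    intro e
    have := congrArg PowerSeries.constantCoeff e
    rw [map_ofNat, map_zero] at this
    norm_num at this
  have c2 : (2 : PowerSeries ℚ) ≠ 0 := fun e => c8 (by linear_combination 4 * e)
  have hnat : ∀ n : ℕ, euler (n : PowerSeries ℚ) = 0 := fun n => euler.map_natCast n
  have n2 : euler (2 : PowerSeries ℚ) = 0 := hnat 2
  set f := psiSeries with hf
  set p := euler f with hp
  set q := euler p with hq
  set f' := PowerSeries.rescale (-1 : ℚ) f with hf'
  set p' := PowerSeries.rescale (-1 : ℚ) p with hp'
  set q' := PowerSeries.rescale (-1 : ℚ) q with hq'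
  have ef' : euler f' = p' := euler_rescale _ _
  have ep' : euler p' = q' := euler_rescale _ _
  have r1 : 8 * p = h * (4 * q + 4 * p + f) := eight_mul_euler_psiSeries
  have r2 : 8 * p' = - h * (4 * q' + 4 * p' + f') := by
    have := congrArg (PowerSeries.rescale (-1 : ℚ)) r1
    rw [map_mul, map_mul, map_add, map_add, map_mul, map_mul, map_ofNat, map_ofNat, hh,
      PowerSeries.rescale_X, map_neg, map_one] at this
    rw [← hf', ← hp', ← hq'] at this
    rw [this]
    ring
  -- A Wronskian-type first integral: the Euler operator annihilates it, so it equals its constant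
  -- term.
  have wr : 2 * (f * f') + h * (f * p' - p * f') = 2 := by
    have hder : euler (2 * (f * f') + h * (f * p' - p * f')) = 0 := by
      simp only [map_add, map_sub, Derivation.leibniz, smul_eq_mul, n2, eh, ef', ep', ← hp, ← hq]
      refine mul_left_cancel₀ c8 ?_
      linear_combination 2 * f * r2 - (-2 * f') * r1
    ext n
    have hn := congrArg (PowerSeries.coeff n) hder
    rw [coeff_euler, map_zero] at hn
    cases n with
    | zero =>
      have c0 : PowerSeries.constantCoeff f = 1 := by
        rw [hf, psiSeries, ← PowerSeries.coeff_zero_eq_constantCoeff_apply, PowerSeries.coeff_mk,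
          psiCoeff]
      have c0' : PowerSeries.constantCoeff f' = 1 := by
        rw [hf', ← PowerSeries.coeff_zero_eq_constantCoeff_apply, PowerSeries.coeff_rescale, pow_zero,
          one_mul, PowerSeries.coeff_zero_eq_constantCoeff_apply, c0]
      rw [PowerSeries.coeff_zero_eq_constantCoeff_apply]
      simp [hh, c0, c0']
    | succ n =>
      have e : PowerSeries.coeff (n + 1) (2 : PowerSeries ℚ) = 0 := by
        rw [← map_ofNat PowerSeries.C 2, PowerSeries.coeff_C, if_neg (Nat.succ_ne_zero n)]
      rw [e]
      refine (mul_eq_zero.1 hn).resolve_left ?_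
      positivity
  have ha : alphaSeries = f * f' := rfl
  have hb : betaSeries = (f - k * h * f - h * p) * (f' + k * h * f' + h * p') := by
    rw [betaSeries, rescale_psiAuxSeries]
    rfl
  have ho : oddSeries = k * h * (f * f' + (p * f' + f * p')) := by
    rw [oddSeries, ha]
    simp only [Derivation.leibniz, smul_eq_mul, ef', ← hp]
    ring
  have e1 : euler alphaSeries = p * f' + f * p' := by
    rw [ha]
    simp only [Derivation.leibniz, smul_eq_mul, ef', ← hp]
    ring
  have e2 : h * euler (p * f' + f * p') = -2 * (f * p' - p * f') - h * (p * f' + f * p')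
      - k * h * (f * f') + 2 * h * (p * p') := by
    simp only [map_add, Derivation.leibniz, smul_eq_mul, ef', ep', ← hp, ← hq]
    refine mul_left_cancel₀ c8 ?_
    linear_combination (-2 * f') * r1 + 2 * f * r2 + 4 * h * f * f' * hk2
  have hpp : h * euler (p * p') = h * (-2 * (p * p') - k * k * (p * f' + f * p')) := by
    simp only [Derivation.leibniz, smul_eq_mul, ep', ← hq]
    refine mul_left_cancel₀ c8 ?_
    linear_combination (-2 * p') * r1 + 2 * p * r2 + (2 * k + 1) * 2 * h * (p * f' + f * p') * hk2
  obtain ⟨i1, i2⟩ := euler_identities (b := betaSeries) (m := p * p') hk2 k0 eh h0 e1 e2 hpp wr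
    (by rw [hb, ha]; ring)
  refine ⟨i1, i2, ?_, ?_⟩
  · rw [ho, rescale_psiAuxSeries]
    change f * (f' + k * h * f' + h * p') = _
    refine mul_left_cancel₀ c2 ?_
    linear_combination wr - h * (p * f' + f * p') * hk2
  · rw [ho]
    change (f - k * h * f - h * p) * f' = _
    refine mul_left_cancel₀ c2 ?_
    linear_combination wr + h * (p * f' + f * p') * hk2

/-- `(2k-1)!!³ / (8ᵏ k!)`. -/
def alphaCoeff : ℕ → ℚ
  | 0 => 1
  | k + 1 => alphaCoeff k * (2 * k + 1) ^ 3 / (8 * (k + 1))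

/-- The third-order equation is (θ+1)³ applied to the series, times h², equal to 4θ of it, that is
(n+1)³ c_n = 4(n+2) c_{n+2}: a two-term recursion and hence a closed product. -/
theorem coeff_alphaSeries (k : ℕ) : PowerSeries.coeff (2 * k) alphaSeries = alphaCoeff k := by
  induction k with
  | zero =>
    rw [alphaSeries, mul_zero, PowerSeries.coeff_zero_eq_constantCoeff_apply, map_mul,
      ← PowerSeries.coeff_zero_eq_constantCoeff_apply, ← PowerSeries.coeff_zero_eq_constantCoeff_apply,
      PowerSeries.coeff_rescale]
    norm_num [psiSeries, psiCoeff, alphaCoeff]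
  | succ k ih =>
    have h4 : (4 : PowerSeries ℚ) = PowerSeries.C 4 := (map_ofNat PowerSeries.C 4).symm
    have h3 : (3 : PowerSeries ℚ) = PowerSeries.C 3 := (map_ofNat PowerSeries.C 3).symm
    have h := congrArg (PowerSeries.coeff (2 * k + 2)) series_relations.1
    rw [map_add, map_add, map_add, PowerSeries.coeff_mul_X_pow, PowerSeries.coeff_mul_X_pow,
      PowerSeries.coeff_mul_X_pow, PowerSeries.coeff_mul_X_pow, h3, h4, PowerSeries.coeff_C_mul,
      PowerSeries.coeff_C_mul, PowerSeries.coeff_C_mul] at h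
    simp only [coeff_euler, ih] at h
    push_cast at h
    rw [mul_add, mul_one, alphaCoeff, eq_div_iff (by positivity)]
    linear_combination -h

theorem coeff_betaSeries (k : ℕ) : PowerSeries.coeff (2 * k) betaSeries =
    - ((2 * k + 1) / (2 * k - 1)) * alphaCoeff k := by
  have h := congrArg (PowerSeries.coeff (2 * k)) series_relations.2.1
  rw [map_sub, map_neg, map_add, coeff_euler, coeff_euler, coeff_alphaSeries] at h
  push_cast at h
  have h0 : (2 * (k : ℚ) - 1) ≠ 0 := by
    intro e
    have : (2 * (k : ℤ) - 1) = 0 := by exact_mod_cast e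
    omega
  field_simp
  linear_combination h

theorem coeff_oddSeries (k : ℕ) : PowerSeries.coeff (2 * k + 1) oddSeries =
    (k + 1 / 2) * alphaCoeff k := by
  rw [oddSeries, mul_assoc, PowerSeries.coeff_C_mul, PowerSeries.coeff_succ_X_mul, map_add,
    coeff_euler, coeff_alphaSeries]
  push_cast
  ring

end UnivariateSeries

/-! ### The two-variable partition function, and passage to generic polynomial variables -/

section Identities

variable {F : Type*} [Field F] [Algebra ℚ F]

/-- After division by x_i + x_j both sides solve the decoupled equation with the initial value
(x_i-x_j)/(x_i+x_j), so they agree by `eq_of_deriv_eq`. -/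
theorem C_mul_miwaZ_pair {ι : Type*} [DecidableEq ι] {x : ι → F} (D : ι → Derivation ℚ F F)
    (hD : ∀ i j, D i (x j) = if j = i then 1 else 0) {i j : ι} (hij : i ≠ j)
    (h : x i ^ 2 ≠ x j ^ 2) (hi : x i ≠ 0) (hj : x j ≠ 0) :
    PowerSeries.C (x i - x j) * miwaZ x {i, j} = bilin (x i) (x j) := by
  have hs : x i + x j ≠ 0 := fun e => h (by linear_combination (x i - x j) * e)
  set u := x i
  set v := x j
  set w : F := (u + v)⁻¹ with hw
  have hws : (u + v) * w = 1 := mul_inv_cancel₀ hs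
  have hCw : (PowerSeries.C u + PowerSeries.C v) * PowerSeries.C w = 1 := by
    rw [← map_add, ← map_mul, hws, map_one]
  have Du : D i u = 1 := by rw [hD, if_pos rfl]
  have Dv : D j v = 1 := by rw [hD, if_pos rfl]
  have Dv' : D i v = 0 := by rw [hD, if_neg hij.symm]
  have Du' : D j u = 0 := by rw [hD, if_neg hij]
  have Dw : D i w = w * -w := by
    rw [hw, Derivation.leibniz_inv, map_add, Du, Dv', smul_eq_mul]; ring
  have Dw' : D j w = w * -w := by
    rw [hw, Derivation.leibniz_inv, map_add, Du', Dv, smul_eq_mul]; ring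
  have hM : PowerSeries.derivative F (PowerSeries.C w * bilin u v) =
      ∑ k ∈ {i, j}, hOp (D k) (x k) (PowerSeries.C w * bilin u v) := by
    have key := bilin_key (D i) (D j) Du Dv Du' Dv' hi hj
    rw [Finset.sum_pair hij, hOp_C_mul (D i) u w (-w) Dw, hOp_C_mul (D j) v w (-w) Dw', map_neg,
      map_neg, Dw, Dw', Derivation.leibniz, PowerSeries.derivative_C, smul_zero, add_zero,
      smul_eq_mul]
    have : CharZero F := algebraRat.charZero F
    have hsum : (1 / 2 * u ^ 3 * ((-w) ^ 2 + -(w * -w)) + u ^ 2 * -w)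
        + (1 / 2 * v ^ 3 * ((-w) ^ 2 + -(w * -w)) + v ^ 2 * -w) = - (u * v * w) := by
      linear_combination (u ^ 2 * w + v ^ 2 * w - u * v * w) * hws
    have hsum' := congrArg (PowerSeries.C (R := F)) hsum
    rw [map_add, map_neg, map_mul, map_mul] at hsum'
    simp only [map_neg, map_mul, map_pow] at hsum' ⊢
    linear_combination PowerSeries.C w ^ 2 * key
      - PowerSeries.C w * (PowerSeries.derivative F (bilin u v)
        - hOp (D i) u (bilin u v) - hOp (D j) v (bilin u v)) * hCw
      - PowerSeries.C w * bilin u v * hsum'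
  have h1 := eq_of_deriv_eq (S := {i, j}) D _ _ (deriv_delta_mul_miwaZ_pair D hD hij h) hM (by
    have c0 : PowerSeries.constantCoeff (miwaZ x {i, j}) = 1 := by
      rw [← PowerSeries.coeff_zero_eq_constantCoeff_apply, coeff_zero_miwaZ]
    have c1 : ∀ z : F, PowerSeries.constantCoeff (psi z) = 1 := by
      intro z
      rw [← PowerSeries.coeff_zero_eq_constantCoeff_apply, coeff_psi, psiCoeff, pow_zero, one_smul]
    rw [PowerSeries.coeff_zero_eq_constantCoeff_apply, PowerSeries.coeff_zero_eq_constantCoeff_apply]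
    simp only [bilin, psiAux, map_mul, map_sub, PowerSeries.constantCoeff_C, c0, c1,
      PowerSeries.constantCoeff_X, zero_mul, sub_zero, mul_one]
    rw [hw]
    change (u - v) / (u + v) = _
    rw [div_eq_mul_inv, mul_comm])
  change PowerSeries.C ((u - v) / (u + v)) * _ = _ at h1
  rw [div_eq_mul_inv, map_mul] at h1
  have hC : PowerSeries.C w ≠ 0 := by
    intro e
    rw [e, mul_zero] at hCw
    exact zero_ne_one hCw
  refine mul_left_cancel₀ hC ?_
  rw [← h1]
  ring

end Identities

section Transfer

theorem map_miwaZ {ι A A' : Type*} [CommRing A] [Algebra ℚ A] [CommRing A'] [Algebra ℚ A']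
    (g : A →ₐ[ℚ] A') (x : ι → A) (S : Finset ι) :
    PowerSeries.map (g : A →+* A') (miwaZ x S) = miwaZ (fun i => g (x i)) S := by
  have h : g.comp (miwa x S) = miwa (fun i => g (x i)) S := by
    ext k
    simp [miwa_X, map_sum]
  ext n
  rw [PowerSeries.coeff_map, coeff_miwaZ, coeff_miwaZ, ← h]
  rfl

variable {A A' : Type*} [CommRing A] [Algebra ℚ A] [CommRing A'] [Algebra ℚ A']

/-- Substitution of `h x` for the variable of a rational power series. -/
noncomputable def subst (x : A) : PowerSeries ℚ →+* PowerSeries A :=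
  (PowerSeries.rescale x).comp (PowerSeries.map (algebraMap ℚ A))

theorem coeff_subst (x : A) (f : PowerSeries ℚ) (n : ℕ) :
    PowerSeries.coeff n (subst x f) = algebraMap ℚ A (PowerSeries.coeff n f) * x ^ n := by
  rw [subst, RingHom.comp_apply, PowerSeries.coeff_rescale, PowerSeries.coeff_map, mul_comm]

theorem subst_neg (x : A) (f : PowerSeries ℚ) :
    subst (-x) f = subst x (PowerSeries.rescale (-1) f) := by
  ext n
  rw [coeff_subst, coeff_subst, PowerSeries.coeff_rescale, map_mul, neg_pow, map_pow, map_neg,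
    map_one]
  ring

theorem psi_eq_subst (x : A) : psi x = subst x psiSeries := by
  ext n
  rw [coeff_psi, coeff_subst, psiSeries, PowerSeries.coeff_mk, Algebra.smul_def]

theorem psiAux_eq_subst (x : A) : psiAux x = subst x psiAuxSeries := by
  have h1 : PowerSeries.C x * (PowerSeries.X : PowerSeries A) = subst x PowerSeries.X := by
    ext n
    rw [coeff_subst, PowerSeries.coeff_C_mul, PowerSeries.coeff_X, PowerSeries.coeff_X]
    split_ifs with e <;> simp [e]
  have h2 : PowerSeries.X * PowerSeries.derivative A (psi x) = subst x (euler psiSeries) := by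
    ext n
    rw [coeff_subst, coeff_euler, psiSeries, PowerSeries.coeff_mk]
    cases n with
    | zero => simp
    | succ n =>
      rw [PowerSeries.coeff_succ_X_mul, PowerSeries.coeff_derivative, coeff_psi, map_mul,
        Algebra.smul_def, map_natCast]
      push_cast
      ring
  have h3 : (1 / 2 : ℚ) • psi x = subst x (PowerSeries.C (1 / 2) * psiSeries) := by
    ext n
    rw [PowerSeries.coeff_smul, coeff_psi, coeff_subst, PowerSeries.coeff_C_mul, psiSeries,
      PowerSeries.coeff_mk, Algebra.smul_def, Algebra.smul_def, map_mul]
    ring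
  rw [psiAux, h2, h3, psi_eq_subst, ← mul_assoc, mul_comm PowerSeries.X (PowerSeries.C x), h1,
    ← map_add, ← map_mul, ← map_sub, psiAuxSeries]
  congr 1
  ring

theorem map_subst (g : A →ₐ[ℚ] A') (x : A) (f : PowerSeries ℚ) :
    PowerSeries.map (g : A →+* A') (subst x f) = subst (g x) f := by
  ext n
  rw [PowerSeries.coeff_map, coeff_subst, coeff_subst]
  simp

theorem map_bilin (g : A →ₐ[ℚ] A') (u v : A) :
    PowerSeries.map (g : A →+* A') (bilin u v) = bilin (g u) (g v) := by
  simp only [bilin, psi_eq_subst, psiAux_eq_subst, map_sub, map_mul, map_subst, PowerSeries.map_C]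
  rfl

end Transfer

section Generic

/-- Localization is formally étale, so the differentials of K are those of P with scalars extended.
It supplies partial derivatives on the rational function field, where the evolution equations have
their denominators. -/
theorem exists_derivation_extending {P K : Type*} [CommRing P] [IsDomain P] [Algebra ℚ P] [Field K]
    [Algebra P K] [IsFractionRing P K] [Algebra ℚ K] [IsScalarTower ℚ P K] (d : Derivation ℚ P P) :
    ∃ D : Derivation ℚ K K, ∀ p, D (algebraMap P K p) = algebraMap P K (d p) := by
  have : Algebra.FormallyEtale P K := Algebra.FormallyEtale.of_isLocalization (nonZeroDivisors P)
  let e := KaehlerDifferential.tensorKaehlerEquivOfFormallyEtale ℚ P K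
  let L : TensorProduct P K (KaehlerDifferential ℚ P) →ₗ[K] K :=
    TensorProduct.AlgebraTensorModule.lift
      (LinearMap.toSpanSingleton K _ ((Algebra.linearMap P K).comp d.liftKaehlerDifferential))
  refine ⟨(L.comp e.symm.toLinearMap).compDer (KaehlerDifferential.D ℚ K), fun p => ?_⟩
  change L (e.symm (KaehlerDifferential.D ℚ K (algebraMap P K p))) = _
  rw [KaehlerDifferential.tensorKaehlerEquivOfFormallyEtale_symm_D_algebraMap]
  simp [L]

end Generic

section GenericVariables

theorem pderiv_pderiv_comm {σ : Type*} (a b : σ) (f : MvPolynomial σ ℚ) :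
    MvPolynomial.pderiv a (MvPolynomial.pderiv b f)
      = MvPolynomial.pderiv b (MvPolynomial.pderiv a f) := by
  classical
  have : ⁅(MvPolynomial.pderiv a : Derivation ℚ (MvPolynomial σ ℚ) (MvPolynomial σ ℚ)),
      (MvPolynomial.pderiv b : Derivation ℚ (MvPolynomial σ ℚ) (MvPolynomial σ ℚ))⁆ = 0 := by
    apply MvPolynomial.derivation_ext
    intro i
    simp [Derivation.commutator_apply, MvPolynomial.pderiv_X, Pi.single_apply, apply_ite]
  have h := congrArg (fun D => D f) this
  simpa [Derivation.commutator_apply, sub_eq_zero] using h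

theorem exists_generic_field : ∃ (F : Type) (_ : Field F) (_ : Algebra ℚ F)
    (g : MvPolynomial (Fin 4) ℚ →ₐ[ℚ] F) (D : Fin 4 → Derivation ℚ F F),
    Function.Injective g ∧ ∀ i j, D i (g (MvPolynomial.X j)) = if j = i then 1 else 0 := by
  let F := FractionRing (MvPolynomial (Fin 4) ℚ)
  have hD := fun i : Fin 4 => exists_derivation_extending (K := F)
    (MvPolynomial.pderiv i : Derivation ℚ (MvPolynomial (Fin 4) ℚ) (MvPolynomial (Fin 4) ℚ))
  choose D hD using hD
  refine ⟨F, inferInstance, inferInstance, IsScalarTower.toAlgHom ℚ (MvPolynomial (Fin 4) ℚ) F, D,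
    IsFractionRing.injective _ _, fun i j => ?_⟩
  rw [IsScalarTower.coe_toAlgHom', hD, MvPolynomial.pderiv_X, Pi.single_apply]
  by_cases h : i = j
  · rw [if_pos h.symm, if_pos h.symm, map_one]
  · rw [if_neg (Ne.symm h), if_neg (Ne.symm h), map_zero]

theorem X_sq_ne {i j : Fin 4} (h : i ≠ j) :
    (MvPolynomial.X i : MvPolynomial (Fin 4) ℚ) ^ 2 ≠ MvPolynomial.X j ^ 2 := by
  intro e
  have := congrArg (MvPolynomial.eval (fun k => if k = i then (1 : ℚ) else 0)) e
  simp [h.symm] at this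

theorem C_mul_miwaZ_pair_generic {i j : Fin 4} (hij : i ≠ j) :
    PowerSeries.C (MvPolynomial.X i - MvPolynomial.X j : MvPolynomial (Fin 4) ℚ)
      * miwaZ MvPolynomial.X {i, j} = bilin (MvPolynomial.X i) (MvPolynomial.X j) := by
  obtain ⟨F, _, _, g, D, hg, hD⟩ := exists_generic_field
  refine PowerSeries.map_injective (g : MvPolynomial (Fin 4) ℚ →+* F) hg ?_
  rw [map_mul, map_miwaZ, map_bilin, PowerSeries.map_C]
  have h0 : ∀ k : Fin 4, g (MvPolynomial.X k) ≠ 0 := fun k e =>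
    MvPolynomial.X_ne_zero k (hg (e.trans (map_zero g).symm))
  have := C_mul_miwaZ_pair (x := fun k => g (MvPolynomial.X k)) D hD hij
    (fun e => X_sq_ne hij (hg (by rw [map_pow, map_pow]; exact e))) (h0 i) (h0 j)
  rw [← this]
  congr 2
  exact map_sub g _ _

/-- The Pfaffian formula multiplied by all sums x_i + x_j is a polynomial identity and may be
specialized where such sums vanish. Terms are grouped so that the right side carries the factor
(x_0+x_1)(x_2+x_3), which vanishes doubly at the point (x,-x,1,-1). -/
theorem pfaffian_four_generic (x : Fin 4 → MvPolynomial (Fin 4) ℚ) (hx : x = MvPolynomial.X) :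
    PowerSeries.C ((x 0 - x 1) * (x 2 - x 3) * ((x 0 - x 2) * (x 0 - x 3) * (x 1 - x 2) * (x 1 - x 3)))
        * miwaZ x Finset.univ
      - PowerSeries.C ((x 0 - x 1) * (x 2 - x 3)
          * ((x 0 + x 2) * (x 0 + x 3) * (x 1 + x 2) * (x 1 + x 3)))
        * (miwaZ x {0, 1} * miwaZ x {2, 3})
    = PowerSeries.C ((x 0 + x 1) * (x 2 + x 3))
      * (PowerSeries.C ((x 0 - x 3) * (x 1 - x 2) * ((x 0 + x 2) * (x 1 + x 3)))
          * (miwaZ x {0, 3} * miwaZ x {1, 2})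
        - PowerSeries.C ((x 0 - x 2) * (x 1 - x 3) * ((x 0 + x 3) * (x 1 + x 2)))
          * (miwaZ x {0, 2} * miwaZ x {1, 3})) := by
  obtain ⟨F, _, _, g, D, hg, hD⟩ := exists_generic_field
  refine PowerSeries.map_injective (g : MvPolynomial (Fin 4) ℚ →+* F) hg ?_
  set y : Fin 4 → F := fun i => g (x i) with hy
  have hgx : ∀ i, g (x i) = y i := fun i => rfl
  have hne : ∀ i j, i ≠ j → y i ^ 2 ≠ y j ^ 2 := fun i j hij e =>
    X_sq_ne hij (hg (by rw [map_pow, map_pow, ← hx]; exact e))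
  have hadd : ∀ i j, i ≠ j → y i + y j ≠ 0 := fun i j hij e =>
    hne i j hij (by linear_combination (y i - y j) * e)
  have key := pfaffian_four (x := y) D (by intro i j; rw [hy, hx]; exact hD i j) hne
  have hC : ∀ i j, i ≠ j → PowerSeries.C ((y i - y j) / (y i + y j))
      * (PowerSeries.C (y i) + PowerSeries.C (y j)) = PowerSeries.C (y i) - PowerSeries.C (y j) := by
    intro i j hij
    rw [← PowerSeries.C.map_add, ← PowerSeries.C.map_mul, div_mul_cancel₀ _ (hadd i j hij), map_sub]
  simp only [map_mul, map_sub, map_add, map_miwaZ, PowerSeries.map_C, RingHom.coe_coe, hgx] at key ⊢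
  have h01 := hC 0 1 (by decide)
  have h02 := hC 0 2 (by decide)
  have h03 := hC 0 3 (by decide)
  have h12 := hC 1 2 (by decide)
  have h13 := hC 1 3 (by decide)
  have h23 := hC 2 3 (by decide)
  rw [← h01, ← h02, ← h03, ← h12, ← h13, ← h23]
  have hp : ∀ i j, i ≠ j → PowerSeries.C (y i) + PowerSeries.C (y j) ≠ 0 := by
    intro i j hij e
    refine hadd i j hij ?_
    rw [← map_add] at e
    exact PowerSeries.C_injective (e.trans (map_zero _).symm)
  generalize PowerSeries.C ((y 0 - y 1) / (y 0 + y 1)) = t01 at *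
  generalize PowerSeries.C ((y 0 - y 2) / (y 0 + y 2)) = t02 at *
  generalize PowerSeries.C ((y 0 - y 3) / (y 0 + y 3)) = t03 at *
  generalize PowerSeries.C ((y 1 - y 2) / (y 1 + y 2)) = t12 at *
  generalize PowerSeries.C ((y 1 - y 3) / (y 1 + y 3)) = t13 at *
  generalize PowerSeries.C ((y 2 - y 3) / (y 2 + y 3)) = t23 at *
  change _ * miwaZ y Finset.univ - _ * (miwaZ y {0, 1} * miwaZ y {2, 3}) =
    _ * (_ * (miwaZ y {0, 3} * miwaZ y {1, 2}) - _ * (miwaZ y {0, 2} * miwaZ y {1, 3}))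
  generalize PowerSeries.C (y 0) = y0 at *
  generalize PowerSeries.C (y 1) = y1 at *
  generalize PowerSeries.C (y 2) = y2 at *
  generalize PowerSeries.C (y 3) = y3 at *
  linear_combination (y0 + y1) * (y0 + y2) * (y0 + y3) * (y1 + y2) * (y1 + y3) * (y2 + y3) * key

end GenericVariables

/-! ### Evaluation at a point with vanishing odd power sums -/

section Evaluation

variable {A : Type*} [CommRing A] [Algebra ℚ A]

/-- Vanishing odd power sums mean that every t_k is specialized to 0. -/
theorem miwa_eq_constantCoeff {ι : Type*} {x : ι → A} {S : Finset ι}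
    (h : ∀ k : ℕ, ∑ i ∈ S, x i ^ (2 * k + 1) = 0) (f : MvPolynomial ℕ ℚ) :
    miwa x S f = algebraMap ℚ A (MvPolynomial.constantCoeff f) := by
  have : miwa x S = (Algebra.ofId ℚ A).comp (MvPolynomial.aeval fun _ => (0 : ℚ)) := by
    ext k
    rw [miwa_X, h, smul_zero]
    simp
  rw [this, AlgHom.comp_apply, MvPolynomial.aeval_zero']
  simp [Algebra.ofId_apply]

/-- The value of the first derivatives of the specialized partition function. -/
noncomputable def oneSeries (a : A) : PowerSeries A := PowerSeries.mk fun n =>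
  ∑ k ∈ Finset.range (2 ^ n), a ^ (2 * k) *
    algebraMap ℚ A (MvPolynomial.constantCoeff (MvPolynomial.pderiv k (zpart n)))

/-- The value of the mixed second derivatives of the specialized partition function. -/
noncomputable def twoSeries (a b : A) : PowerSeries A := PowerSeries.mk fun n =>
  ∑ k ∈ Finset.range (2 ^ n), b ^ (2 * k) * ∑ l ∈ Finset.range (2 ^ n), a ^ (2 * l) *
    algebraMap ℚ A (MvPolynomial.constantCoeff
      (MvPolynomial.pderiv l (MvPolynomial.pderiv k (zpart n))))

variable {e : Fin 4 → A} {S : Finset (Fin 4)}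

/-- Evaluation of polynomials in four variables. -/
noncomputable abbrev evalHom (e : Fin 4 → A) : MvPolynomial (Fin 4) ℚ →+* A :=
  (MvPolynomial.aeval e : MvPolynomial (Fin 4) ℚ →ₐ[ℚ] A)

theorem aeval_miwa (f : MvPolynomial ℕ ℚ) :
    (MvPolynomial.aeval e : MvPolynomial (Fin 4) ℚ →ₐ[ℚ] A) (miwa MvPolynomial.X S f) = miwa e S f := by
  have h : (MvPolynomial.aeval e : MvPolynomial (Fin 4) ℚ →ₐ[ℚ] A).comp
      (miwa MvPolynomial.X S) = miwa e S := by
    ext k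
    simp [miwa_X, map_sum]
  rw [← h]
  rfl

theorem map_aeval_miwaZ : PowerSeries.map (evalHom e) (miwaZ MvPolynomial.X S) = miwaZ e S := by
  rw [map_miwaZ]
  congr 1
  ext i
  rw [MvPolynomial.aeval_X]

theorem pderiv_X_eq (i j : Fin 4) : (MvPolynomial.pderiv i : Derivation ℚ (MvPolynomial (Fin 4) ℚ)
    (MvPolynomial (Fin 4) ℚ)) (MvPolynomial.X j) = if j = i then 1 else 0 := by
  rw [MvPolynomial.pderiv_X, Pi.single_apply]

theorem miwaZ_eq_one (h : ∀ k : ℕ, ∑ i ∈ S, e i ^ (2 * k + 1) = 0) : miwaZ e S = 1 := by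
  ext n
  have h1 := congrArg (PowerSeries.coeff n) evZero_zser
  rw [evZero, PowerSeries.coeff_map, coeff_zser] at h1
  rw [coeff_miwaZ, miwa_eq_constantCoeff h, h1, PowerSeries.coeff_one, PowerSeries.coeff_one, apply_ite (algebraMap ℚ A), map_one,
    map_zero]

theorem map_aeval_mapDer_miwaZ (h : ∀ k : ℕ, ∑ i ∈ S, e i ^ (2 * k + 1) = 0) {i : Fin 4} (hi : i ∈ S) :
    PowerSeries.map (evalHom e)
      (mapDer (MvPolynomial.pderiv i) (miwaZ MvPolynomial.X S)) = oneSeries (e i) := by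
  ext n
  rw [PowerSeries.coeff_map, coeff_mapDer, coeff_miwaZ,
    der_miwa_single hi _ (pderiv_X_eq i) (zpart_mem_supported n), oneSeries, PowerSeries.coeff_mk]
  simp only [RingHom.coe_coe, map_sum, map_mul, map_pow, aeval_miwa, miwa_eq_constantCoeff h,
    MvPolynomial.aeval_X]

theorem map_aeval_mapDer_mapDer_miwaZ (h : ∀ k : ℕ, ∑ i ∈ S, e i ^ (2 * k + 1) = 0) {i j : Fin 4}
    (hi : i ∈ S) (hj : j ∈ S) (hij : j ≠ i) :
    PowerSeries.map (evalHom e)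
      (mapDer (MvPolynomial.pderiv i) (mapDer (MvPolynomial.pderiv j) (miwaZ MvPolynomial.X S)))
      = twoSeries (e i) (e j) := by
  ext n
  rw [PowerSeries.coeff_map, coeff_mapDer, coeff_mapDer, coeff_miwaZ,
    der_miwa_single hj _ (pderiv_X_eq j) (zpart_mem_supported n), twoSeries, PowerSeries.coeff_mk,
    map_sum]
  have : ∀ k, MvPolynomial.pderiv i ((MvPolynomial.X j : MvPolynomial (Fin 4) ℚ) ^ (2 * k) *
      miwa MvPolynomial.X S (MvPolynomial.pderiv k (zpart n)))
      = MvPolynomial.X j ^ (2 * k) * ∑ l ∈ Finset.range (2 ^ n), MvPolynomial.X i ^ (2 * l) *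
        miwa MvPolynomial.X S (MvPolynomial.pderiv l (MvPolynomial.pderiv k (zpart n))) := by
    intro k
    rw [Derivation.leibniz, Derivation.leibniz_pow, pderiv_X_eq, if_neg hij, smul_zero, smul_zero,
      smul_zero, add_zero, smul_eq_mul, der_miwa_single hi _ (pderiv_X_eq i)
        (pderiv_mem_supported k (zpart_mem_supported n))]
  simp only [this, RingHom.coe_coe, map_sum, map_mul, map_pow, aeval_miwa, miwa_eq_constantCoeff h,
    MvPolynomial.aeval_X]

end Evaluation

section TwoPoint

open Polynomial in
/-- The evaluation point `(x, -x, 1, -1)`. -/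
noncomputable def antiPoint : Fin 4 → ℚ[X] := ![X, -X, 1, -1]

theorem antiPoint_power_sums (k : ℕ) :
    (∑ i, antiPoint i ^ (2 * k + 1) = 0) ∧
    (∑ i ∈ {0, 1}, antiPoint i ^ (2 * k + 1) = 0) ∧
    (∑ i ∈ {2, 3}, antiPoint i ^ (2 * k + 1) = 0) := by
  have h : Odd (2 * k + 1) := odd_two_mul_add_one k
  refine ⟨?_, ?_, ?_⟩
  · rw [Fin.sum_univ_four]
    simp [antiPoint, h.neg_pow]
  · rw [Finset.sum_pair (by decide)]
    simp [antiPoint, h.neg_pow]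
  · rw [Finset.sum_pair (by decide)]
    simp [antiPoint, h.neg_pow]

/-- The relation `pfaffian_four_generic` is differentiated in x_1 and x_3 and evaluated at
(x,-x,1,-1). There Z and its pair restrictions equal 1, so first and mixed derivatives of Z are
generating series of one- and two-point values. -/
theorem two_point_relation_bilin :
    PowerSeries.C (4 * Polynomial.X * (Polynomial.X ^ 2 - 1) ^ 2 : Polynomial ℚ)
        * (twoSeries Polynomial.X (-1) - oneSeries Polynomial.X * oneSeries 1)
      + PowerSeries.C (8 * Polynomial.X * (Polynomial.X ^ 2 + 1))
    = PowerSeries.C (Polynomial.X - 1) ^ 2 * (bilin Polynomial.X 1 * bilin (-Polynomial.X) (-1))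
      - PowerSeries.C (Polynomial.X + 1) ^ 2 * (bilin Polynomial.X (-1) * bilin (-Polynomial.X) 1) := by
  set x : Fin 4 → MvPolynomial (Fin 4) ℚ := MvPolynomial.X with hx
  set D1 := mapDer (MvPolynomial.pderiv 1 : Derivation ℚ (MvPolynomial (Fin 4) ℚ) (MvPolynomial (Fin 4) ℚ)) with hD1
  set D3 := mapDer (MvPolynomial.pderiv 3 : Derivation ℚ (MvPolynomial (Fin 4) ℚ) (MvPolynomial (Fin 4) ℚ)) with hD3
  have key := pfaffian_four_generic x hx
  have hz3 : D3 (miwaZ x {0, 1}) = 0 := by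
    ext n
    rw [hD3, coeff_mapDer, coeff_miwaZ, der_miwa_of_notMem (i := 3) (by decide) _ (pderiv_X_eq 3), map_zero]
  have hz1 : D1 (miwaZ x {2, 3}) = 0 := by
    ext n
    rw [hD1, coeff_mapDer, coeff_miwaZ, der_miwa_of_notMem (i := 1) (by decide) _ (pderiv_X_eq 1), map_zero]
  have hz13 : D1 (D3 (miwaZ x {2, 3})) = 0 := by
    ext n
    rw [hD1, hD3, coeff_mapDer, coeff_mapDer, coeff_miwaZ, pderiv_pderiv_comm,
      der_miwa_of_notMem (i := 1) (by decide) _ (pderiv_X_eq 1), map_zero, map_zero]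
  set E := PowerSeries.map (evalHom antiPoint) with hE
  have hleib : ∀ (a : MvPolynomial (Fin 4) ℚ) (f : PowerSeries (MvPolynomial (Fin 4) ℚ)),
      D1 (D3 (PowerSeries.C a * f)) =
        PowerSeries.C (MvPolynomial.pderiv 1 (MvPolynomial.pderiv 3 a)) * f
        + PowerSeries.C (MvPolynomial.pderiv 3 a) * D1 f
        + PowerSeries.C (MvPolynomial.pderiv 1 a) * D3 f + PowerSeries.C a * D1 (D3 f) := by
    intro a f
    simp only [hD1, hD3, Derivation.leibniz, map_add, mapDer_C, smul_eq_mul]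
    ring
  set a := (x 0 - x 1) * (x 2 - x 3) * ((x 0 - x 2) * (x 0 - x 3) * (x 1 - x 2) * (x 1 - x 3)) with ha
  set v := (x 0 - x 1) * (x 2 - x 3) * ((x 0 + x 2) * (x 0 + x 3) * (x 1 + x 2) * (x 1 + x 3)) with hv
  set s := (x 0 + x 1) * (x 2 + x 3) with hs
  have hd3 : D3 (miwaZ x {0, 1} * miwaZ x {2, 3}) = miwaZ x {0, 1} * D3 (miwaZ x {2, 3}) := by
    rw [Derivation.leibniz, hz3, smul_zero, add_zero, smul_eq_mul]
  have hd1 : D1 (miwaZ x {0, 1} * miwaZ x {2, 3}) = miwaZ x {2, 3} * D1 (miwaZ x {0, 1}) := by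
    rw [Derivation.leibniz, hz1, smul_zero, zero_add, smul_eq_mul]
  have hd13 : D1 (miwaZ x {0, 1} * D3 (miwaZ x {2, 3}))
      = D3 (miwaZ x {2, 3}) * D1 (miwaZ x {0, 1}) := by
    rw [Derivation.leibniz, hz13, smul_zero, zero_add, smul_eq_mul]
  -- On the left the two coefficients a and v have equal values and equal first derivatives at the
  -- point (`z1` to `z4`), so first-order terms cancel; the second derivatives differ by 8x(x²+1).
  have k2 := congrArg (fun f => E (D1 (D3 f))) key
  simp only [map_sub D3, map_sub D1, hleib, hd3, hd1, hd13, map_sub E, map_add E, map_mul E] at k2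
  have p0 := fun k => (antiPoint_power_sums k).1
  have p1 := fun k => (antiPoint_power_sums k).2.1
  have p2 := fun k => (antiPoint_power_sums k).2.2
  have v0 : antiPoint 0 = Polynomial.X := rfl
  have v1 : antiPoint 1 = -Polynomial.X := rfl
  have v2 : antiPoint 2 = 1 := rfl
  have v3 : antiPoint 3 = -1 := rfl
  have EZ : ∀ S, E (miwaZ x S) = miwaZ antiPoint S := fun S => map_aeval_miwaZ
  have one_neg : ∀ y : Polynomial ℚ, oneSeries (-y) = oneSeries y := by
    intro y
    ext1 n
    simp only [oneSeries, PowerSeries.coeff_mk, pow_mul, neg_sq]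
  have two_neg : twoSeries (-Polynomial.X : Polynomial ℚ) (-1) = twoSeries Polynomial.X (-1) := by
    ext1 n
    simp only [twoSeries, PowerSeries.coeff_mk, pow_mul, neg_sq]
  have w0 : E (D1 (miwaZ x Finset.univ)) = oneSeries Polynomial.X := by
    rw [hE, hD1, hx, map_aeval_mapDer_miwaZ p0 (Finset.mem_univ _), v1, one_neg]
  have w0' : E (D3 (miwaZ x Finset.univ)) = oneSeries 1 := by
    rw [hE, hD3, hx, map_aeval_mapDer_miwaZ p0 (Finset.mem_univ _), v3, one_neg]
  have w1 : E (D1 (miwaZ x {0, 1})) = oneSeries Polynomial.X := by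
    rw [hE, hD1, hx, map_aeval_mapDer_miwaZ p1 (by decide), v1, one_neg]
  have w2 : E (D3 (miwaZ x {2, 3})) = oneSeries 1 := by
    rw [hE, hD3, hx, map_aeval_mapDer_miwaZ p2 (by decide), v3, one_neg]
  have w3 : E (D1 (D3 (miwaZ x Finset.univ))) = twoSeries Polynomial.X (-1) := by
    rw [hE, hD1, hD3, hx, map_aeval_mapDer_mapDer_miwaZ p0 (Finset.mem_univ _) (Finset.mem_univ _)
      (by decide), v1, v3, two_neg]
  have u0 : E (miwaZ x Finset.univ) = 1 := by rw [EZ, miwaZ_eq_one p0]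
  have u1 : E (miwaZ x {0, 1}) = 1 := by rw [EZ, miwaZ_eq_one p1]
  have u2 : E (miwaZ x {2, 3}) = 1 := by rw [EZ, miwaZ_eq_one p2]
  have EC : ∀ b, E (PowerSeries.C b) = PowerSeries.C (evalHom antiPoint b) := fun b =>
    PowerSeries.map_C _ _
  have ex : ∀ i, evalHom antiPoint (x i) = antiPoint i := fun i => MvPolynomial.aeval_X _ _
  have q10 : MvPolynomial.pderiv 1 (x 0) = 0 := pderiv_X_eq 1 0
  have q11 : MvPolynomial.pderiv 1 (x 1) = 1 := pderiv_X_eq 1 1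
  have q12 : MvPolynomial.pderiv 1 (x 2) = 0 := pderiv_X_eq 1 2
  have q13 : MvPolynomial.pderiv 1 (x 3) = 0 := pderiv_X_eq 1 3
  have q30 : MvPolynomial.pderiv 3 (x 0) = 0 := pderiv_X_eq 3 0
  have q31 : MvPolynomial.pderiv 3 (x 1) = 0 := pderiv_X_eq 3 1
  have q32 : MvPolynomial.pderiv 3 (x 2) = 0 := pderiv_X_eq 3 2
  have q33 : MvPolynomial.pderiv 3 (x 3) = 1 := pderiv_X_eq 3 3
  have z1 : evalHom antiPoint a = 4 * Polynomial.X * (Polynomial.X ^ 2 - 1) ^ 2 := by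
    simp only [ha, map_mul, map_sub, ex, v0, v1, v2, v3]
    ring
  have z2 : evalHom antiPoint v = 4 * Polynomial.X * (Polynomial.X ^ 2 - 1) ^ 2 := by
    simp only [hv, map_mul, map_sub, map_add, ex, v0, v1, v2, v3]
    ring
  have z3 : evalHom antiPoint (MvPolynomial.pderiv 1 a) = evalHom antiPoint (MvPolynomial.pderiv 1 v) := by
    simp only [ha, hv, Derivation.leibniz, map_mul, map_sub, map_add, smul_eq_mul, q10, q11, q12, q13,
      ex, v0, v1, v2, v3, map_zero, map_one]
    ring
  have z4 : evalHom antiPoint (MvPolynomial.pderiv 3 a) = evalHom antiPoint (MvPolynomial.pderiv 3 v) := by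
    simp only [ha, hv, Derivation.leibniz, map_mul, map_sub, map_add, smul_eq_mul, q30, q31, q32, q33,
      ex, v0, v1, v2, v3, map_zero, map_one]
    ring
  have z5 : evalHom antiPoint (MvPolynomial.pderiv 1 (MvPolynomial.pderiv 3 a))
      - evalHom antiPoint (MvPolynomial.pderiv 1 (MvPolynomial.pderiv 3 v))
      = 8 * Polynomial.X * (Polynomial.X ^ 2 + 1) := by
    simp only [ha, hv, Derivation.leibniz, map_mul, map_sub, map_add, smul_eq_mul, q30, q31, q32, q33,
      q10, q11, q12, q13, ex, v0, v1, v2, v3, map_zero, map_one]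
    ring
  -- Of the factor s only its mixed derivative survives, so the bracket on the right enters
  -- undifferentiated.
  have z6 : evalHom antiPoint s = 0 ∧ evalHom antiPoint (MvPolynomial.pderiv 1 s) = 0
      ∧ evalHom antiPoint (MvPolynomial.pderiv 3 s) = 0
      ∧ evalHom antiPoint (MvPolynomial.pderiv 1 (MvPolynomial.pderiv 3 s)) = 1 := by
    simp only [hs, Derivation.leibniz, map_mul, map_add, smul_eq_mul, q30, q31, q32, q33,
      q10, q11, q12, q13, ex, v0, v1, v2, v3, map_zero, map_one]
    refine ⟨?_, ?_, ?_, ?_⟩ <;> ring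
  have z5' := congrArg PowerSeries.C z5
  rw [map_sub] at z5'
  have bil : ∀ i j : Fin 4, i ≠ j → PowerSeries.C (antiPoint i - antiPoint j) * miwaZ antiPoint {i, j}
      = bilin (antiPoint i) (antiPoint j) := by
    intro i j hij
    have h := congrArg E (C_mul_miwaZ_pair_generic hij)
    rw [map_mul, EC, map_sub, ← hx, ex, ex, EZ] at h
    rw [h, hE]
    refine (map_bilin (MvPolynomial.aeval antiPoint) _ _).trans ?_
    rw [MvPolynomial.aeval_X, MvPolynomial.aeval_X]
  have b02 := bil 0 2 (by decide)
  have b13 := bil 1 3 (by decide)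
  have b03 := bil 0 3 (by decide)
  have b12 := bil 1 2 (by decide)
  simp only [EC, w0, w0', w1, w2, w3, u0, u1, u2, z1, z2, z3, z4, z6.1, z6.2.1, z6.2.2.1, z6.2.2.2,
    map_zero, map_one, one_mul, mul_one, zero_mul, add_zero, EZ, map_mul (evalHom antiPoint),
    map_sub (evalHom antiPoint), map_add (evalHom antiPoint), ex] at k2
  rw [v0, v2] at b02
  rw [v1, v3] at b13
  rw [v0, v3] at b03
  rw [v1, v2] at b12
  rw [← b02, ← b13, ← b03, ← b12, ← z5']
  simp only [v0, v1, v2, v3, map_sub, map_add, map_mul, map_neg, map_one] at k2 ⊢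
  linear_combination k2

end TwoPoint

/-! ### Coefficients of the two-point generating function -/

section TwoPointCoefficients

/-- The products ψ(h)G(-h) and G(h)ψ(-h), with G the companion series, are 1 ± one and the same
series. Hence the bilinear products collapse to the series `alphaSeries`, `betaSeries`, `oddSeries`
in hx and in h. -/
theorem C_mul_twoSeries_sub :
    PowerSeries.C ((Polynomial.X ^ 2 - 1) ^ 2 : Polynomial ℚ)
        * (twoSeries Polynomial.X (-1) - oneSeries Polynomial.X * oneSeries 1)
    = PowerSeries.C (Polynomial.X ^ 2) * (subst Polynomial.X alphaSeries * subst 1 betaSeries)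
      + subst Polynomial.X betaSeries * subst 1 alphaSeries
      + 2 * PowerSeries.C Polynomial.X * (subst Polynomial.X oddSeries * subst 1 oddSeries)
      - PowerSeries.C (Polynomial.X ^ 2 + 1) := by
  have key := two_point_relation_bilin
  simp only [bilin, psi_eq_subst, psiAux_eq_subst, subst_neg] at key
  have c4 : PowerSeries.C (4 * Polynomial.X : Polynomial ℚ) ≠ 0 := by
    intro e
    have : (4 * Polynomial.X : Polynomial ℚ) = 0 := PowerSeries.C_injective (e.trans (map_zero _).symm)
    have := congrArg (Polynomial.eval 1) this
    norm_num at this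
  have r1 := fun y : Polynomial ℚ => congrArg (subst y) series_relations.2.2.1
  have r2 := fun y : Polynomial ℚ => congrArg (subst y) series_relations.2.2.2
  have r3 : ∀ y : Polynomial ℚ, subst y alphaSeries =
      subst y psiSeries * subst y (PowerSeries.rescale (-1) psiSeries) := fun y => map_mul _ _ _
  have r4 : ∀ y : Polynomial ℚ, subst y betaSeries =
      subst y psiAuxSeries * subst y (PowerSeries.rescale (-1) psiAuxSeries) := fun y => map_mul _ _ _
  simp only [map_mul, map_add, map_sub, map_one] at r1 r2
  rw [r3, r3, r4, r4]
  have a1 := r1 Polynomial.X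
  have a2 := r2 Polynomial.X
  have b1 := r1 1
  have b2 := r2 1
  refine mul_left_cancel₀ c4 ?_
  simp only [map_mul, map_add, map_sub, map_one, map_pow, map_neg, map_ofNat] at key ⊢
  generalize subst (Polynomial.X : Polynomial ℚ) oddSeries = o at *
  generalize subst (1 : Polynomial ℚ) oddSeries = o' at *
  generalize subst (Polynomial.X : Polynomial ℚ) psiSeries = f at *
  generalize subst (Polynomial.X : Polynomial ℚ) (PowerSeries.rescale (-1) psiSeries) = fb at *
  generalize subst (Polynomial.X : Polynomial ℚ) psiAuxSeries = g at *
  generalize subst (Polynomial.X : Polynomial ℚ) (PowerSeries.rescale (-1) psiAuxSeries) = gb at *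
  generalize subst (1 : Polynomial ℚ) psiSeries = f' at *
  generalize subst (1 : Polynomial ℚ) (PowerSeries.rescale (-1) psiSeries) = fb' at *
  generalize subst (1 : Polynomial ℚ) psiAuxSeries = g' at *
  generalize subst (1 : Polynomial ℚ) (PowerSeries.rescale (-1) psiAuxSeries) = gb' at *
  generalize PowerSeries.C (Polynomial.X : Polynomial ℚ) = x at *
  linear_combination key + x * (x - 1) ^ 2 * (a1 * g' * fb' + (1 + o) * b2 + a2 * f' * gb' + (1 - o) * b1)
    + x * (x + 1) ^ 2 * (a1 * f' * gb' + (1 + o) * b1 + a2 * g' * fb' + (1 - o) * b2)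

/-- In f(hx) g(h) the exponent of x records the share of the first factor, so a monomial in x and h
isolates one product of coefficients. -/
theorem coeff_coeff_subst_mul_subst (f g : PowerSeries ℚ) (i j : ℕ) :
    (PowerSeries.coeff (i + j) (subst (Polynomial.X : Polynomial ℚ) f * subst 1 g)).coeff i
      = PowerSeries.coeff i f * PowerSeries.coeff j g := by
  rw [PowerSeries.coeff_mul, Polynomial.finsetSum_coeff, Finset.sum_eq_single (i, j)]
  · rw [coeff_subst, coeff_subst, one_pow, mul_one]
    rw [Polynomial.algebraMap_eq, mul_right_comm, ← Polynomial.C_mul, Polynomial.coeff_C_mul,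
      Polynomial.coeff_X_pow, if_pos rfl, mul_one]
  · rintro ⟨a, b⟩ hab hne
    rw [Finset.HasAntidiagonal.mem_antidiagonal] at hab
    simp only at hab ⊢
    rw [coeff_subst, coeff_subst, one_pow, mul_one, Polynomial.algebraMap_eq, mul_right_comm,
      ← Polynomial.C_mul, Polynomial.coeff_C_mul, Polynomial.coeff_X_pow, if_neg, mul_zero]
    rintro rfl
    exact hne (by ext <;> simp; omega)
  · intro h
    exact absurd (Finset.HasAntidiagonal.mem_antidiagonal.2 (rfl : i + j = i + j)) h

theorem coeff_oneSeries {A : Type*} [CommRing A] [Algebra ℚ A] (a : A) :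
    PowerSeries.C a * oneSeries a =
      subst a (PowerSeries.mk fun n => if n % 2 = 1 then B [n / 2] else 0) := by
  ext n
  rw [PowerSeries.coeff_C_mul, oneSeries, PowerSeries.coeff_mk, coeff_subst, PowerSeries.coeff_mk]
  simp only [constantCoeff_pderiv_zpart]
  by_cases hn : n % 2 = 1
  · rw [Finset.sum_eq_single (n / 2), if_pos hn, if_pos (by omega)]
    · have : a * a ^ (2 * (n / 2)) = a ^ n := by
        rw [← pow_succ']
        congr 1
        omega
      rw [← mul_assoc, this, mul_comm]
    · intro b _ hb
      rw [if_neg (by omega), map_zero, mul_zero]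
    · intro h
      exact absurd (Finset.mem_range.2 ((Nat.div_le_self n 2).trans_lt n.lt_two_pow_self)) h
  · rw [if_neg hn, map_zero, zero_mul, Finset.sum_eq_zero, mul_zero]
    intro k _
    rw [if_neg (by omega), map_zero, mul_zero]

theorem coeff_twoSeries_sub (d e : ℕ) : (PowerSeries.coeff (2 * d + 2 * e + 2)
    (twoSeries (Polynomial.X : Polynomial ℚ) (-1) - oneSeries Polynomial.X * oneSeries 1)).coeff (2 * d)
      = B [d, e] := by
  have hlt : ∀ k, k ≤ d + e → k < 2 ^ (2 * d + 2 * e + 2) := fun k hk =>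
    lt_of_le_of_lt (by omega : k ≤ 2 * d + 2 * e + 2) Nat.lt_two_pow_self
  have h1 : (PowerSeries.coeff (2 * d + 2 * e + 2)
      (twoSeries (Polynomial.X : Polynomial ℚ) (-1))).coeff (2 * d) = B [d, e] + B [d] * B [e] := by
    rw [twoSeries, PowerSeries.coeff_mk, Polynomial.finsetSum_coeff]
    simp only [constantCoeff_pderiv_pderiv_zpart, pow_mul, neg_sq, one_pow, one_mul,
      Polynomial.finsetSum_coeff, Polynomial.algebraMap_eq, Polynomial.coeff_mul_C]
    simp only [← pow_mul, Polynomial.coeff_X_pow]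
    rw [Finset.sum_eq_single e]
    · rw [Finset.sum_eq_single d, if_pos rfl, if_pos (by ring), one_mul, B_pair_comm e d, mul_comm]
      · intro b _ hb
        rw [if_neg (by omega), zero_mul]
      · exact fun h => absurd (Finset.mem_range.2 (hlt d (by omega))) h
    · intro b _ hb
      refine Finset.sum_eq_zero fun l _ => ?_
      by_cases hl : 2 * d = 2 * l
      · rw [if_neg (by omega : ¬ 2 * d + 2 * e + 2 = 2 * b + 2 * l + 2), mul_zero]
      · rw [if_neg hl, zero_mul]
    · exact fun h => absurd (Finset.mem_range.2 (hlt e (by omega))) h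
  have h2 : (PowerSeries.coeff (2 * d + 2 * e + 2)
      (oneSeries (Polynomial.X : Polynomial ℚ) * oneSeries 1)).coeff (2 * d) = B [d] * B [e] := by
    have := coeff_coeff_subst_mul_subst (PowerSeries.mk fun n => if n % 2 = 1 then B [n / 2] else 0)
      (PowerSeries.mk fun n => if n % 2 = 1 then B [n / 2] else 0) (2 * d + 1) (2 * e + 1)
    rw [← coeff_oneSeries, ← coeff_oneSeries, map_one, one_mul, mul_assoc, PowerSeries.coeff_C_mul,
      Polynomial.coeff_X_mul, PowerSeries.coeff_mk, PowerSeries.coeff_mk, if_pos (by omega),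
      if_pos (by omega)] at this
    rw [show 2 * d + 2 * e + 2 = 2 * d + 1 + (2 * e + 1) by ring, this]
    congr 3 <;> omega
  rw [map_sub, Polynomial.coeff_sub, h1, h2]
  ring

theorem C_mul_C_mul_coeff (p : Polynomial ℚ) (f : PowerSeries (Polynomial ℚ)) (n : ℕ) :
    PowerSeries.coeff n (PowerSeries.C p * f) = p * PowerSeries.coeff n f :=
  PowerSeries.coeff_C_mul _ _ _

/-- At x = 0 only the product of `betaSeries` in hx with `alphaSeries` in h contributes to positive
powers of h. -/
theorem B_zero_left (k : ℕ) : B [0, k] = alphaCoeff (k + 1) := by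
  have key := congrArg (fun f => (PowerSeries.coeff (2 * k + 2) f).coeff 0) C_mul_twoSeries_sub
  have h2 : (2 : PowerSeries (Polynomial ℚ)) = PowerSeries.C 2 := (map_ofNat _ 2).symm
  have h1 := coeff_twoSeries_sub 0 k
  rw [mul_zero, zero_add, map_sub, Polynomial.coeff_sub] at h1
  have h3 := coeff_coeff_subst_mul_subst betaSeries alphaSeries 0 (2 * k + 2)
  rw [zero_add, show 2 * k + 2 = 2 * (k + 1) by ring, coeff_alphaSeries, ← mul_zero 2,
    coeff_betaSeries, mul_zero] at h3
  rw [show 2 * (k + 1) = 2 * k + 2 by ring] at h3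
  simp only [map_add (PowerSeries.coeff (2 * k + 2)), map_sub (PowerSeries.coeff (2 * k + 2)),
    h2, mul_assoc, C_mul_C_mul_coeff, Polynomial.coeff_add, Polynomial.coeff_sub, h3,
    Polynomial.mul_coeff_zero, h1] at key
  rw [PowerSeries.coeff_C, if_neg (by omega)] at key
  have h0 : (((Polynomial.X ^ 2 - 1) ^ 2 : Polynomial ℚ)).coeff 0 = 1 := by
    rw [Polynomial.coeff_zero_eq_eval_zero]
    simp
  rw [h0] at key
  simp [alphaCoeff] at key
  rw [key, alphaCoeff]

/-- Multiplication by (x²-1)² is a second difference along d + e = const; the coefficient of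
x^{2d+4} h^{2d+2e+6} is compared. -/
theorem B_second_difference (d e : ℕ) : B [d, e + 2] - 2 * B [d + 1, e + 1] + B [d + 2, e] =
    alphaCoeff (d + 1) * (-((2 * (e + 2) + 1) / (2 * (e + 2) - 1)) * alphaCoeff (e + 2))
    + (-((2 * (d + 2) + 1) / (2 * (d + 2) - 1)) * alphaCoeff (d + 2)) * alphaCoeff (e + 1)
    + 2 * ((d + 3 / 2) * alphaCoeff (d + 1)) * ((e + 3 / 2) * alphaCoeff (e + 1)) := by
  have key := congrArg (fun f => (PowerSeries.coeff (2 * d + 2 * e + 6) f).coeff (2 * d + 4))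
    C_mul_twoSeries_sub
  have hp : ((Polynomial.X ^ 2 - 1) ^ 2 : Polynomial ℚ)
      = Polynomial.X ^ 4 - Polynomial.C 2 * Polynomial.X ^ 2 + 1 := by
    rw [map_ofNat]; ring
  have h2 : (2 : PowerSeries (Polynomial ℚ)) = PowerSeries.C (Polynomial.C 2) := by
    rw [map_ofNat, map_ofNat]
  have e1 := coeff_twoSeries_sub d (e + 2)
  have e2 := coeff_twoSeries_sub (d + 1) (e + 1)
  have e3 := coeff_twoSeries_sub (d + 2) e
  rw [show 2 * d + 2 * (e + 2) + 2 = 2 * d + 2 * e + 6 by ring] at e1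
  rw [show 2 * (d + 1) + 2 * (e + 1) + 2 = 2 * d + 2 * e + 6 by ring] at e2
  rw [show 2 * (d + 2) + 2 * e + 2 = 2 * d + 2 * e + 6 by ring] at e3
  rw [map_sub] at e1 e2 e3
  have f1 := coeff_coeff_subst_mul_subst alphaSeries betaSeries (2 * (d + 1)) (2 * (e + 2))
  have f2 := coeff_coeff_subst_mul_subst betaSeries alphaSeries (2 * (d + 2)) (2 * (e + 1))
  have f3 := coeff_coeff_subst_mul_subst oddSeries oddSeries (2 * (d + 1) + 1) (2 * (e + 1) + 1)
  rw [coeff_alphaSeries, coeff_betaSeries, show 2 * (d + 1) + 2 * (e + 2) = 2 * d + 2 * e + 6 by ring] at f1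
  rw [coeff_alphaSeries, coeff_betaSeries, show 2 * (d + 2) + 2 * (e + 1) = 2 * d + 2 * e + 6 by ring] at f2
  rw [coeff_oddSeries, coeff_oddSeries,
    show 2 * (d + 1) + 1 + (2 * (e + 1) + 1) = 2 * d + 2 * e + 6 by ring] at f3
  simp only [map_add (PowerSeries.coeff (2 * d + 2 * e + 6)), map_sub (PowerSeries.coeff (2 * d + 2 * e + 6)),
    h2, mul_assoc, C_mul_C_mul_coeff, Polynomial.coeff_add, Polynomial.coeff_sub] at key
  rw [PowerSeries.coeff_C, if_neg (by omega), Polynomial.coeff_zero, sub_zero, hp, add_mul, sub_mul,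
    one_mul, Polynomial.coeff_add, Polynomial.coeff_sub, mul_assoc, Polynomial.coeff_C_mul,
    Polynomial.coeff_C_mul, Polynomial.coeff_X_pow_mul, show 2 * d + 4 = 2 * d + 2 + 2 by ring,
    Polynomial.coeff_X_pow_mul, Polynomial.coeff_X_pow_mul, show 2 * d + 2 + 2 = 2 * (d + 1) + 1 + 1 by ring,
    Polynomial.coeff_X_mul, f3, show 2 * d + 2 = 2 * (d + 1) by ring, f1,
    show 2 * (d + 1) + 1 + 1 = 2 * (d + 2) by ring, f2, e1, e2, e3] at key
  push_cast at key
  linear_combination key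

end TwoPointCoefficients

/-! ### Recursions for the two-point numbers -/

section TwoPointRecursion

/-- By `B_second_difference` the discrepancy between the two sides depends only on d+e. By symmetry
of `B` it is antisymmetric in d and e. Hence it is zero. -/
theorem B_difference (d e : ℕ) : B [d, e + 1] - B [d + 1, e] =
    ((d : ℚ) - e) / (d + e + 2) * (alphaCoeff (d + 1) * alphaCoeff (e + 1)) := by
  set D : ℕ → ℕ → ℚ := fun d e => B [d, e + 1] - B [d + 1, e] -
    ((d : ℚ) - e) / (d + e + 2) * (alphaCoeff (d + 1) * alphaCoeff (e + 1)) with hD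
  have hstep : ∀ d e, D d (e + 1) = D (d + 1) e := by
    intro d e
    have h := B_second_difference d e
    rw [← sub_eq_zero]
    simp only [hD]
    push_cast
    have h3 : (d : ℚ) + 1 + e + 2 ≠ 0 := by positivity
    have h3' : (d : ℚ) + (e + 1) + 2 ≠ 0 := by positivity
    rw [alphaCoeff.eq_2 (e + 1), alphaCoeff.eq_2 (d + 1)] at h ⊢
    push_cast at h ⊢
    generalize alphaCoeff (d + 1) = a at *
    generalize alphaCoeff (e + 1) = b at *
    have h1 : 2 * ((d : ℚ) + 2) - 1 ≠ 0 := by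
      rw [show 2 * ((d : ℚ) + 2) - 1 = 2 * d + 3 by ring]; positivity
    have h2 : 2 * ((e : ℚ) + 2) - 1 ≠ 0 := by
      rw [show 2 * ((e : ℚ) + 2) - 1 = 2 * e + 3 by ring]; positivity
    have h4 : (d : ℚ) + 1 + 1 ≠ 0 := by positivity
    have h5 : (e : ℚ) + 1 + 1 ≠ 0 := by positivity
    have key : B [d, e + 1 + 1] - B [d + 1, e + 1] - (B [d + 1, e + 1] - B [d + 1 + 1, e]) =
      B [d, e + 2] - 2 * B [d + 1, e + 1] + B [d + 2, e] := by ring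
    rw [sub_sub_sub_comm, key, h]
    field_simp
    ring
  have hdiag : ∀ d e, D d e = D 0 (d + e) := by
    intro d
    induction d with
    | zero => intro e; rw [zero_add]
    | succ d ih => intro e; rw [← hstep, ih]; congr 1; ring
  have hanti : ∀ d e, D e d = - D d e := by
    intro d e
    simp only [hD]
    rw [B_pair_comm e (d + 1), B_pair_comm (e + 1) d]
    have h3 : (d : ℚ) + e + 2 ≠ 0 := by positivity
    rw [show (e : ℚ) + d + 2 = d + e + 2 by ring]
    ring
  have h0 : D d e = 0 := by
    have h1 := hanti d e
    rw [hdiag d e, hdiag e d, add_comm e d] at h1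
    rw [hdiag]
    linarith
  exact sub_eq_zero.1 h0

/-- The case d = 0 is the closed form `B_zero_left`; the step from d to d+1 trades the first
argument for the second by `B_difference`. The homogeneous part has a Gamma product as solution,
namely `pairNorm`. -/
theorem B_recursion (d e : ℕ) :
    ((d : ℚ) + e + 2) * (2 * (d + e + 2) + 1) * B [d, e + 1] =
      2 * (d + e + 2) ^ 3 * (d + e + 1) * B [d, e]
        + (2 * d + 4 * e + 7) * ((d + 1) * alphaCoeff (d + 1) * alphaCoeff (e + 1)) := by
  induction d generalizing e with
  | zero =>
    rw [B_zero_left, B_zero_left, alphaCoeff.eq_2 (e + 1)]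
    push_cast
    have : alphaCoeff 1 = 1 / 8 := by norm_num [alphaCoeff]
    rw [zero_add, this]
    have h5 : (e : ℚ) + 1 + 1 ≠ 0 := by positivity
    field_simp
    ring
  | succ d ih =>
    have h := ih (e + 1)
    have e1 := B_difference d e
    have e2 := B_difference d (e + 1)
    have f1 : B [d + 1, e] = B [d, e + 1] - ((d : ℚ) - e) / (d + e + 2) *
      (alphaCoeff (d + 1) * alphaCoeff (e + 1)) := by linarith
    have f2 : B [d + 1, e + 1] = B [d, e + 1 + 1] - ((d : ℚ) - (e + 1 : ℕ)) / (d + (e + 1 : ℕ) + 2) *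
      (alphaCoeff (d + 1) * alphaCoeff (e + 1 + 1)) := by linarith
    rw [f1, f2]
    rw [alphaCoeff.eq_2 (e + 1)] at h ⊢
    rw [alphaCoeff.eq_2 (d + 1)]
    push_cast at h ⊢
    have h3 : (d : ℚ) + (e + 1) + 2 ≠ 0 := by positivity
    have h3' : (d : ℚ) + e + 2 ≠ 0 := by positivity
    have h4 : (d : ℚ) + 1 + 1 ≠ 0 := by positivity
    have h5 : (e : ℚ) + 1 + 1 ≠ 0 := by positivity
    generalize alphaCoeff (d + 1) = a at *
    generalize alphaCoeff (e + 1) = b at *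
    generalize B [d, e + 1] = u at *
    generalize B [d, e + 1 + 1] = v at *
    rw [← sub_eq_zero] at h ⊢
    rw [← h]
    field_simp
    ring

end TwoPointRecursion

/-! ### The coefficients A_j and their three-term recursion -/

section ExpansionCoefficients

/-- The rising factorial `(a)ₙ`. -/
noncomputable abbrev rising (a : ℚ) (n : ℕ) : ℚ := (ascPochhammer ℚ n).eval a

theorem rising_succ_right (a : ℚ) (n : ℕ) : rising a (n + 1) = rising a n * (a + n) := by
  rw [rising, ascPochhammer_succ_right]
  simp

theorem rising_succ_left (a : ℚ) (n : ℕ) : rising a (n + 1) = a * rising (a + 1) n := by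
  rw [rising, ascPochhammer_succ_left]
  simp [Polynomial.eval_comp]

/-- The terms of the explicit sum for the coefficients `A_j`. -/
noncomputable def aTerm (x : ℚ) (j l : ℕ) : ℚ :=
  (-1) ^ (j - 1) * ((j - 1)! : ℚ) * (((2 * l - 1)‼ : ℚ) / (8 ^ l * (l ! : ℚ) ^ 3) *
    rising ((j : ℚ) - 2 * (l : ℚ)) (2 * l) * rising (x + 3 / 2 - (l : ℚ)) (j - 1))

theorem aTerm_eq_zero (x : ℚ) {j l : ℕ} (hj : 1 ≤ j) (h : j ≤ 2 * l) : aTerm x j l = 0 := by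
  have : rising ((j : ℚ) - 2 * (l : ℚ)) (2 * l) = 0 := by
    rw [rising, show (j : ℚ) - 2 * l = -((2 * l - j : ℕ) : ℚ) by
      rw [Nat.cast_sub h]; push_cast; ring]
    rw [ascPochhammer_eval_neg_eq_descPochhammer, descPochhammer_eval_coe_nat_of_lt (by omega),
      mul_zero]
  rw [aTerm, this]
  ring

/-- The coefficient `A_j(x)`. -/
noncomputable def aCoeff (x : ℚ) (j : ℕ) : ℚ := ∑ l ∈ Finset.range ((j + 1) / 2 + 1), aTerm x j l

/-- The factor (j-2l)_{2l} runs through 0 once 2l ≥ j ≥ 1, so the upper limit is immaterial and sums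
for different j can share one range. -/
theorem aCoeff_eq_sum (x : ℚ) {j L : ℕ} (hj : 1 ≤ j) (h : j ≤ 2 * L) :
    aCoeff x j = ∑ l ∈ Finset.range L, aTerm x j l := by
  have h1 : ∀ M, j ≤ 2 * M → ∀ N, M ≤ N → ∑ l ∈ Finset.range N, aTerm x j l
      = ∑ l ∈ Finset.range M, aTerm x j l := by
    intro M hM N hN
    refine (Finset.sum_subset (Finset.range_mono hN) fun l _ hl => ?_).symm
    exact aTerm_eq_zero x hj (by rw [Finset.mem_range] at hl; omega)
  rw [aCoeff, ← h1 ((j + 1) / 2 + 1) (by omega) (max L ((j + 1) / 2 + 1)) (le_max_right _ _),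
    h1 L h _ (le_max_left _ _)]

theorem aCoeff_one (x : ℚ) : aCoeff x 1 = 1 := by
  rw [aCoeff_eq_sum x le_rfl (L := 1) (by norm_num)]
  simp [aTerm, rising]

/-- The creative telescoping identity behind the recursion of the coefficients `A_j`. -/
theorem sum_aTerm_telescope (x : ℚ) (i L : ℕ) :
    ∑ l ∈ Finset.range (L + 1), (((i : ℚ) + 2) * aTerm x (i + 3) l
      - ((i + 1) ^ 3 * (2 * x + i + 3) - (i + 2) ^ 3 * (2 * x + i + 4)) / 2 * aTerm x (i + 2) l
      + (i + 1) ^ 3 * (2 * x + i + 3) * (x + i + 2) * aTerm x (i + 1) l)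
    = - (1 / 2) * (i + 1) ^ 2 * (2 * x + i + 3) * (2 * L + 1) * (x + 1 / 2 - L) * aTerm x (i + 1) L := by
  induction L with
  | zero =>
    simp only [aTerm, zero_add, Finset.sum_range_one, mul_zero]
    rw [show i + 3 - 1 = i + 1 + 1 by omega, show i + 2 - 1 = i + 1 by omega,
      show i + 1 - 1 = i by omega, rising_succ_right _ (i + 1), rising_succ_right _ i]
    simp only [Nat.factorial_succ]
    push_cast
    simp [rising]
    ring
  | succ L ih =>
    rw [Finset.sum_range_succ, ih]
    have hdf : ((2 * (L + 1) - 1)‼ : ℚ) = (2 * L + 1) * ((2 * L - 1)‼ : ℚ) := by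
      have : (2 * (L + 1) - 1)‼ = (2 * L + 1) * (2 * L - 1)‼ := by
        cases L with
        | zero => rfl
        | succ L => rfl
      rw [this]; push_cast; ring
    have hp3 : rising (((i + 3 : ℕ) : ℚ) - 2 * ((L + 1 : ℕ) : ℚ)) (2 * (L + 1))
        = rising (((i + 1 : ℕ) : ℚ) - 2 * (L : ℚ)) (2 * L) * (i + 1) * (i + 2) := by
      rw [show 2 * (L + 1) = 2 * L + 1 + 1 by ring, rising_succ_right, rising_succ_right]
      push_cast
      rw [show (i : ℚ) + 3 - 2 * (L + 1) = i + 1 - 2 * L by ring]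
      ring
    have hp2 : rising (((i + 2 : ℕ) : ℚ) - 2 * ((L + 1 : ℕ) : ℚ)) (2 * (L + 1))
        = (i - 2 * L) * rising (((i + 1 : ℕ) : ℚ) - 2 * (L : ℚ)) (2 * L) * (i + 1) := by
      rw [show 2 * (L + 1) = 2 * L + 1 + 1 by ring, rising_succ_left, rising_succ_right]
      push_cast
      rw [show (i : ℚ) + 2 - 2 * (L + 1) + 1 = i + 1 - 2 * L by ring]
      ring
    have hp1 : rising (((i + 1 : ℕ) : ℚ) - 2 * ((L + 1 : ℕ) : ℚ)) (2 * (L + 1))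
        = (i - 2 * L) * (i - 1 - 2 * L) * rising (((i + 1 : ℕ) : ℚ) - 2 * (L : ℚ)) (2 * L) := by
      rw [show 2 * (L + 1) = 2 * L + 1 + 1 by ring, rising_succ_left, rising_succ_left]
      push_cast
      rw [show (i : ℚ) + 1 - 2 * (L + 1) + 1 + 1 = i + 1 - 2 * L by ring]
      ring
    have hq : x + 3 / 2 - ((L + 1 : ℕ) : ℚ) = x + 1 / 2 - L := by push_cast; ring
    have hv : (x + 1 / 2 - L) * rising (x + 3 / 2 - L) i = rising (x + 1 / 2 - L) i * (x + 1 / 2 - L + i) := by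
      rw [← rising_succ_right, rising_succ_left]
      congr 2
      ring
    simp only [aTerm, hp1, hp2, hp3, hq, hdf]
    rw [show i + 3 - 1 = i + 1 + 1 by omega, show i + 2 - 1 = i + 1 by omega,
      show i + 1 - 1 = i by omega, rising_succ_right _ (i + 1), rising_succ_right _ i]
    have hv' : ∀ c : ℚ, c * (x + 1 / 2 - L) * ((-1) ^ i * (i ! : ℚ) * (((2 * L - 1)‼ : ℚ) / (8 ^ L * (L ! : ℚ) ^ 3) *
        rising (((i + 1 : ℕ) : ℚ) - 2 * (L : ℚ)) (2 * L) * rising (x + 3 / 2 - (L : ℚ)) i))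
        = c * ((-1) ^ i * (i ! : ℚ) * (((2 * L - 1)‼ : ℚ) / (8 ^ L * (L ! : ℚ) ^ 3) *
        rising (((i + 1 : ℕ) : ℚ) - 2 * (L : ℚ)) (2 * L))) * (rising (x + 1 / 2 - L) i * (x + 1 / 2 - L + i)) := by
      intro c
      rw [← hv]
      ring
    rw [hv']
    simp only [Nat.factorial_succ]
    push_cast
    generalize rising ((i : ℚ) + 1 - 2 * (L : ℚ)) (2 * L) = p
    generalize rising (x + 1 / 2 - L) i = v
    generalize ((2 * L - 1)‼ : ℚ) = w
    have hL : (L ! : ℚ) ≠ 0 := by positivity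
    have hL1 : (L : ℚ) + 1 ≠ 0 := by positivity
    generalize (L ! : ℚ) = z at *
    field_simp
    ring

/-- In `sum_aTerm_telescope` the boundary term at L = i+3 vanishes, and that range exhausts all
three sums. -/
theorem aCoeff_recursion (x : ℚ) (i : ℕ) :
    2 * ((i : ℚ) + 2) * aCoeff x (i + 3) =
      ((i + 1) ^ 3 * (2 * x + i + 3) - (i + 2) ^ 3 * (2 * x + i + 4)) * aCoeff x (i + 2)
      - (i + 1) ^ 3 * (2 * x + i + 3) * (2 * x + 2 * i + 4) * aCoeff x (i + 1) := by
  have h := sum_aTerm_telescope x i (i + 3)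
  rw [aTerm_eq_zero x (by omega) (by omega), mul_zero, Finset.sum_add_distrib, Finset.sum_sub_distrib,
    ← Finset.mul_sum, ← Finset.mul_sum, ← Finset.mul_sum, ← aCoeff_eq_sum x (by omega) (by omega),
    ← aCoeff_eq_sum x (by omega) (by omega), ← aCoeff_eq_sum x (by omega) (by omega)] at h
  linear_combination 2 * h

theorem aCoeff_two (x : ℚ) : 2 * aCoeff x 2 = - (2 * x + 3) := by
  rw [aCoeff_eq_sum x (by norm_num) (L := 1) (by norm_num)]
  simp [aTerm, rising]
  ring

end ExpansionCoefficients

/-! ### Algebra and uniqueness of asymptotic expansions -/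

section InverseExpansions

open Filter Asymptotics Topology

variable {α : Type*} {l : Filter α} {x f g : α → ℝ} {P Q : PowerSeries ℝ}

/-- The truncated expansion. -/
noncomputable def partialSum (P : PowerSeries ℝ) (N : ℕ) (t : ℝ) : ℝ := (P.trunc N).eval t⁻¹

theorem sum_coeff_div_eq (P : PowerSeries ℝ) (N : ℕ) (t : ℝ) :
    ∑ k ∈ Finset.range N, PowerSeries.coeff k P / t ^ k = partialSum P N t := by
  rw [partialSum, ← Polynomial.eval₂_id, PowerSeries.eval₂_trunc_eq_sum_range]
  refine Finset.sum_congr rfl fun k _ => ?_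
  rw [RingHom.id_apply, inv_pow, div_eq_mul_inv]

theorem hasInvExpansion_iff : HasInvExpansion l x f P ↔
    ∀ N, (fun a => f a - partialSum P N (x a)) =O[l] fun a => 1 / x a ^ N := by
  simp only [HasInvExpansion, sum_coeff_div_eq]

theorem isBigO_eval_inv (hx : Tendsto x l atTop) (p : Polynomial ℝ) :
    (fun a => p.eval (x a)⁻¹) =O[l] fun _ => (1 : ℝ) := by
  have h : Tendsto (fun a => p.eval (x a)⁻¹) l (𝓝 (p.eval 0)) :=
    (p.continuous.tendsto 0).comp (tendsto_inv_atTop_zero.comp hx)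
  exact h.isBigO_one ℝ

theorem isBigO_one_div_pow_of_le (hx : Tendsto x l atTop) {m n : ℕ} (h : m ≤ n) :
    (fun a => 1 / x a ^ n) =O[l] fun a => 1 / x a ^ m := by
  refine IsBigO.of_bound 1 ?_
  filter_upwards [hx.eventually_ge_atTop 1] with a ha
  have h0 : (0 : ℝ) < x a := by linarith
  rw [one_mul, Real.norm_of_nonneg (by positivity), Real.norm_of_nonneg (by positivity)]
  exact one_div_le_one_div_of_le (by positivity) (pow_le_pow_right₀ ha h)

theorem HasInvExpansion.isBigO_one (hf : HasInvExpansion l x f P) :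
    f =O[l] fun _ => (1 : ℝ) := by
  have := hf 0
  simpa using this

theorem HasInvExpansion.add (hf : HasInvExpansion l x f P) (hg : HasInvExpansion l x g Q) :
    HasInvExpansion l x (fun a => f a + g a) (P + Q) := fun N => by
  refine ((hf N).add (hg N)).congr_left fun a => ?_
  simp only [map_add, add_div, Finset.sum_add_distrib]
  ring

theorem HasInvExpansion.const_mul (hf : HasInvExpansion l x f P) (c : ℝ) :
    HasInvExpansion l x (fun a => c * f a) (PowerSeries.C c * P) := fun N => by
  refine ((hf N).const_mul_left c).congr_left fun a => ?_
  simp only [PowerSeries.coeff_C_mul, mul_sub, Finset.mul_sum, mul_div_assoc]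

theorem hasInvExpansion_zero : HasInvExpansion l x (fun _ => 0) 0 := fun N => by
  simpa using isBigO_zero _ _

theorem HasInvExpansion.sum {ι : Type*} (s : Finset ι) {F : ι → α → ℝ} {P : ι → PowerSeries ℝ}
    (h : ∀ i ∈ s, HasInvExpansion l x (F i) (P i)) :
    HasInvExpansion l x (fun a => ∑ i ∈ s, F i a) (∑ i ∈ s, P i) := by
  classical
  induction s using Finset.induction_on with
  | empty => simpa using hasInvExpansion_zero
  | insert i s hi ih =>
    simp only [Finset.sum_insert hi]
    exact (h i (Finset.mem_insert_self _ _)).add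
      (ih fun j hj => h j (Finset.mem_insert_of_mem hj))

theorem HasInvExpansion.mul (hx : Tendsto x l atTop) (hf : HasInvExpansion l x f P)
    (hg : HasInvExpansion l x g Q) : HasInvExpansion l x (fun a => f a * g a) (P * Q) := by
  have hg1 := hg.isBigO_one
  rw [hasInvExpansion_iff] at hf hg ⊢
  intro N
  -- The product of truncations and the truncation of the product agree below degree N; the cofactor
  -- r stays bounded at 1/x, so their difference is within the allowed error.
  obtain ⟨r, hr⟩ : (Polynomial.X : Polynomial ℝ) ^ N ∣
      P.trunc N * Q.trunc N - (P * Q).trunc N := by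
    rw [Polynomial.X_pow_dvd_iff]
    intro d hd
    rw [Polynomial.coeff_sub, PowerSeries.coeff_trunc, if_pos hd,
      PowerSeries.coeff_mul_eq_coeff_trunc_mul_trunc P Q hd, ← Polynomial.coeff_coe,
      Polynomial.coe_mul, sub_self]
  have e : ∀ a, f a * g a - partialSum (P * Q) N (x a) = (f a - partialSum P N (x a)) * g a
      + (g a - partialSum Q N (x a)) * partialSum P N (x a) + 1 / x a ^ N * r.eval (x a)⁻¹ := by
    intro a
    have := congrArg (Polynomial.eval (x a)⁻¹) hr
    rw [Polynomial.eval_sub, Polynomial.eval_mul, Polynomial.eval_mul, Polynomial.eval_pow,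
      Polynomial.eval_X, inv_pow] at this
    simp only [partialSum]
    rw [one_div]
    linear_combination this
  simp only [e]
  have h1 := (hf N).mul hg1
  have h2 := (hg N).mul (isBigO_eval_inv hx (P.trunc N))
  have h3 := (isBigO_refl (fun a => 1 / x a ^ N) l).mul (isBigO_eval_inv hx r)
  simp only [mul_one] at h1 h2 h3
  exact (h1.add h2).add h3

theorem hasInvExpansion_one : HasInvExpansion l x (fun _ => 1) 1 := by
  intro N
  cases N with
  | zero => simpa using isBigO_refl (fun _ : α => (1 : ℝ)) l
  | succ N =>
    refine (isBigO_zero _ _).congr_left fun a => ?_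
    rw [Finset.sum_range_succ', Finset.sum_eq_zero]
    · simp
    · intro k _
      rw [PowerSeries.coeff_one, if_neg (Nat.succ_ne_zero k), zero_div]

theorem HasInvExpansion.prod (hx : Tendsto x l atTop) {ι : Type*} (s : Finset ι) {F : ι → α → ℝ}
    {P : ι → PowerSeries ℝ} (h : ∀ i ∈ s, HasInvExpansion l x (F i) (P i)) :
    HasInvExpansion l x (fun a => ∏ i ∈ s, F i a) (∏ i ∈ s, P i) := by
  classical
  induction s using Finset.induction_on with
  | empty => simpa using hasInvExpansion_one
  | insert i s hi ih =>
    simp only [Finset.prod_insert hi]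
    exact (h i (Finset.mem_insert_self _ _)).mul hx
      (ih fun j hj => h j (Finset.mem_insert_of_mem hj))

theorem coeff_succ_X_mul_inv (c : ℚ) (k : ℕ) :
    PowerSeries.coeff (k + 1) (PowerSeries.X * (1 + PowerSeries.C c * PowerSeries.X)⁻¹) = (-c) ^ k := by
  have : (PowerSeries.mk fun k => (-c) ^ k) = (1 + PowerSeries.C c * PowerSeries.X)⁻¹ := by
    rw [PowerSeries.eq_inv_iff_mul_eq_one (by simp)]
    ext n
    rw [mul_add, mul_one, map_add, mul_left_comm, PowerSeries.coeff_C_mul, mul_comm _ PowerSeries.X]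
    cases n with
    | zero => simp
    | succ n =>
      rw [PowerSeries.coeff_succ_X_mul, PowerSeries.coeff_mk, PowerSeries.coeff_mk,
        PowerSeries.coeff_one, if_neg (Nat.succ_ne_zero n)]
      ring
  rw [PowerSeries.coeff_succ_X_mul, ← this, PowerSeries.coeff_mk]

theorem hasInvExpansion_one_div_add (hx : Tendsto x l atTop) (c : ℚ) :
    HasInvExpansion l x (fun a => 1 / (x a + c))
      ((PowerSeries.X * (1 + PowerSeries.C c * PowerSeries.X)⁻¹ : PowerSeries ℚ).map
        (algebraMap ℚ ℝ)) := by
  have hbig : ∀ N : ℕ, (fun a => (-(c : ℝ)) ^ N / (x a ^ N * (x a + c))) =O[l]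
      fun a => 1 / x a ^ (N + 1) := by
    intro N
    refine IsBigO.of_bound (2 * |(-(c : ℝ)) ^ N|) ?_
    filter_upwards [hx.eventually_ge_atTop (2 * |(c : ℝ)| + 1)] with a ha
    have h0 : (0 : ℝ) < x a := by have := abs_nonneg (c : ℝ); linarith
    have h1 : x a / 2 ≤ x a + c := by have := neg_abs_le (c : ℝ); linarith
    have h2 : 0 < x a + c := by linarith
    rw [Real.norm_eq_abs, abs_div, abs_of_pos (show 0 < x a ^ N * (x a + c) by positivity),
      Real.norm_of_nonneg (by positivity), mul_one_div, div_le_div_iff₀ (by positivity) (by positivity),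
      pow_succ]
    have : |(-(c : ℝ)) ^ N| * x a ^ N * (x a / 2) ≤ |(-(c : ℝ)) ^ N| * x a ^ N * (x a + c) :=
      mul_le_mul_of_nonneg_left h1 (by positivity)
    nlinarith
  -- The exact remainder of the geometric series in -c/t.
  have hid : ∀ N : ℕ, ∀ t : ℝ, t ≠ 0 → t + c ≠ 0 → 1 / (t + c) - ∑ k ∈ Finset.range (N + 1),
      PowerSeries.coeff k ((PowerSeries.X * (1 + PowerSeries.C c * PowerSeries.X)⁻¹ :
        PowerSeries ℚ).map (algebraMap ℚ ℝ)) / t ^ k = (-(c : ℝ)) ^ N / (t ^ N * (t + c)) := by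
    intro N t h1 h2
    induction N with
    | zero => simp
    | succ N ih =>
      rw [Finset.sum_range_succ, ← sub_sub, ih, PowerSeries.coeff_map, coeff_succ_X_mul_inv]
      simp only [map_pow, map_neg, eq_ratCast]
      field_simp
      ring
  intro N
  cases N with
  | zero =>
    have h := (hbig 0).trans (isBigO_one_div_pow_of_le hx (Nat.zero_le (0 + 1)))
    simpa using h
  | succ N =>
    refine (hbig N).congr' ?_ EventuallyEq.rfl
    filter_upwards [hx.eventually_ge_atTop (|(c : ℝ)| + 1)] with a ha
    have h0 := abs_nonneg (c : ℝ)
    have h1 := neg_abs_le (c : ℝ)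
    exact (hid N (x a) (by linarith) (by linarith)).symm

/-- The function `1/(t+a)_m`. -/
noncomputable def invRising (a : ℤ) (m : ℕ) (t : ℝ) : ℝ :=
  ∏ i ∈ Finset.range m, 1 / (t + ((a : ℝ) + i))

theorem hasInvExpansion_invRising (hx : Tendsto x l atTop) (a : ℤ) (m : ℕ) :
    HasInvExpansion l x (fun b => invRising a m (x b)) ((invPochhammer a m).map (algebraMap ℚ ℝ)) := by
  rw [invPochhammer, map_prod]
  refine HasInvExpansion.prod hx _ fun i _ => ?_
  have := hasInvExpansion_one_div_add hx ((a : ℚ) + (i : ℚ))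
  push_cast at this
  exact this

theorem HasInvExpansion.unique [l.NeBot] (hx : Tendsto x l atTop) (hP : HasInvExpansion l x f P)
    (hQ : HasInvExpansion l x f Q) : P = Q := by
  ext n
  induction n using Nat.strong_induction_on with
  | _ n ih =>
    have h := (hQ (n + 1)).sub (hP (n + 1))
    have h1 : (fun a => (PowerSeries.coeff n P - PowerSeries.coeff n Q) / x a ^ n) =O[l]
        fun a => 1 / x a ^ (n + 1) := by
      refine h.congr_left fun a => ?_
      rw [Finset.sum_range_succ, Finset.sum_range_succ,
        Finset.sum_congr rfl fun k hk => by rw [← ih k (Finset.mem_range.1 hk)]]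
      ring
    have h2 := h1.mul (isBigO_refl (fun a => x a ^ n) l)
    have h3 : (fun _ : α => PowerSeries.coeff n P - PowerSeries.coeff n Q) =O[l] fun a => (x a)⁻¹ := by
      refine h2.congr' ?_ ?_
      · filter_upwards [hx.eventually_gt_atTop 0] with a ha
        rw [div_mul_cancel₀ _ (by positivity)]
      · filter_upwards [hx.eventually_gt_atTop 0] with a ha
        rw [pow_succ]
        field_simp
    have h4 := h3.trans_tendsto (tendsto_inv_atTop_zero.comp hx)
    exact sub_eq_zero.1 (tendsto_nhds_unique tendsto_const_nhds h4)

theorem hasInvExpansion_iff_eq [l.NeBot] (hx : Tendsto x l atTop) (hP : HasInvExpansion l x f P) :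
    HasInvExpansion l x f Q ↔ Q = P :=
  ⟨fun h => h.unique hx hP, fun h => h ▸ hP⟩

/-- No convergence of the inverse Pochhammer series is available or needed: for each order some
partial sum that is close enough, with the right initial coefficients, suffices. -/
theorem HasInvExpansion.of_approx
    (h : ∀ N, ∃ g Q, HasInvExpansion l x g Q ∧ ((fun a => f a - g a) =O[l] fun a => 1 / x a ^ N) ∧
      ∀ k < N, PowerSeries.coeff k Q = PowerSeries.coeff k P) : HasInvExpansion l x f P := by
  intro N
  obtain ⟨g, Q, hg, hfg, hc⟩ := h N
  refine (hfg.add (hg N)).congr_left fun a => ?_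
  rw [Finset.sum_congr rfl fun k hk => by rw [hc k (Finset.mem_range.1 hk)]]
  ring

end InverseExpansions

/-! ### From increments to decay -/

section Telescoping

open Filter Asymptotics Topology

/-- Each increment is dominated by a difference, since 2/z^{m+1} ≤ 1/(z-2)^m - 1/z^m; the sum
telescopes and u tends to 0. The factor 2^m comes from y-2 ≥ y/2, valid for y ≥ 4. -/
theorem abs_le_of_telescoping {u : ℕ → ℝ} {y c : ℝ} {m : ℕ} (hm : 1 ≤ m) (hy : 4 ≤ y) (hc : 0 ≤ c)
    (h0 : Tendsto u atTop (𝓝 0)) (h : ∀ k : ℕ, |u (k + 1) - u k| ≤ c / (y + 2 * k) ^ (m + 1)) :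
    |u 0| ≤ c * 2 ^ m / y ^ m := by
  have step : ∀ z : ℝ, 4 ≤ z → c / z ^ (m + 1) ≤ c / 2 * (1 / (z - 2) ^ m - 1 / z ^ m) := by
    intro z hz
    have hz2 : 0 < z - 2 := by linarith
    have hz0 : 0 < z := by linarith
    obtain ⟨n, rfl⟩ : ∃ n, m = n + 1 := ⟨m - 1, by omega⟩
    have h1 : 1 / (z - 2) ^ (n + 1) ≥ 1 / (z ^ n * (z - 2)) := by
      refine one_div_le_one_div_of_le (by positivity) ?_
      rw [pow_succ]
      exact mul_le_mul_of_nonneg_right (pow_le_pow_left₀ hz2.le (by linarith) n) hz2.le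
    have h2 : 2 / z ^ (n + 1 + 1) ≤ 1 / (z ^ n * (z - 2)) - 1 / z ^ (n + 1) := by
      have e : 1 / (z ^ n * (z - 2)) - 1 / z ^ (n + 1) = 2 / (z ^ (n + 1) * (z - 2)) := by
        field_simp
        ring
      rw [e, pow_succ z (n + 1)]
      refine div_le_div_of_nonneg_left (by norm_num) (by positivity) ?_
      exact mul_le_mul_of_nonneg_left (by linarith) (by positivity)
    have h3 : 2 / z ^ (n + 1 + 1) ≤ 1 / (z - 2) ^ (n + 1) - 1 / z ^ (n + 1) := by linarith
    calc c / z ^ (n + 1 + 1) = c / 2 * (2 / z ^ (n + 1 + 1)) := by field_simp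
      _ ≤ _ := mul_le_mul_of_nonneg_left h3 (by positivity)
  have bound : ∀ n : ℕ, |u 0| ≤ |u n| + c / 2 * (1 / (y - 2) ^ m - 1 / (y + 2 * n - 2) ^ m) := by
    intro n
    induction n with
    | zero => simp
    | succ n ih =>
      have h1 := (h n).trans (step (y + 2 * n) (by have : (0 : ℝ) ≤ n := n.cast_nonneg; linarith))
      have h2 : |u n| ≤ |u (n + 1)| + |u (n + 1) - u n| := by
        have := abs_sub_abs_le_abs_sub (u n) (u (n + 1))
        rw [abs_sub_comm (u n)] at this
        linarith
      push_cast
      rw [show y + 2 * ((n : ℝ) + 1) - 2 = y + 2 * n by ring]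
      nlinarith
  have hy2 : 0 < y - 2 := by linarith
  have bound' : ∀ n : ℕ, |u 0| ≤ |u n| + c / 2 * (1 / (y - 2) ^ m) := by
    intro n
    refine (bound n).trans ?_
    have : 0 ≤ 1 / (y + 2 * n - 2) ^ m := by
      have : (0 : ℝ) ≤ n := n.cast_nonneg
      have : 0 < y + 2 * n - 2 := by linarith
      positivity
    have := mul_nonneg (by positivity : 0 ≤ c / 2) this
    nlinarith
  have hlim : Tendsto (fun n => |u n| + c / 2 * (1 / (y - 2) ^ m)) atTop
      (𝓝 (0 + c / 2 * (1 / (y - 2) ^ m))) := by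
    have := h0.abs
    rw [abs_zero] at this
    exact this.add_const _
  have h1 := ge_of_tendsto' hlim bound'
  rw [zero_add] at h1
  refine h1.trans ?_
  have h2 : 1 / (y - 2) ^ m ≤ 2 ^ m / y ^ m := by
    rw [div_le_div_iff₀ (by positivity) (by positivity), one_mul, ← mul_pow]
    exact pow_le_pow_left₀ (by linarith) (by linarith) m
  calc c / 2 * (1 / (y - 2) ^ m) ≤ c / 2 * (2 ^ m / y ^ m) :=
        mul_le_mul_of_nonneg_left h2 (by positivity)
    _ ≤ c * (2 ^ m / y ^ m) := mul_le_mul_of_nonneg_right (by linarith) (by positivity)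
    _ = _ := by ring

theorem isBigO_of_telescoping {v : ℝ → ℝ} {m : ℕ} (hm : 1 ≤ m) (h0 : Tendsto v atTop (𝓝 0))
    (h : (fun t => v (t + 2) - v t) =O[atTop] fun t => 1 / t ^ (m + 1)) :
    v =O[atTop] fun t => 1 / t ^ m := by
  obtain ⟨c, hc, h⟩ := h.exists_nonneg
  obtain ⟨M, hM⟩ := eventually_atTop.1 h.bound
  refine IsBigO.of_bound (c * 2 ^ m) ?_
  filter_upwards [eventually_ge_atTop (max M 4)] with t ht
  have ht4 : 4 ≤ t := (le_max_right _ _).trans ht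
  have htM : M ≤ t := (le_max_left _ _).trans ht
  have h1 := abs_le_of_telescoping (u := fun k => v (t + 2 * k)) (y := t) hm ht4 hc ?_ ?_
  · simp only [Nat.cast_zero, mul_zero, add_zero] at h1
    rw [Real.norm_eq_abs, Real.norm_of_nonneg (by positivity), mul_one_div]
    exact h1
  · refine h0.comp ?_
    exact tendsto_atTop_add_const_left _ _
      (tendsto_natCast_atTop_atTop.const_mul_atTop (by norm_num))
  · intro k
    have hk : (0 : ℝ) ≤ k := k.cast_nonneg
    have := hM (t + 2 * k) (by linarith)
    rw [Real.norm_eq_abs, Real.norm_of_nonneg (by positivity), mul_one_div] at this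
    push_cast
    rw [show t + 2 * ((k : ℝ) + 1) = t + 2 * k + 2 by ring]
    exact this

theorem isBigO_nat_of_telescoping {u : ℕ → ℝ} {b : ℝ} {m : ℕ} (hm : 1 ≤ m)
    (h0 : Tendsto u atTop (𝓝 0))
    (h : (fun e : ℕ => u (e + 1) - u e) =O[atTop] fun e => 1 / (2 * (e : ℝ) + b) ^ (m + 1)) :
    u =O[atTop] fun e => 1 / (2 * (e : ℝ) + b) ^ m := by
  obtain ⟨c, hc, h⟩ := h.exists_nonneg
  obtain ⟨M, hM⟩ := eventually_atTop.1 h.bound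
  refine IsBigO.of_bound (c * 2 ^ m) ?_
  have hb : Tendsto (fun e : ℕ => 2 * (e : ℝ) + b) atTop atTop :=
    tendsto_atTop_add_const_right _ _ (tendsto_natCast_atTop_atTop.const_mul_atTop (by norm_num))
  filter_upwards [eventually_ge_atTop M, hb.eventually_ge_atTop 4] with e he he4
  have h1 := abs_le_of_telescoping (u := fun k => u (e + k)) (y := 2 * (e : ℝ) + b) hm he4 hc ?_ ?_
  · rw [Real.norm_eq_abs, Real.norm_of_nonneg (by positivity), mul_one_div]
    exact h1
  · exact h0.comp (tendsto_add_atTop_nat e |>.congr fun k => add_comm k e)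
  · intro k
    have hk : (0 : ℝ) ≤ k := k.cast_nonneg
    have := hM (e + k) (by omega)
    push_cast at this
    rw [show 2 * ((e : ℝ) + k) + b = 2 * e + b + 2 * k by ring] at this
    rw [Real.norm_eq_abs, Real.norm_of_nonneg (by positivity), mul_one_div] at this
    exact this

end Telescoping

/-! ### Formal sums of inverse Pochhammer symbols -/

section FormalSums

theorem exists_invPochhammer_eq (a : ℤ) (m : ℕ) : ∃ u : PowerSeries ℚ,
    PowerSeries.constantCoeff u = 1 ∧ invPochhammer a m = PowerSeries.X ^ m * u := by
  refine ⟨∏ i ∈ Finset.range m, (1 + PowerSeries.C ((a : ℚ) + (i : ℚ)) * PowerSeries.X)⁻¹, ?_, ?_⟩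
  · rw [map_prod]
    refine Finset.prod_eq_one fun i _ => ?_
    rw [PowerSeries.constantCoeff_inv]
    simp
  · rw [invPochhammer, Finset.prod_mul_distrib, Finset.prod_const, Finset.card_range]

theorem coeff_invPochhammer_of_lt (a : ℤ) {m n : ℕ} (h : n < m) :
    PowerSeries.coeff n (invPochhammer a m) = 0 := by
  obtain ⟨u, -, hu⟩ := exists_invPochhammer_eq a m
  rw [hu, PowerSeries.coeff_X_pow_mul', if_neg (by omega)]

theorem coeff_invPochhammer_self (a : ℤ) (m : ℕ) :
    PowerSeries.coeff m (invPochhammer a m) = 1 := by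
  obtain ⟨u, hu0, hu⟩ := exists_invPochhammer_eq a m
  rw [hu, PowerSeries.coeff_X_pow_mul', if_pos le_rfl, Nat.sub_self,
    PowerSeries.coeff_zero_eq_constantCoeff_apply, hu0]

variable {p : ℕ → PowerSeries ℚ} {s : ℕ}

/-- The sum of a sequence of power series of increasing order. -/
noncomputable def formalSum (f : ℕ → PowerSeries ℚ) : PowerSeries ℚ :=
  PowerSeries.mk fun n => PowerSeries.coeff n (∑ j ∈ Finset.Icc 1 n, f j)

theorem coeff_sum_eq_coeff_formalSum {f : ℕ → PowerSeries ℚ}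
    (hf : ∀ j n, n < j → PowerSeries.coeff n (f j) = 0) {n J : ℕ} (h : n ≤ J) :
    PowerSeries.coeff n (∑ j ∈ Finset.Icc 1 J, f j) = PowerSeries.coeff n (formalSum f) := by
  rw [formalSum, PowerSeries.coeff_mk, map_sum, map_sum]
  refine (Finset.sum_subset (Finset.Icc_subset_Icc_right h) fun j hj hj' => ?_).symm
  rw [Finset.mem_Icc] at hj hj'
  exact hf j n (by omega)

theorem isFormalSum_formalSum {f : ℕ → PowerSeries ℚ}
    (hf : ∀ j n, n < j → PowerSeries.coeff n (f j) = 0) : IsFormalSum f (formalSum f) := fun n =>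
  Filter.eventually_atTop.2 ⟨n, fun _ h => coeff_sum_eq_coeff_formalSum hf h⟩

/-- The system is triangular: p_j has order exactly s+2j with leading coefficient 1, so the
coefficient at that order determines a_j from the earlier ones. -/
theorem isFormalSum_iff (hp : ∀ j n, n < s + 2 * j → PowerSeries.coeff n (p j) = 0)
    (hp1 : ∀ j, PowerSeries.coeff (s + 2 * j) (p j) = 1) (c a : ℕ → ℚ) :
    IsFormalSum (fun j => PowerSeries.C (a j) * p j) (formalSum fun j => PowerSeries.C (c j) * p j)
      ↔ ∀ j, 1 ≤ j → a j = c j := by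
  have hf : ∀ (c : ℕ → ℚ) j n, n < j → PowerSeries.coeff n (PowerSeries.C (c j) * p j) = 0 := by
    intro c j n hn
    rw [PowerSeries.coeff_C_mul, hp j n (by omega), mul_zero]
  constructor
  · intro h j
    induction j using Nat.strong_induction_on with
    | _ j ih =>
      intro hj
      obtain ⟨J, hJ, hJj, hJn⟩ := ((h (s + 2 * j)).and ((Filter.eventually_ge_atTop j).and
        (Filter.eventually_ge_atTop (s + 2 * j)))).exists
      rw [← coeff_sum_eq_coeff_formalSum (hf c) hJn, map_sum, map_sum, ← sub_eq_zero,
        ← Finset.sum_sub_distrib, Finset.sum_eq_single j] at hJ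
      · rw [PowerSeries.coeff_C_mul, PowerSeries.coeff_C_mul, hp1] at hJ
        linarith
      · intro b hb hbj
        rw [Finset.mem_Icc] at hb
        rcases lt_or_gt_of_ne hbj with hlt | hlt
        · rw [ih b hlt hb.1, sub_self]
        · rw [PowerSeries.coeff_C_mul, PowerSeries.coeff_C_mul, hp b _ (by omega)]
          ring
      · intro hj'
        exact absurd (Finset.mem_Icc.2 ⟨hj, hJj⟩) hj'
  · intro h
    have := isFormalSum_formalSum (hf c)
    intro n
    filter_upwards [this n] with J hJ
    rw [← hJ]
    congr 1
    exact Finset.sum_congr rfl fun j hj => by rw [h j (Finset.mem_Icc.1 hj).1]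

end FormalSums

/-! ### Difference equations of inverse Pochhammer symbols -/

section InverseRising

theorem invRising_succ_right (a : ℤ) (m : ℕ) (t : ℝ) :
    invRising a (m + 1) t = invRising a m t * (1 / (t + (a + m))) := by
  rw [invRising, Finset.prod_range_succ, ← invRising]

theorem invRising_succ_left (a : ℤ) (m : ℕ) (t : ℝ) :
    invRising a (m + 1) t = 1 / (t + a) * invRising (a + 1) m t := by
  rw [invRising, Finset.prod_range_succ', mul_comm, Nat.cast_zero, add_zero]
  congr 1
  refine Finset.prod_congr rfl fun i _ => ?_
  push_cast
  ring

theorem invRising_add_two (a : ℤ) (m : ℕ) (t : ℝ) :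
    invRising a m (t + 2) = invRising (a + 2) m t := by
  refine Finset.prod_congr rfl fun i _ => ?_
  push_cast
  ring

/-- The inverse Pochhammer symbols `1/(t-2d-j+1)_{2d+2j+2}`. -/
noncomputable def invP (d j : ℕ) (t : ℝ) : ℝ := invRising (1 - 2 * (d : ℤ) - (j : ℤ)) (2 * d + 2 * j + 2) t

/-- The inverse Pochhammer symbols `1/(t-2d-j+1)_{2d+2j}`. -/
noncomputable def invP' (d j : ℕ) (t : ℝ) : ℝ := invRising (1 - 2 * (d : ℤ) - (j : ℤ)) (2 * d + 2 * j) t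

/-- The inverse Pochhammer symbols `1/(t-2d-j+3)_{2d+2j}`. -/
noncomputable def invR (d j : ℕ) (t : ℝ) : ℝ := invRising (3 - 2 * (d : ℤ) - (j : ℤ)) (2 * d + 2 * j) t

/-- Neighbouring symbols are all written over the common factor `invR`, which occurs in both `invP d
j t` and `invP d j (t + 2)`; the identities below then become polynomial. -/
theorem invP_eq (d j : ℕ) (t : ℝ) : invP d j t =
    invR d j t * (1 / (t - 2 * d - j + 1)) * (1 / (t - 2 * d - j + 2)) := by
  rw [invP, invRising_succ_left, invRising_succ_left, invR]
  rw [show (1 - 2 * (d : ℤ) - j + 1 + 1) = 3 - 2 * (d : ℤ) - j by ring]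
  push_cast
  rw [show t + (1 - 2 * (d : ℝ) - j) = t - 2 * d - j + 1 by ring,
    show t + (1 - 2 * (d : ℝ) - j + 1) = t - 2 * d - j + 2 by ring]
  ring

theorem invP_add_two (d j : ℕ) (t : ℝ) : invP d j (t + 2) =
    invR d j t * (1 / (t + j + 3)) * (1 / (t + j + 4)) := by
  rw [invP, invRising_add_two, invRising_succ_right, invRising_succ_right, invR]
  rw [show (1 - 2 * (d : ℤ) - j + 2) = 3 - 2 * (d : ℤ) - j by ring]
  push_cast
  rw [show t + (3 - 2 * (d : ℝ) - j + (2 * d + 2 * j)) = t + j + 3 by ring,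
    show t + (3 - 2 * (d : ℝ) - j + (2 * d + 2 * j + 1)) = t + j + 4 by ring]

theorem invR_succ (d j : ℕ) (t : ℝ) : invR d (j + 1) t =
    invR d j t * (1 / (t - 2 * d - j + 2)) * (1 / (t + j + 3)) := by
  rw [invR, show 2 * d + 2 * (j + 1) = 2 * d + 2 * j + 1 + 1 by ring, invRising_succ_left,
    invRising_succ_right, invR]
  push_cast
  rw [show (3 - 2 * (d : ℤ) - (j + 1) + 1) = 3 - 2 * (d : ℤ) - j by ring]
  rw [show t + (3 - 2 * (d : ℝ) - (j + 1)) = t - 2 * d - j + 2 by ring,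
    show t + (3 - 2 * (d : ℝ) - (j + 1) + 1 + (2 * d + 2 * j)) = t + j + 3 by ring]
  ring

theorem invP'_eq (d j : ℕ) {t : ℝ} (ht : 2 * (d : ℝ) + j < t) :
    invP' d j t = invP d j t * ((t + j + 1) * (t + j + 2)) := by
  have h0 : (0 : ℝ) ≤ d := d.cast_nonneg
  have h0' : (0 : ℝ) ≤ j := j.cast_nonneg
  rw [invP, invRising_succ_right, invRising_succ_right, invP']
  push_cast
  rw [show t + (1 - 2 * (d : ℝ) - j + (2 * d + 2 * j)) = t + j + 1 by ring,
    show t + (1 - 2 * (d : ℝ) - j + (2 * d + 2 * j + 1)) = t + j + 2 by ring]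
  have h1 : t + j + 1 ≠ 0 := by linarith
  have h2 : t + j + 2 ≠ 0 := by linarith
  field_simp

/-- Over a common denominator the numerator is u(u+1) - v(v+1) = (u-v)(u+v+1) with u = t+j+1 and v =
t-2d-j+1. So `invP'` sums the symbols weighted by 2t-2d+3, the weight occurring in `Chat_succ_sub`.
-/
theorem invP'_sub (d j : ℕ) {t : ℝ} (ht : 2 * (d : ℝ) + j < t) :
    invP' d j t - invP' d j (t + 2) = 2 * (d + j) * ((2 * t - 2 * d + 3) * invP d j t) := by
  have h0 : (0 : ℝ) ≤ d := d.cast_nonneg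
  have h0' : (0 : ℝ) ≤ j := j.cast_nonneg
  have h1 : invP' d j (t + 2) = invR d j t := by
    rw [invP', invRising_add_two, invR]
    congr 1
    ring
  have hA : t - 2 * d - j + 1 ≠ 0 := by linarith
  have hB : t - 2 * d - j + 2 ≠ 0 := by linarith
  rw [invP'_eq d j ht, h1, invP_eq]
  field_simp
  ring

/-- The bracket identity behind the recursion of the coefficients. -/
theorem invP_bracket (d j : ℕ) {t : ℝ} (ht : 2 * (d : ℝ) + j < t) :
    (t + 4) ^ 3 * (t + 2 - 2 * d) * invP d j (t + 2) - (t + 1 - 2 * d) ^ 3 * (t + 3) * invP d j t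
      = (2 * t - 2 * d + 5) * ((2 - 2 * j) * invR d j t
        + ((j - 1) ^ 3 * (2 * d + j + 1) - j ^ 3 * (2 * d + j + 2)) * invR d (j + 1) t
        + (- j ^ 3 * (2 * d + j + 2) * (2 * d + 2 * j + 2)) * invR d (j + 2) t) := by
  have h0 : (0 : ℝ) ≤ d := d.cast_nonneg
  have h0' : (0 : ℝ) ≤ j := j.cast_nonneg
  have hA : t - 2 * d - j + 1 ≠ 0 := by linarith
  have hB : t - 2 * d - j + 2 ≠ 0 := by linarith
  have hC : t + j + 3 ≠ 0 := by linarith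
  have hD : t + j + 4 ≠ 0 := by linarith
  rw [invP_add_two, invP_eq, invR_succ d (j + 1), invR_succ d j]
  push_cast
  rw [show t - 2 * (d : ℝ) - (j + 1) + 2 = t - 2 * d - j + 1 by ring,
    show t + ((j : ℝ) + 1) + 3 = t + j + 4 by ring]
  field_simp
  ring

/-- Each bracket spreads over three consecutive symbols `invR`; the recursion of the A_j cancels
everything except two terms at the upper end. The partial sums thus satisfy the functional equation
of the Gamma quotient up to a high-order error. -/
theorem sum_invP_bracket (d J : ℕ) {t : ℝ} (ht : 2 * (d : ℝ) + J < t) :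
    (t + 4) ^ 3 * (t + 2 - 2 * d) * (∑ j ∈ Finset.Icc 1 J, (aCoeff d j : ℝ) * invP d j (t + 2))
      - (t + 1 - 2 * d) ^ 3 * (t + 3) * (∑ j ∈ Finset.Icc 1 J, (aCoeff d j : ℝ) * invP d j t)
      = (2 * t - 2 * d + 5) * (2 * J * aCoeff d (J + 1) * invR d (J + 1) t
        + (- J ^ 3 * (2 * d + J + 2) * (2 * d + 2 * J + 2)) * aCoeff d J * invR d (J + 2) t) := by
  induction J with
  | zero => simp
  | succ J ih =>
    push_cast at ht
    have h1 := ih (by linarith)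
    have h2 := invP_bracket d (J + 1) (t := t) (by push_cast; linarith)
    rw [Finset.sum_Icc_succ_top (by omega), Finset.sum_Icc_succ_top (by omega)]
    -- For J ≥ 1 this is `aCoeff_recursion`. For J = 0 the factor J³ removes the meaningless A_0,
    -- and what remains is the relation between A_1 and A_2.
    have h3 : 2 * ((J : ℝ) + 1) * aCoeff d (J + 2) =
        (J ^ 3 * (2 * d + J + 2) - (J + 1) ^ 3 * (2 * d + J + 3)) * aCoeff d (J + 1)
        - J ^ 3 * (2 * d + J + 2) * (2 * d + 2 * J + 2) * aCoeff d J := by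
      cases J with
      | zero =>
        have e2 := congrArg (fun q : ℚ => (q : ℝ)) (aCoeff_two d)
        have e1 := congrArg (fun q : ℚ => (q : ℝ)) (aCoeff_one d)
        push_cast at e1 e2 ⊢
        simp only [zero_add]
        rw [e1]
        linear_combination e2
      | succ i =>
        have e := congrArg (fun q : ℚ => (q : ℝ)) (aCoeff_recursion d i)
        push_cast at e ⊢
        linear_combination e
    push_cast at h1 h2 ⊢
    simp only [show J + 1 + 1 = J + 2 by ring, show J + 1 + 2 = J + 3 by ring] at h2 ⊢
    linear_combination h1 + (aCoeff d (J + 1) : ℝ) * h2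
      - (2 * t - 2 * d + 5) * invR d (J + 2) t * h3

end InverseRising

/-! ### The Gamma quotient: functional equation and leading behaviour -/

section GammaQuotient

open Filter Asymptotics Topology

/-- The quotient `Γ(y+½)/Γ(y)`. -/
noncomputable def gammaRatio (y : ℝ) : ℝ := Real.Gamma (y + 1 / 2) / Real.Gamma y

theorem gamma_midpoint_sq_le {s t : ℝ} (hs : 0 < s) (ht : 0 < t) :
    Real.Gamma ((s + t) / 2) ^ 2 ≤ Real.Gamma s * Real.Gamma t := by
  have h := Real.Gamma_mul_add_mul_le_rpow_Gamma_mul_rpow_Gamma hs ht (a := 1 / 2) (b := 1 / 2)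
    (by norm_num) (by norm_num) (by norm_num)
  have h1 := Real.Gamma_pos_of_pos hs
  have h2 := Real.Gamma_pos_of_pos ht
  rw [← Real.sqrt_eq_rpow, ← Real.sqrt_eq_rpow, ← Real.sqrt_mul h1.le,
    show 1 / 2 * s + 1 / 2 * t = (s + t) / 2 by ring] at h
  calc Real.Gamma ((s + t) / 2) ^ 2 ≤ (√(Real.Gamma s * Real.Gamma t)) ^ 2 :=
        pow_le_pow_left₀ (Real.Gamma_pos_of_pos (by linarith)).le h 2
    _ = _ := Real.sq_sqrt (by positivity)

/-- Log-convexity of Γ on [y, y+1] and on [y+½, y+3/2] traps the ratio; the leading asymptotics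
follow without Stirling's formula. -/
theorem gammaRatio_sq_bounds {y : ℝ} (hy : 0 < y) :
    y ^ 2 / (y + 1 / 2) ≤ gammaRatio y ^ 2 ∧ gammaRatio y ^ 2 ≤ y := by
  have g0 := Real.Gamma_pos_of_pos hy
  have g1 := Real.Gamma_pos_of_pos (show 0 < y + 1 / 2 by linarith)
  have h1 := gamma_midpoint_sq_le hy (show 0 < y + 1 by linarith)
  have h2 := gamma_midpoint_sq_le (show 0 < y + 1 / 2 by linarith) (show 0 < y + 1 / 2 + 1 by linarith)
  rw [Real.Gamma_add_one hy.ne', show (y + (y + 1)) / 2 = y + 1 / 2 by ring] at h1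
  rw [Real.Gamma_add_one (show y + 1 / 2 ≠ 0 by linarith),
    show (y + 1 / 2 + (y + 1 / 2 + 1)) / 2 = y + 1 by ring, Real.Gamma_add_one hy.ne'] at h2
  rw [gammaRatio, div_pow]
  constructor
  · rw [div_le_div_iff₀ (by linarith) (by positivity)]
    nlinarith
  · rw [div_le_iff₀ (by positivity)]
    nlinarith

theorem tendsto_gammaRatio_pow_four :
    Tendsto (fun y => gammaRatio y ^ 4 / y ^ 2) atTop (𝓝 1) := by
  have h : Tendsto (fun y => gammaRatio y ^ 2 / y) atTop (𝓝 1) := by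
    have hl : Tendsto (fun y : ℝ => 1 - 1 / 2 * (y + 1 / 2)⁻¹) atTop (𝓝 1) := by
      have := (tendsto_inv_atTop_zero.comp
        (tendsto_atTop_add_const_right atTop (1 / 2 : ℝ) tendsto_id)).const_mul (1 / 2 : ℝ)
      have := this.const_sub 1
      simpa using this
    refine tendsto_of_tendsto_of_tendsto_of_le_of_le' hl tendsto_const_nhds ?_ ?_
    · filter_upwards [eventually_gt_atTop 0] with y hy
      rw [le_div_iff₀ hy]
      refine le_trans (le_of_eq ?_) (gammaRatio_sq_bounds hy).1
      field_simp
      ring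
    · filter_upwards [eventually_gt_atTop 0] with y hy
      rw [div_le_one hy]
      exact (gammaRatio_sq_bounds hy).2
  have h2 := h.pow 2
  rw [one_pow] at h2
  refine h2.congr fun y => ?_
  rw [div_pow, ← pow_mul]

theorem gamma_add_natCast {y : ℝ} (hy : 0 < y) (n : ℕ) :
    Real.Gamma (y + n) = Real.Gamma y * ∏ i ∈ Finset.range n, (y + i) := by
  induction n with
  | zero => simp
  | succ n ih =>
    have : 0 < y + n := by positivity
    rw [Nat.cast_succ, ← add_assoc, Real.Gamma_add_one this.ne', ih, Finset.prod_range_succ]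
    ring

/-- The quotient of Gamma functions whose expansion defines the polynomials `A_j`. -/
noncomputable def gammaQuotient (d : ℕ) (x : ℝ) : ℝ := 1 / 2 ^ (2 * d + 4) *
  (Real.Gamma ((x + 1) / 2 - d) ^ 3 * Real.Gamma ((x + 3) / 2) /
    (Real.Gamma (x / 2 + 2) ^ 3 * Real.Gamma (x / 2 - d + 1)))

theorem gammaQuotient_pos {d : ℕ} {x : ℝ} (hx : 2 * (d : ℝ) < x) : 0 < gammaQuotient d x := by
  have h0 : (0 : ℝ) ≤ d := d.cast_nonneg
  have h1 := Real.Gamma_pos_of_pos (show 0 < (x + 1) / 2 - d by linarith)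
  have h2 := Real.Gamma_pos_of_pos (show 0 < (x + 3) / 2 by linarith)
  have h3 := Real.Gamma_pos_of_pos (show 0 < x / 2 + 2 by linarith)
  have h4 := Real.Gamma_pos_of_pos (show 0 < x / 2 - d + 1 by linarith)
  unfold gammaQuotient
  positivity

theorem gammaQuotient_add_two {d : ℕ} {x : ℝ} (hx : 2 * (d : ℝ) < x) :
    gammaQuotient d (x + 2) * ((x + 4) ^ 3 * (x + 2 - 2 * d))
      = gammaQuotient d x * ((x + 1 - 2 * d) ^ 3 * (x + 3)) := by
  have h0 : (0 : ℝ) ≤ d := d.cast_nonneg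
  have h1 : 0 < (x + 1) / 2 - d := by linarith
  have h2 : 0 < (x + 3) / 2 := by linarith
  have h3 : 0 < x / 2 + 2 := by linarith
  have h4 : 0 < x / 2 - d + 1 := by linarith
  have g1 := Real.Gamma_pos_of_pos h1
  have g2 := Real.Gamma_pos_of_pos h2
  have g3 := Real.Gamma_pos_of_pos h3
  have g4 := Real.Gamma_pos_of_pos h4
  rw [gammaQuotient, gammaQuotient, show (x + 2 + 1) / 2 - d = (x + 1) / 2 - d + 1 by ring,
    show (x + 2 + 3) / 2 = (x + 3) / 2 + 1 by ring, show (x + 2) / 2 + 2 = x / 2 + 2 + 1 by ring,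
    show (x + 2) / 2 - d + 1 = x / 2 - d + 1 + 1 by ring, Real.Gamma_add_one h1.ne',
    Real.Gamma_add_one h2.ne', Real.Gamma_add_one h3.ne', Real.Gamma_add_one h4.ne']
  have e3 : x + 4 = 2 * (x / 2 + 2) := by ring
  have e4 : x + 2 - 2 * d = 2 * (x / 2 - d + 1) := by ring
  have e1 : x + 1 - 2 * d = 2 * ((x + 1) / 2 - d) := by ring
  have e2 : x + 3 = 2 * ((x + 3) / 2) := by ring
  rw [e3, e4, e1, e2]
  generalize Real.Gamma ((x + 1) / 2 - d) = u1 at *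
  rw [← e2]
  generalize Real.Gamma ((x + 3) / 2) = u2 at *
  generalize Real.Gamma (x / 2 + 2) = u3 at *
  generalize Real.Gamma (x / 2 - d + 1) = u4 at *
  generalize (x + 1) / 2 - (d : ℝ) = v1 at *
  generalize x / 2 + 2 = v3 at *
  generalize x / 2 - (d : ℝ) + 1 = v4 at *
  field_simp

/-- With x = 2(y+d) all four Gamma arguments are y or y+½ shifted by integers, so only the fourth
power of `gammaRatio` is transcendental. -/
theorem gammaQuotient_eq (d : ℕ) {y : ℝ} (hy : 0 < y) :
    gammaQuotient d (2 * (y + d)) = 1 / 2 ^ (2 * d + 4) * (gammaRatio y ^ 4 *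
      ∏ i ∈ Finset.range (d + 1), (y + 1 / 2 + i)) / (y * (∏ i ∈ Finset.range (d + 2), (y + i)) ^ 3) := by
  have g0 := Real.Gamma_pos_of_pos hy
  rw [gammaQuotient, show (2 * (y + d) + 1) / 2 - d = y + 1 / 2 by ring,
    show (2 * (y + d) + 3) / 2 = y + 1 / 2 + ((d + 1 : ℕ) : ℝ) by push_cast; ring,
    show 2 * (y + d) / 2 + 2 = y + ((d + 2 : ℕ) : ℝ) by push_cast; ring,
    show 2 * (y + d) / 2 - d + 1 = y + 1 by ring, Real.Gamma_add_one hy.ne', gamma_add_natCast hy,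
    gamma_add_natCast (by linarith), gammaRatio]
  have : 0 < ∏ i ∈ Finset.range (d + 2), (y + i) := Finset.prod_pos fun i _ => by positivity
  field_simp

theorem tendsto_gammaQuotient (d : ℕ) :
    Tendsto (fun x => x ^ (2 * d + 4) * gammaQuotient d x) atTop (𝓝 1) := by
  have hone : ∀ c : ℝ, Tendsto (fun y : ℝ => (y + c) / y) atTop (𝓝 1) := by
    intro c
    have := (tendsto_inv_atTop_zero (𝕜 := ℝ)).const_mul c
    have := this.const_add 1
    rw [mul_zero, add_zero] at this
    refine this.congr' ?_
    filter_upwards [eventually_gt_atTop 0] with y hy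
    field_simp
  have hmain : Tendsto (fun y : ℝ => ((y + d) / y) ^ (2 * d + 4) * (gammaRatio y ^ 4 / y ^ 2) *
      (∏ i ∈ Finset.range (d + 1), ((y + (1 / 2 + i)) / y)) /
        (∏ i ∈ Finset.range (d + 2), ((y + (i : ℝ)) / y)) ^ 3) atTop (𝓝 1) := by
    have h1 := (hone d).pow (2 * d + 4)
    have h2 := tendsto_finsetProd (Finset.range (d + 1)) fun i _ => hone (1 / 2 + (i : ℝ))
    have h3 := tendsto_finsetProd (Finset.range (d + 2)) fun i _ => hone (i : ℝ)
    have := ((h1.mul tendsto_gammaRatio_pow_four).mul h2).div (h3.pow 3) (by simp)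
    simp only [mul_one, one_pow, Finset.prod_const_one, div_one] at this
    exact this
  have hcomp : Tendsto (fun x : ℝ => x / 2 - d) atTop atTop := by
    have := (tendsto_id (α := ℝ) (x := atTop)).atTop_div_const (show (0 : ℝ) < 2 by norm_num)
    exact tendsto_atTop_add_const_right _ (-(d : ℝ)) this
  refine (hmain.comp hcomp).congr' ?_
  filter_upwards [eventually_gt_atTop (2 * (d : ℝ))] with x hx
  have hy : 0 < x / 2 - d := by linarith
  have hxy : x = 2 * (x / 2 - d + d) := by ring
  rw [Function.comp_apply]
  conv_rhs => rw [hxy]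
  rw [gammaQuotient_eq d hy]
  set y := x / 2 - d
  have h3 : 0 < ∏ i ∈ Finset.range (d + 2), (y + i) := Finset.prod_pos fun i _ => by positivity
  rw [Finset.prod_div_distrib, Finset.prod_div_distrib, Finset.prod_const, Finset.prod_const,
    Finset.card_range, Finset.card_range]
  simp only [← add_assoc]
  generalize ∏ i ∈ Finset.range (d + 1), (y + 1 / 2 + (i : ℝ)) = a
  generalize ∏ i ∈ Finset.range (d + 2), (y + (i : ℝ)) = b at *
  generalize gammaRatio y = g
  rw [mul_pow, div_pow]
  generalize y + (d : ℝ) = z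
  field_simp
  ring

end GammaQuotient

/-! ### Asymptotic expansion of the Gamma quotient -/

section LeadingTerms

open Filter Asymptotics Topology

variable {α : Type*} {l : Filter α} {x f : α → ℝ} {P : PowerSeries ℝ}

theorem HasInvExpansion.isBigO_of_coeff_eq_zero {m : ℕ} (hf : HasInvExpansion l x f P)
    (h : ∀ k < m, PowerSeries.coeff k P = 0) : f =O[l] fun a => 1 / x a ^ m := by
  refine (hf m).congr_left fun a => ?_
  rw [Finset.sum_eq_zero fun k hk => by rw [h k (Finset.mem_range.1 hk), zero_div], sub_zero]

theorem HasInvExpansion.tendsto_of_coeff_eq_zero {m : ℕ} (hx : Tendsto x l atTop)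
    (hf : HasInvExpansion l x f P) (h : ∀ k < m, PowerSeries.coeff k P = 0) :
    Tendsto (fun a => x a ^ m * f a) l (𝓝 (PowerSeries.coeff m P)) := by
  have h1 : (fun a => f a - PowerSeries.coeff m P / x a ^ m) =O[l] fun a => 1 / x a ^ (m + 1) := by
    refine (hf (m + 1)).congr_left fun a => ?_
    rw [Finset.sum_range_succ, Finset.sum_eq_zero fun k hk => by
      rw [h k (Finset.mem_range.1 hk), zero_div], zero_add]
  have h2 := (isBigO_refl (fun a => x a ^ m) l).mul h1
  have h3 : (fun a => x a ^ m * f a - PowerSeries.coeff m P) =O[l] fun a => (x a)⁻¹ := by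
    refine h2.congr' ?_ ?_
    · filter_upwards [hx.eventually_gt_atTop 0] with a ha
      field_simp
    · filter_upwards [hx.eventually_gt_atTop 0] with a ha
      rw [pow_succ]
      field_simp
  have h4 := h3.trans_tendsto (tendsto_inv_atTop_zero.comp hx)
  have h5 := h4.add_const (PowerSeries.coeff m P)
  simpa using h5

theorem isBigO_invRising (hx : Tendsto x l atTop) (a : ℤ) (m : ℕ) :
    (fun b => invRising a m (x b)) =O[l] fun b => 1 / x b ^ m :=
  (hasInvExpansion_invRising hx a m).isBigO_of_coeff_eq_zero fun k hk => by
    rw [PowerSeries.coeff_map, coeff_invPochhammer_of_lt a hk, map_zero]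

end LeadingTerms

section GammaExpansion

open Filter Asymptotics Topology

/-- The partial sums `∑_{1 ≤ j ≤ J} c_j p_j` of inverse Pochhammer symbols. -/
noncomputable def seriesP (d J : ℕ) : PowerSeries ℚ := ∑ j ∈ Finset.Icc 1 J,
  PowerSeries.C (aCoeff d j) * invPochhammer (1 - 2 * (d : ℤ) - (j : ℤ)) (2 * d + 2 * j + 2)

/-- The corresponding functions. -/
noncomputable def partialP (d J : ℕ) (t : ℝ) : ℝ :=
  ∑ j ∈ Finset.Icc 1 J, (aCoeff d j : ℝ) * invP d j t

theorem hasInvExpansion_partialP (d J : ℕ) :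
    HasInvExpansion atTop (fun t : ℝ => t) (partialP d J) ((seriesP d J).map (algebraMap ℚ ℝ)) := by
  rw [seriesP, map_sum]
  refine HasInvExpansion.sum _ fun j _ => ?_
  rw [map_mul, PowerSeries.map_C]
  exact (hasInvExpansion_invRising tendsto_id _ _).const_mul _

theorem tendsto_partialP {d J : ℕ} (hJ : 1 ≤ J) :
    Tendsto (fun t => t ^ (2 * d + 4) * partialP d J t) atTop (𝓝 1) := by
  have h := (hasInvExpansion_partialP d J).tendsto_of_coeff_eq_zero (m := 2 * d + 4) tendsto_id ?_
  · have hc : PowerSeries.coeff (2 * d + 4) (seriesP d J) = 1 := by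
      rw [seriesP, map_sum, Finset.sum_eq_single 1]
      · rw [PowerSeries.coeff_C_mul, aCoeff_one, one_mul]
        exact coeff_invPochhammer_self _ _
      · intro j hj hj1
        rw [Finset.mem_Icc] at hj
        rw [PowerSeries.coeff_C_mul, coeff_invPochhammer_of_lt _ (by omega), mul_zero]
      · intro h
        exact absurd (Finset.mem_Icc.2 ⟨le_rfl, hJ⟩) h
    rw [PowerSeries.coeff_map, hc, map_one] at h
    exact h
  · intro k hk
    rw [PowerSeries.coeff_map, seriesP, map_sum, Finset.sum_eq_zero, map_zero]
    intro j hj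
    rw [Finset.mem_Icc] at hj
    rw [PowerSeries.coeff_C_mul, coeff_invPochhammer_of_lt _ (by omega), mul_zero]

/-- Let S be the partial sum and G the Gamma quotient. By the common functional equation, S/G
changes under t ↦ t+2 only by O(t · t^{-(2d+2J+2)} · t^{2d+4} · t^{-4}) = O(t^{-2J-1}). Both leading
coefficients are 1, so S/G - 1 tends to 0 and is therefore O(t^{-2J}); multiplication by G gives the
claim. -/
theorem gammaQuotient_sub_partialP {d J : ℕ} (hJ : 1 ≤ J) :
    (fun t => gammaQuotient d t - partialP d J t) =O[atTop] fun t => 1 / t ^ (2 * d + 2 * J + 4) := by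
  set G := gammaQuotient d with hG
  set S := partialP d J with hS
  set N : ℝ → ℝ := fun t => (t + 1 - 2 * d) ^ 3 * (t + 3) with hN
  have hd0 : (0 : ℝ) ≤ d := d.cast_nonneg
  have hJ0 : (0 : ℝ) ≤ J := J.cast_nonneg
  have hGlim := tendsto_gammaQuotient d
  have hGinv : (fun t => (G t)⁻¹) =O[atTop] fun t => t ^ (2 * d + 4) := by
    have h1 := (hGlim.inv₀ one_ne_zero).isBigO_one ℝ
    have h2 := h1.mul (isBigO_refl (fun t : ℝ => t ^ (2 * d + 4)) atTop)
    refine h2.congr' ?_ (Eventually.of_forall fun t => one_mul _)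
    filter_upwards [eventually_gt_atTop 0] with t ht
    rw [mul_inv]
    field_simp
    rfl
  have hNinv : (fun t => (N t)⁻¹) =O[atTop] fun t => 1 / t ^ 4 := by
    refine IsBigO.of_bound 8 ?_
    filter_upwards [eventually_gt_atTop (4 * (d : ℝ))] with t ht
    have ht0 : 0 < t := by linarith
    have h1 : t / 2 ≤ t + 1 - 2 * d := by linarith
    have h2 : t ^ 4 / 8 ≤ N t := by
      calc t ^ 4 / 8 = (t / 2) ^ 3 * t := by ring
        _ ≤ _ := mul_le_mul (pow_le_pow_left₀ (by positivity) h1 3) (by linarith) ht0.le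
          (pow_nonneg (by linarith) 3)
    have h3 : 0 < N t := lt_of_lt_of_le (by positivity) h2
    rw [Real.norm_of_nonneg (inv_nonneg.2 h3.le), Real.norm_of_nonneg (by positivity)]
    calc (N t)⁻¹ ≤ (t ^ 4 / 8)⁻¹ := inv_anti₀ (by positivity) h2
      _ = _ := by field_simp
  have hlin : (fun t : ℝ => 2 * t - 2 * d + 5) =O[atTop] fun t : ℝ => t := by
    refine IsBigO.of_bound 7 ?_
    filter_upwards [eventually_gt_atTop (2 * (d : ℝ) + 1)] with t ht
    rw [Real.norm_of_nonneg (by linarith), Real.norm_of_nonneg (by linarith)]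
    linarith
  have hr : (fun t => 2 * (J : ℝ) * aCoeff d (J + 1) * invR d (J + 1) t
      + (- (J : ℝ) ^ 3 * (2 * d + J + 2) * (2 * d + 2 * J + 2)) * aCoeff d J * invR d (J + 2) t)
      =O[atTop] fun t : ℝ => 1 / t ^ (2 * d + 2 * J + 2) := by
    have h1 := isBigO_invRising tendsto_id (3 - 2 * (d : ℤ) - ((J + 1 : ℕ) : ℤ)) (2 * d + 2 * (J + 1))
    have h2 := (isBigO_invRising tendsto_id (3 - 2 * (d : ℤ) - ((J + 2 : ℕ) : ℤ)) (2 * d + 2 * (J + 2))).trans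
      (isBigO_one_div_pow_of_le tendsto_id (show 2 * d + 2 * (J + 1) ≤ 2 * d + 2 * (J + 2) by omega))
    exact (h1.const_mul_left _).add (h2.const_mul_left _)
  have hv : (fun t => S t / G t - 1) =O[atTop] fun t => 1 / t ^ (2 * J) := by
    refine isBigO_of_telescoping (by omega) ?_ ?_
    · have h1 := (tendsto_partialP (d := d) hJ).div hGlim one_ne_zero
      have h2 := h1.sub_const 1
      rw [div_one, sub_self] at h2
      refine h2.congr' ?_
      filter_upwards [eventually_gt_atTop 0] with t ht
      rw [Pi.div_apply, mul_div_mul_left _ _ (by positivity)]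
    · refine ((((hlin.mul hr).mul hGinv).mul hNinv).congr' ?_ ?_)
      · filter_upwards [eventually_gt_atTop (2 * (d : ℝ) + J + 1)] with t ht
        have hb := sum_invP_bracket d J (t := t) (by linarith)
        have hg := gammaQuotient_add_two (d := d) (x := t) (by linarith)
        have g1 : 0 < G t := gammaQuotient_pos (by linarith)
        have g2 : 0 < G (t + 2) := gammaQuotient_pos (by linarith)
        have hN0 : 0 < N t := by
          have : 0 < t + 1 - 2 * d := by linarith
          have : 0 < t + 3 := by linarith
          simp only [hN]
          positivity
        have hD0 : 0 < (t + 4) ^ 3 * (t + 2 - 2 * d) := by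
          have : 0 < t + 4 := by linarith
          have : 0 < t + 2 - 2 * d := by linarith
          positivity
        rw [← hb]
        change ((t + 4) ^ 3 * (t + 2 - 2 * d) * S (t + 2) - N t * S t) * (G t)⁻¹ * (N t)⁻¹ = _
        change G (t + 2) * _ = G t * N t at hg
        have e : S (t + 2) / G (t + 2) = (t + 4) ^ 3 * (t + 2 - 2 * d) * S (t + 2) / (G t * N t) := by
          rw [← hg, div_eq_div_iff g2.ne' (mul_ne_zero g2.ne' hD0.ne')]
          ring
        rw [e]
        field_simp
        ring
      · filter_upwards [eventually_gt_atTop 0] with t ht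
        field_simp
        ring
  have hGO : G =O[atTop] fun t => 1 / t ^ (2 * d + 4) := by
    have h1 := (hGlim.isBigO_one ℝ).mul (isBigO_refl (fun t : ℝ => 1 / t ^ (2 * d + 4)) atTop)
    refine h1.congr' ?_ (Eventually.of_forall fun t => one_mul _)
    filter_upwards [eventually_gt_atTop 0] with t ht
    field_simp
    rfl
  refine ((hv.mul hGO).neg_left).congr' ?_ ?_
  · filter_upwards [eventually_gt_atTop (2 * (d : ℝ))] with t ht
    have g1 : 0 < G t := gammaQuotient_pos ht
    field_simp
    ring
  · filter_upwards [eventually_gt_atTop 0] with t ht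
    field_simp
    ring

theorem coeff_C_mul_invPochhammer (c : ℚ) (a : ℤ) {m n : ℕ} (h : n < m) :
    PowerSeries.coeff n (PowerSeries.C c * invPochhammer a m) = 0 := by
  rw [PowerSeries.coeff_C_mul, coeff_invPochhammer_of_lt _ h, mul_zero]

theorem hasInvExpansion_gammaQuotient (d : ℕ) :
    HasInvExpansion atTop (fun t : ℝ => t) (gammaQuotient d) ((formalSum fun j =>
      PowerSeries.C (aCoeff d j) * invPochhammer (1 - 2 * (d : ℤ) - (j : ℤ)) (2 * d + 2 * j + 2)).map
        (algebraMap ℚ ℝ)) := by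
  refine HasInvExpansion.of_approx fun N => ⟨partialP d (N + 1), _, hasInvExpansion_partialP d (N + 1),
    (gammaQuotient_sub_partialP (by omega)).trans
      (isBigO_one_div_pow_of_le tendsto_id (by omega)), fun k hk => ?_⟩
  rw [PowerSeries.coeff_map, PowerSeries.coeff_map, seriesP, coeff_sum_eq_coeff_formalSum
    (fun j n h => coeff_C_mul_invPochhammer _ _ (by omega)) (by omega)]

end GammaExpansion

/-! ### Normalized two-point numbers: increments and limit -/

section TwoPointLimit

open Filter Asymptotics Topology

/-- The normalization of the two-point numbers with `X = 2n`. -/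
noncomputable def pairNorm (n : ℕ) : ℝ :=
  Real.Gamma n * Real.Gamma (n + 1) ^ 2 / (√Real.pi ^ 3 * Real.Gamma (n + 3 / 2))

theorem pairNorm_pos {n : ℕ} (hn : 1 ≤ n) : 0 < pairNorm n := by
  have h : (0 : ℝ) < n := by exact_mod_cast hn
  have h1 := Real.Gamma_pos_of_pos h
  have h2 := Real.Gamma_pos_of_pos (show 0 < (n : ℝ) + 1 by linarith)
  have h3 := Real.Gamma_pos_of_pos (show 0 < (n : ℝ) + 3 / 2 by linarith)
  have h4 := Real.sqrt_pos.2 Real.pi_pos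
  unfold pairNorm
  positivity

theorem pairNorm_succ {n : ℕ} (hn : 1 ≤ n) :
    pairNorm (n + 1) * (n + 3 / 2) = pairNorm n * (n * (n + 1) ^ 2) := by
  have h : (0 : ℝ) < n := by exact_mod_cast hn
  have h3 := Real.Gamma_pos_of_pos (show 0 < (n : ℝ) + 3 / 2 by linarith)
  have h4 := Real.sqrt_pos.2 Real.pi_pos
  rw [pairNorm, pairNorm, Nat.cast_succ, Real.Gamma_add_one (show (n : ℝ) + 1 ≠ 0 by linarith),
    Real.Gamma_add_one h.ne', show (n : ℝ) + 1 + 3 / 2 = n + 3 / 2 + 1 by ring,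
    Real.Gamma_add_one (show (n : ℝ) + 3 / 2 ≠ 0 by linarith)]
  field_simp

/-- Here X = 2n with n = d+e+1, and the duplication formula for Γ absorbs (X-1)! and the power of 2
into Gamma values at n and at half-integer shifts. -/
theorem Chat_pair (d e : ℕ) : Chat [d, e] = (B [d, e] : ℝ) / pairNorm (d + e + 1) := by
  set n := d + e + 1 with hn
  have hX : bigX [d, e] = 2 * n := by simp [bigX, hn]; ring
  have hsum : 2 * [d, e].sum + 1 = 2 * n - 1 := by simp [hn]; omega
  have h : (0 : ℝ) < n := by rw [hn]; positivity
  have g1 := Real.Gamma_pos_of_pos h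
  have g2 := Real.Gamma_pos_of_pos (show 0 < (n : ℝ) + 1 by linarith)
  have g3 := Real.Gamma_pos_of_pos (show 0 < (n : ℝ) + 3 / 2 by linarith)
  have g4 := Real.Gamma_pos_of_pos (show 0 < (n : ℝ) + 1 / 2 by linarith)
  have h4 := Real.sqrt_pos.2 Real.pi_pos
  have hp : √Real.pi ^ 2 = Real.pi := Real.sq_sqrt Real.pi_pos.le
  have hC : C [d, e] = 2 ^ (2 * n - 1) * B [d, e] / ((2 * n - 1)! : ℚ) := by
    rw [C, number, hX, hsum]
    have : (([d, e].map fun k => ((2 * k + 1)‼ : ℚ)).prod) ≠ 0 := by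
      have h1 : ∀ k : ℕ, ((2 * k + 1)‼ : ℚ) ≠ 0 := fun k => by
        exact_mod_cast (Nat.doubleFactorial_pos _).ne'
      simp [h1]
    field_simp
  have hfac : (((2 * n - 1)! : ℕ) : ℝ) = Real.Gamma (2 * n) := by
    rw [← Real.Gamma_nat_eq_factorial]
    congr 1
    rw [Nat.cast_sub (by omega)]
    push_cast
    ring
  have hdup := Real.Gamma_mul_Gamma_add_half n
  have hpow : (2 : ℝ) ^ (1 - 2 * (n : ℝ)) * 2 ^ (2 * n - 1) = 1 := by
    rw [← Real.rpow_natCast, ← Real.rpow_add (by norm_num), Nat.cast_sub (by omega)]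
    push_cast
    rw [show 1 - 2 * (n : ℝ) + (2 * n - 1) = 0 by ring, Real.rpow_zero]
  have g5 := Real.Gamma_pos_of_pos (show 0 < 2 * (n : ℝ) by linarith)
  rw [Chat, hC, hX, gammaFun, pairNorm]
  push_cast
  rw [hfac, show 2 * (n : ℝ) / 2 + 1 = n + 1 by ring, show (2 * (n : ℝ) + 1) / 2 = n + 1 / 2 by ring,
    show (2 * (n : ℝ) + 3) / 2 = n + 3 / 2 by ring]
  have key : (2 : ℝ) ^ (2 * n - 1) * (Real.Gamma n * Real.Gamma (n + 1 / 2)) =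
      Real.Gamma (2 * n) * √Real.pi := by
    rw [hdup]
    linear_combination Real.Gamma (2 * n) * √Real.pi * hpow
  rw [show √Real.pi ^ 3 = √Real.pi * Real.pi by rw [pow_succ, hp]; ring]
  generalize (2 : ℝ) ^ (2 * n - 1) = q at *
  have hpi := Real.pi_pos
  generalize Real.Gamma ((n : ℝ) + 1 / 2) = u at *
  generalize Real.Gamma (2 * (n : ℝ)) = w at *
  rw [div_div, div_div_eq_mul_div, div_eq_div_iff (by positivity) (by positivity)]
  field_simp
  linear_combination (B [d, e] : ℝ) * key

theorem alphaCoeff_eq_gamma (k : ℕ) : (alphaCoeff k : ℝ) =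
    Real.Gamma (k + 1 / 2) ^ 3 / (√Real.pi ^ 3 * Real.Gamma (k + 1)) := by
  have h4 := Real.sqrt_pos.2 Real.pi_pos
  induction k with
  | zero =>
    simp only [alphaCoeff, Nat.cast_zero, zero_add]
    rw [Real.Gamma_one_half_eq, Real.Gamma_one]
    push_cast
    field_simp
  | succ k ih =>
    have h : (0 : ℝ) ≤ k := k.cast_nonneg
    have g2 := Real.Gamma_pos_of_pos (show 0 < (k : ℝ) + 1 by linarith)
    rw [alphaCoeff]
    push_cast
    rw [ih, Real.Gamma_add_one (show (k : ℝ) + 1 ≠ 0 by linarith),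
      show (k : ℝ) + 1 + 1 / 2 = k + 1 / 2 + 1 by ring,
      Real.Gamma_add_one (show (k : ℝ) + 1 / 2 ≠ 0 by linarith)]
    field_simp
    ring

theorem alphaCoeff_succ_eq (d : ℕ) :
    alphaCoeff (d + 1) = ((2 * d + 1)‼ : ℚ) ^ 3 / (8 ^ (d + 1) * ((d + 1)! : ℚ)) := by
  induction d with
  | zero => norm_num [alphaCoeff]
  | succ d ih =>
    rw [alphaCoeff, ih, Nat.factorial_succ (d + 1), show 2 * (d + 1) + 1 = 2 * d + 1 + 2 by ring,
      Nat.doubleFactorial_add_two]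
    push_cast
    have : ((d + 1)! : ℚ) ≠ 0 := by positivity
    field_simp
    ring

/-- The constant `(2d+1)!!³/(2^d d!)`. -/
noncomputable def pairConst (d : ℕ) : ℚ := ((2 * d + 1)‼ : ℚ) ^ 3 / (2 ^ d * (d ! : ℚ))

/-- `pairNorm` solves the homogeneous part of `B_recursion`, so the normalized difference consists
of the inhomogeneous term alone. Its factor 2d+4e+7 equals 2X-2d+3, and the rest is the Gamma
quotient at X. -/
theorem Chat_succ_sub (d e : ℕ) : Chat [d, e + 1] - Chat [d, e] =
    pairConst d * ((2 * (bigX [d, e] : ℝ) - 2 * d + 3) * gammaQuotient d (bigX [d, e])) := by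
  set n := d + e + 1 with hn
  have hX : bigX [d, e] = 2 * n := by simp [bigX, hn]; ring
  have h0 : (0 : ℝ) < n := by rw [hn]; positivity
  have hne : (n : ℝ) = d + e + 1 := by rw [hn]; push_cast; ring
  have hrec := congrArg (fun q : ℚ => (q : ℝ)) (B_recursion d e)
  push_cast at hrec
  have hN := pairNorm_succ (n := n) (by omega)
  have p0 := pairNorm_pos (n := n) (by omega)
  have p1 := pairNorm_pos (n := n + 1) (by omega)
  have hdiff : Chat [d, e + 1] - Chat [d, e] = (2 * d + 4 * e + 7) * ((d + 1) * alphaCoeff (d + 1)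
      * alphaCoeff (e + 1)) / ((n + 1) * (2 * n + 3) * pairNorm (n + 1)) := by
    rw [Chat_pair, Chat_pair, show d + (e + 1) + 1 = n + 1 by omega, ← hn,
      div_sub_div _ _ p1.ne' p0.ne', div_eq_div_iff (by positivity) (by positivity)]
    have e1 : ((n : ℝ) + 1) * (2 * n + 3) * (B [d, e + 1] : ℝ) = 2 * (n + 1) ^ 3 * n * (B [d, e] : ℝ)
        + (2 * d + 4 * e + 7) * ((d + 1) * alphaCoeff (d + 1) * alphaCoeff (e + 1)) := by
      rw [hne]
      linear_combination hrec
    linear_combination pairNorm (n + 1) * pairNorm n * e1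
      - 2 * pairNorm (n + 1) * (B [d, e] : ℝ) * (n + 1) * hN
  have hc : ((d : ℝ) + 1) * alphaCoeff (d + 1) = pairConst d / 2 ^ (2 * d + 3) := by
    have : ((d : ℚ) + 1) * alphaCoeff (d + 1) = pairConst d / 2 ^ (2 * d + 3) := by
      rw [alphaCoeff_succ_eq, pairConst, Nat.factorial_succ]
      push_cast
      have : (d ! : ℚ) ≠ 0 := by positivity
      rw [show (8 : ℚ) ^ (d + 1) = 2 ^ d * 2 ^ (2 * d + 3) by
        rw [show (8 : ℚ) = 2 ^ 3 by norm_num, ← pow_mul, ← pow_add]; congr 1; ring]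
      field_simp
    have := congrArg (fun q : ℚ => (q : ℝ)) this
    push_cast at this
    exact this
  have g1 := Real.Gamma_pos_of_pos (show 0 < (n : ℝ) + 3 / 2 by linarith)
  have g2 := Real.Gamma_pos_of_pos (show 0 < (n : ℝ) + 1 by linarith)
  have g3 := Real.Gamma_pos_of_pos (show 0 < (e : ℝ) + 1 + 1 by positivity)
  have h4 := Real.sqrt_pos.2 Real.pi_pos
  rw [hdiff, hX, gammaQuotient, hc, alphaCoeff_eq_gamma, pairNorm]
  push_cast
  rw [show (2 * (n : ℝ) + 1) / 2 - d = e + 1 + 1 / 2 by rw [hne]; ring,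
    show (2 * (n : ℝ) + 3) / 2 = n + 3 / 2 by ring, show 2 * (n : ℝ) / 2 + 2 = n + 1 + 1 by ring,
    show 2 * (n : ℝ) / 2 - d + 1 = e + 1 + 1 by rw [hne]; ring,
    show (n : ℝ) + 1 + 3 / 2 = n + 3 / 2 + 1 by ring,
    Real.Gamma_add_one (show (n : ℝ) + 3 / 2 ≠ 0 by linarith),
    Real.Gamma_add_one (show (n : ℝ) + 1 ≠ 0 by linarith),
    show 2 * (2 * (n : ℝ)) - 2 * d + 3 = 2 * d + 4 * e + 7 by rw [hne]; ring,
    show (2 : ℝ) ^ (2 * d + 4) = 2 ^ (2 * d + 3) * 2 by rw [← pow_succ]]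
  generalize Real.Gamma ((n : ℝ) + 3 / 2) = u1 at *
  generalize Real.Gamma ((n : ℝ) + 1) = u2 at *
  generalize Real.Gamma ((e : ℝ) + 1 + 1 / 2) = u3 at *
  generalize Real.Gamma ((e : ℝ) + 1 + 1) = u4 at *
  generalize 2 * (d : ℝ) + 4 * e + 7 = z
  have hn3 : (n : ℝ) + 3 / 2 ≠ 0 := by linarith
  field_simp

/-- The closed form of B(0,e) gives Ĉ(0,e) = (ρ(n)⁴/n²)(1 + 1/(2n)) with n = e+1 and ρ(n) =
Γ(n+½)/Γ(n). -/
theorem tendsto_Chat_zero : Tendsto (fun e => Chat [0, e]) atTop (𝓝 1) := by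
  have h1 := tendsto_gammaRatio_pow_four.comp ((tendsto_natCast_atTop_atTop (R := ℝ)).comp
    (tendsto_add_atTop_nat 1))
  have h2 : Tendsto (fun y : ℝ => 1 + 1 / 2 * y⁻¹) atTop (𝓝 1) := by
    have := ((tendsto_inv_atTop_zero (𝕜 := ℝ)).const_mul (1 / 2)).const_add 1
    simpa using this
  have h3 := h2.comp ((tendsto_natCast_atTop_atTop (R := ℝ)).comp (tendsto_add_atTop_nat 1))
  have h4 := h1.mul h3
  rw [mul_one] at h4
  refine h4.congr fun e => ?_
  simp only [Function.comp_apply]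
  rw [Chat_pair, B_zero_left, alphaCoeff_eq_gamma, zero_add, pairNorm, gammaRatio]
  set n : ℝ := ((e + 1 : ℕ) : ℝ) with hn
  have h0 : 0 < n := by rw [hn]; positivity
  have g1 := Real.Gamma_pos_of_pos h0
  have g2 := Real.Gamma_pos_of_pos (show 0 < n + 1 / 2 by linarith)
  have h4 := Real.sqrt_pos.2 Real.pi_pos
  rw [show n + 3 / 2 = n + 1 / 2 + 1 by ring, Real.Gamma_add_one (show n + 1 / 2 ≠ 0 by linarith),
    Real.Gamma_add_one h0.ne']
  field_simp
  try ring

theorem pairNorm_le {m n : ℕ} (hm : 1 ≤ m) (h : m ≤ n) : pairNorm m ≤ pairNorm n := by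
  induction n, h using Nat.le_induction with
  | base => exact le_rfl
  | succ n hn ih =>
    have h1 : (1 : ℝ) ≤ n := by exact_mod_cast hm.trans hn
    have h2 := pairNorm_succ (hm.trans hn)
    have h3 := pairNorm_pos (hm.trans hn)
    refine ih.trans ?_
    have h4 : (n : ℝ) + 3 / 2 ≤ n * (n + 1) ^ 2 := by nlinarith [mul_nonneg (by linarith : (0:ℝ) ≤ n) (sq_nonneg ((n : ℝ)))]
    have h5 := mul_le_mul_of_nonneg_left h4 h3.le
    rw [← h2] at h5
    exact le_of_mul_le_mul_right h5 (by linarith)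

theorem alphaCoeff_nonneg (k : ℕ) : 0 ≤ alphaCoeff k := by
  induction k with
  | zero => norm_num [alphaCoeff]
  | succ k ih => rw [alphaCoeff]; positivity

/-- The limit is passed from d to d+1: Ĉ(d,e+1) and Ĉ(d+1,e) have the same normalization, and by
`B_difference` they differ by at most a constant times Ĉ(0,e)/(e+1). -/
theorem tendsto_Chat (d : ℕ) : Tendsto (fun e => Chat [d, e]) atTop (𝓝 1) := by
  induction d with
  | zero => exact tendsto_Chat_zero
  | succ d ih =>
    have h1 := ih.comp (tendsto_add_atTop_nat 1)
    have h2 : Tendsto (fun e : ℕ => (alphaCoeff (d + 1) : ℝ) * (Chat [0, e] * (1 / ((e : ℝ) + 1))))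
        atTop (𝓝 0) := by
      have := (tendsto_Chat_zero.mul (tendsto_one_div_add_atTop_nhds_zero_nat (𝕜 := ℝ))).const_mul
        (alphaCoeff (d + 1) : ℝ)
      simpa using this
    have h3 : Tendsto (fun e : ℕ => Chat [d, e + 1] - Chat [d + 1, e]) atTop (𝓝 0) := by
      refine squeeze_zero_norm (fun e => ?_) h2
      have hB := congrArg (fun q : ℚ => (q : ℝ)) (B_difference d e)
      push_cast at hB
      have p0 := pairNorm_pos (n := e + 1) (by omega)
      have p1 := pairNorm_pos (n := d + e + 2) (by omega)
      have a0 : (0 : ℝ) ≤ alphaCoeff (d + 1) := by exact_mod_cast alphaCoeff_nonneg _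
      have a1 : (0 : ℝ) ≤ alphaCoeff (e + 1) := by exact_mod_cast alphaCoeff_nonneg _
      rw [Chat_pair, Chat_pair, Chat_pair, B_zero_left, zero_add, show d + (e + 1) + 1 = d + e + 2 by ring,
        show d + 1 + e + 1 = d + e + 2 by ring, ← sub_div, hB, Real.norm_eq_abs, abs_div,
        abs_of_pos p1, abs_mul, abs_of_nonneg (mul_nonneg a0 a1)]
      have hq : |((d : ℝ) - e) / (d + e + 2)| ≤ 1 := by
        rw [abs_div, abs_of_pos (show (0 : ℝ) < d + e + 2 by positivity), div_le_one (by positivity)]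
        have := d.cast_nonneg (α := ℝ)
        have := e.cast_nonneg (α := ℝ)
        exact abs_le.2 ⟨by linarith, by linarith⟩
      -- One step of the recursion of `pairNorm` already gains the factor e+1; the remaining steps
      -- only increase it.
      have hN : pairNorm (e + 1) * (e + 1) ≤ pairNorm (d + e + 2) := by
        refine le_trans ?_ (pairNorm_le (m := e + 2) (by omega) (by omega))
        have h2 := pairNorm_succ (n := e + 1) (by omega)
        push_cast at h2
        have he := e.cast_nonneg (α := ℝ)
        have h4 : (e : ℝ) + 1 + 3 / 2 ≤ (e + 1 + 1) ^ 2 := by nlinarith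
        have h5 := mul_le_mul_of_nonneg_left h4 (by positivity : 0 ≤ pairNorm (e + 1) * (e + 1))
        refine le_of_mul_le_mul_right (h5.trans (le_of_eq ?_)) (by linarith : (0 : ℝ) < e + 1 + 3 / 2)
        rw [show e + 2 = e + 1 + 1 by ring, h2]
        ring
      calc |((d : ℝ) - e) / (d + e + 2)| * (alphaCoeff (d + 1) * alphaCoeff (e + 1)) / pairNorm (d + e + 2)
          ≤ 1 * (alphaCoeff (d + 1) * alphaCoeff (e + 1)) / pairNorm (d + e + 2) := by
            gcongr
        _ ≤ 1 * (alphaCoeff (d + 1) * alphaCoeff (e + 1)) / (pairNorm (e + 1) * (e + 1)) := by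
            gcongr
        _ = _ := by field_simp
    have h4 := h1.sub h3
    rw [sub_zero] at h4
    refine h4.congr fun e => ?_
    simp only [Function.comp_apply]
    ring

end TwoPointLimit

/-! ### Expansion of 1 - Ĉ -/

section TwoPointExpansion

open Filter Asymptotics Topology

/-- The coefficients of the expansion of `1 - Ĉ(d, X/2-1-d)`. -/
noncomputable def pairCoeff (d j : ℕ) : ℚ :=
  ((2 * d + 1)‼ : ℚ) ^ 3 / (2 ^ (d + 1) * (d ! : ℚ)) * (aCoeff d j / ((d : ℚ) + (j : ℚ)))

theorem pairCoeff_mul (d : ℕ) {j : ℕ} (hj : 1 ≤ j) :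
    (pairCoeff d j : ℝ) * (2 * ((d : ℝ) + j)) = pairConst d * aCoeff d j := by
  have h : pairCoeff d j * (2 * ((d : ℚ) + j)) = pairConst d * aCoeff d j := by
    have h1 : (0 : ℚ) < j := by exact_mod_cast hj
    have h2 : (d : ℚ) + j ≠ 0 := by positivity
    have h3 : (d ! : ℚ) ≠ 0 := by positivity
    rw [pairCoeff, pairConst, pow_succ (2 : ℚ)]
    field_simp
  exact_mod_cast h

theorem bigX_pair_cast (d e : ℕ) : (bigX [d, e] : ℝ) = 2 * e + (2 * d + 2) := by
  rw [show bigX [d, e] = 2 * e + (2 * d + 2) by simp [bigX]; ring]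
  push_cast
  ring

theorem tendsto_bigX_pair (d : ℕ) : Tendsto (fun e : ℕ => (bigX [d, e] : ℝ)) atTop atTop := by
  simp only [bigX_pair_cast]
  exact tendsto_atTop_add_const_right _ _
    (tendsto_natCast_atTop_atTop.const_mul_atTop (by norm_num))

/-- The partial sums of the two-point series. -/
noncomputable def seriesP' (d J : ℕ) : PowerSeries ℚ := ∑ j ∈ Finset.Icc 1 J,
  PowerSeries.C (pairCoeff d j) * invPochhammer (1 - 2 * (d : ℤ) - (j : ℤ)) (2 * d + 2 * j)

/-- The functions with expansions `seriesP'`. -/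
noncomputable def partialP' (d J : ℕ) (t : ℝ) : ℝ :=
  ∑ j ∈ Finset.Icc 1 J, (pairCoeff d j : ℝ) * invP' d j t

theorem hasInvExpansion_partialP' (d J : ℕ) :
    HasInvExpansion atTop (fun e : ℕ => (bigX [d, e] : ℝ)) (fun e => partialP' d J (bigX [d, e]))
      ((seriesP' d J).map (algebraMap ℚ ℝ)) := by
  rw [seriesP', map_sum]
  refine HasInvExpansion.sum _ fun j _ => ?_
  rw [map_mul, PowerSeries.map_C]
  exact (hasInvExpansion_invRising (tendsto_bigX_pair d) _ _).const_mul _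

theorem tendsto_partialP' (d J : ℕ) :
    Tendsto (fun e : ℕ => partialP' d J (bigX [d, e])) atTop (𝓝 0) := by
  have h := (hasInvExpansion_partialP' d J).isBigO_of_coeff_eq_zero (m := 1) ?_
  · refine h.trans_tendsto ?_
    simp only [pow_one, one_div]
    exact tendsto_inv_atTop_zero.comp (tendsto_bigX_pair d)
  · intro k hk
    rw [PowerSeries.coeff_map, seriesP', map_sum, Finset.sum_eq_zero, map_zero]
    intro j hj
    rw [Finset.mem_Icc] at hj
    exact coeff_C_mul_invPochhammer _ _ (by omega)

theorem partialP'_sub (d J : ℕ) {t : ℝ} (ht : 2 * (d : ℝ) + J < t) :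
    partialP' d J t - partialP' d J (t + 2)
      = pairConst d * ((2 * t - 2 * d + 3) * partialP d J t) := by
  rw [partialP', partialP', ← Finset.sum_sub_distrib, partialP, Finset.mul_sum, Finset.mul_sum]
  refine Finset.sum_congr rfl fun j hj => ?_
  rw [Finset.mem_Icc] at hj
  have hjJ : (j : ℝ) ≤ J := by exact_mod_cast hj.2
  rw [← mul_sub, invP'_sub d j (by linarith)]
  linear_combination ((2 * t - 2 * d + 3) * invP d j t) * pairCoeff_mul d hj.1

/-- The increments of 1 - Ĉ and of the partial sum carry the same factor in front of the Gamma
quotient and of its approximation, so they differ by O(X · X^{-(2d+2J+4)}). Both functions tend to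
0, and telescoping costs one power of X. -/
theorem one_sub_Chat_sub_partialP' (d : ℕ) {J : ℕ} (hJ : 1 ≤ J) :
    (fun e : ℕ => (1 - Chat [d, e]) - partialP' d J (bigX [d, e])) =O[atTop]
      fun e : ℕ => 1 / (bigX [d, e] : ℝ) ^ (2 * d + 2 * J + 2) := by
  have key := isBigO_nat_of_telescoping (m := 2 * d + 2 * J + 2) (b := 2 * (d : ℝ) + 2)
    (u := fun e : ℕ => (1 - Chat [d, e]) - partialP' d J (bigX [d, e])) (by omega) ?_ ?_
  · simpa only [bigX_pair_cast] using key
  · have h := ((tendsto_Chat d).const_sub 1).sub (tendsto_partialP' d J)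
    rwa [sub_self, sub_zero] at h
  · simp only [← bigX_pair_cast]
    have h1 := (gammaQuotient_sub_partialP (d := d) hJ).comp_tendsto (tendsto_bigX_pair d)
    have h2 : (fun e : ℕ => (pairConst d : ℝ) * (2 * (bigX [d, e] : ℝ) - 2 * d + 3)) =O[atTop]
        fun e : ℕ => (bigX [d, e] : ℝ) := by
      refine IsBigO.const_mul_left (IsBigO.of_bound 5 (Eventually.of_forall fun e => ?_)) _
      have he := e.cast_nonneg (α := ℝ)
      have hd := d.cast_nonneg (α := ℝ)
      rw [bigX_pair_cast, Real.norm_of_nonneg (by linarith), Real.norm_of_nonneg (by linarith)]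
      linarith
    refine (h2.mul h1).neg_left.congr' ?_ ?_
    · filter_upwards [(tendsto_bigX_pair d).eventually_gt_atTop (2 * (d : ℝ) + J)] with e he
      have e1 := Chat_succ_sub d e
      have e2 := partialP'_sub d J he
      have e3 : (bigX [d, e + 1] : ℝ) = bigX [d, e] + 2 := by
        rw [bigX_pair_cast, bigX_pair_cast]
        push_cast
        ring
      simp only [Function.comp_apply]
      rw [e3]
      linear_combination e1 - e2
    · refine Eventually.of_forall fun e => ?_
      have he : (0 : ℝ) < bigX [d, e] := by rw [bigX_pair_cast]; positivity
      simp only [Function.comp_apply]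
      field_simp
      ring

theorem hasInvExpansion_one_sub_Chat (d : ℕ) :
    HasInvExpansion atTop (fun e : ℕ => (bigX [d, e] : ℝ)) (fun e : ℕ => 1 - Chat [d, e])
      ((formalSum fun j => PowerSeries.C (pairCoeff d j) *
        invPochhammer (1 - 2 * (d : ℤ) - (j : ℤ)) (2 * d + 2 * j)).map (algebraMap ℚ ℝ)) := by
  refine HasInvExpansion.of_approx fun N => ⟨_, _, hasInvExpansion_partialP' d (N + 1),
    (one_sub_Chat_sub_partialP' d (by omega)).trans
      (isBigO_one_div_pow_of_le (tendsto_bigX_pair d) (by omega)), fun k hk => ?_⟩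
  rw [PowerSeries.coeff_map, PowerSeries.coeff_map, seriesP', coeff_sum_eq_coeff_formalSum
    (fun j n h => coeff_C_mul_invPochhammer _ _ (by omega)) (by omega)]

end TwoPointExpansion

/-! ### The polynomials A_j and the final statement -/

/-- The polynomials `A_j`. -/
noncomputable def aPoly (j : ℕ) : Polynomial ℚ :=
  ∑ l ∈ Finset.range ((j + 1) / 2 + 1), Polynomial.C ((-1) ^ (j - 1) * ((j - 1)! : ℚ) *
    (((2 * l - 1)‼ : ℚ) / (8 ^ l * (l ! : ℚ) ^ 3) * rising ((j : ℚ) - 2 * (l : ℚ)) (2 * l))) *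
    (ascPochhammer ℚ (j - 1)).comp (Polynomial.X + Polynomial.C (3 / 2 - (l : ℚ)))

theorem eval_aPoly (j : ℕ) (x : ℚ) : (aPoly j).eval x = aCoeff x j := by
  rw [aPoly, Polynomial.eval_finsetSum, aCoeff]
  refine Finset.sum_congr rfl fun l _ => ?_
  rw [Polynomial.eval_mul, Polynomial.eval_C, Polynomial.eval_comp, Polynomial.eval_add,
    Polynomial.eval_X, Polynomial.eval_C, aTerm, ← add_sub_assoc]
  ring

end BGW

theorem proposition7p1 :
    ∃ A : ℕ → Polynomial ℚ,
      -- the polynomials are the ones determined by the expansion of the Gamma quotient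
      (∀ d : ℕ, 1 ≤ d → ∃ R : PowerSeries ℚ,
        (∀ V : PowerSeries ℝ,
          BGW.HasInvExpansion Filter.atTop (fun x : ℝ => x)
            (fun x : ℝ => 1 / 2 ^ (2 * d + 4) *
              (Real.Gamma ((x + 1) / 2 - d) ^ 3 * Real.Gamma ((x + 3) / 2) /
                (Real.Gamma (x / 2 + 2) ^ 3 * Real.Gamma (x / 2 - d + 1)))) V
            ↔ V = R.map (algebraMap ℚ ℝ)) ∧
        (∀ a : ℕ → ℚ,
          BGW.IsFormalSum (fun j => PowerSeries.C (a j) *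
              BGW.invPochhammer (1 - 2 * (d : ℤ) - (j : ℤ)) (2 * d + 2 * j + 2)) R
            ↔ ∀ j : ℕ, 1 ≤ j → a j = (A j).eval (d : ℚ))) ∧
      -- the closed formula
      (∀ j : ℕ, 1 ≤ j → ∀ x : ℚ,
        (A j).eval x = (-1) ^ (j - 1) * ((j - 1)! : ℚ) *
          ∑ l ∈ Finset.range ((j + 1) / 2 + 1),
            ((2 * l - 1)‼ : ℚ) / (8 ^ l * (l ! : ℚ) ^ 3) *
              (ascPochhammer ℚ (2 * l)).eval ((j : ℚ) - 2 * (l : ℚ)) *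
              (ascPochhammer ℚ (j - 1)).eval (x + 3 / 2 - (l : ℚ))) ∧
      -- the series `W_d(X)`: it exists, is unique, has order at least `2d + 2`, and is explicit
      (∀ d : ℕ, 1 ≤ d → ∃ W : PowerSeries ℚ,
        (∀ V : PowerSeries ℝ,
          BGW.HasInvExpansion Filter.atTop (fun e : ℕ => (BGW.bigX [d, e] : ℝ))
            (fun e : ℕ => 1 - BGW.Chat [d, e]) V
            ↔ V = W.map (algebraMap ℚ ℝ)) ∧
        PowerSeries.X ^ (2 * d + 2) ∣ W ∧
        BGW.IsFormalSum (fun j =>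
          PowerSeries.C (((2 * d + 1)‼ : ℚ) ^ 3 / (2 ^ (d + 1) * (d ! : ℚ)) *
              ((A j).eval (d : ℚ) / ((d : ℚ) + (j : ℚ)))) *
            BGW.invPochhammer (1 - 2 * (d : ℤ) - (j : ℤ)) (2 * d + 2 * j)) W) := by
  refine ⟨BGW.aPoly, fun d _ => ⟨BGW.formalSum fun j => PowerSeries.C (BGW.aCoeff d j) *
    BGW.invPochhammer (1 - 2 * (d : ℤ) - (j : ℤ)) (2 * d + 2 * j + 2), fun V => ?_, fun a => ?_⟩,
    fun j _ x => ?_, fun d _ => ⟨BGW.formalSum fun j => PowerSeries.C (BGW.pairCoeff d j) *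
      BGW.invPochhammer (1 - 2 * (d : ℤ) - (j : ℤ)) (2 * d + 2 * j), fun V => ?_, ?_, ?_⟩⟩
  · exact BGW.hasInvExpansion_iff_eq Filter.tendsto_id (BGW.hasInvExpansion_gammaQuotient d)
  -- Uniqueness of the A_j(d) is the triangularity of the symbols, whose orders are 2d+2+2j.
  · simp only [BGW.eval_aPoly]
    refine BGW.isFormalSum_iff (s := 2 * d + 2) (p := fun j => BGW.invPochhammer
      (1 - 2 * (d : ℤ) - (j : ℤ)) (2 * d + 2 * j + 2)) (fun j n h => ?_) (fun j => ?_) _ _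
    · exact BGW.coeff_invPochhammer_of_lt _ (by omega)
    · rw [show 2 * d + 2 + 2 * j = 2 * d + 2 * j + 2 by ring]
      exact BGW.coeff_invPochhammer_self _ _
  · rw [BGW.eval_aPoly, BGW.aCoeff, Finset.mul_sum]
    rfl
  · exact BGW.hasInvExpansion_iff_eq (BGW.tendsto_bigX_pair d) (BGW.hasInvExpansion_one_sub_Chat d)
  · rw [PowerSeries.X_pow_dvd_iff]
    intro m hm
    rw [BGW.formalSum, PowerSeries.coeff_mk, map_sum]
    refine Finset.sum_eq_zero fun j hj => ?_
    rw [Finset.mem_Icc] at hj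
    exact BGW.coeff_C_mul_invPochhammer _ _ (by omega)
  · simp only [BGW.eval_aPoly]
    exact BGW.isFormalSum_formalSum fun j n h => BGW.coeff_C_mul_invPochhammer _ _ (by omega)
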